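/- **Setting.** Consider $\min_{x\in X} f_0(x)=g(x)+h(x)$ subject to $f_i(x)\le 0$, $i=1,\dots,m$, where $X\subseteq\mathbb R^n$ is closed and convex, $h$ is convex with values in $\mathbb R\cup\{+\infty\}$, $h+\iota_X$ is closed, and $C=\mathrm{dom}(h)\cap X$ is bounded with diameter $D$. Let $\mu\ge 0$. For a set $A\subseteq\mathbb R^n$ we say that *the smooth part is regular on $A$* with constants $L_0,L_i,B_i$ if on $A$ the functions $g,f_1,\dots,f_m$ are differentiable and convex, $g$ is strongly convex with modulus $\mu$ (just convex if $\mu=0$), $\nabla g$ and $\nabla f_i$ are Lipschitz with constants $L_0$ and $L_i$, and $|f_i|\le B_i$, $\|\nabla f_i\|\le B_i$. Assume that there is a KKT point $(x^*,z^*)$, so that $f_0(x^*)=f_0^*$ is the optimal value. Put $$\mathcal L_\beta(x,z)=f_0(x)+\sum_{i=1}^m\psi_\beta(f_i(x),z_i),\qquad \psi_\beta(u,v)=\begin{cases}uv+\frac\beta2u^2,&\beta u+v\ge0,\\-\frac{v^2}{2\beta},&\beta u+v<0.\end{cases}$$ **Method.** Let $K\ge 1$ be an integer, $C_\beta,C_\varepsilon>0$,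 $\sigma>1$, $\varepsilon>0$, and for $0\le k<K$ let $\beta_k=\beta_g\sigma^k$ with $\beta_g=\frac{C_\beta}{\varepsilon}\frac{\sigma-1}{\sigma^K-1}$. The tolerances are either constant, $\varepsilon_k=\frac\varepsilon2\frac{C_\varepsilon}{C_\beta}$, or adaptive, $$\varepsilon_k=\frac{C_\varepsilon}{2}\frac{1}{\beta_k^{1/3}\sum_{t<K}\beta_t^{2/3}}\ \text{ if }\mu=0,\qquad \varepsilon_k=\frac{C_\varepsilon}{2}\frac{1}{\sqrt{\beta_k}\sum_{t<K}\sqrt{\beta_t}}\ \text{ if }\mu>0 .$$ The inexact augmented Lagrangian method starts with $z^0=0$ and for $0\le k<K$ takes a point $x^{k+1}\in X$ with $\mathcal L_{\beta_k}(x^{k+1},z^k)\le\min_{x\in X}\mathcal L_{\beta_k}(x,z^k)+\varepsilon_k$ and sets $z_i^{k+1}=z_i^k+\beta_k\max(-z_i^k/\beta_k,f_i(x^{k+1}))$. **Theorem.** (1) *Errors.* If the smooth part is regular on $C$, then every sequence generated by the method satisfies $$|f_0(x^K)-f_0(x^*)|\le\frac\varepsilon2\frac{C_\varepsilon}{C_\beta}+\frac{\varepsilon\sigma}{C_\beta(\sigma-1)}\big(2\|z^*\|+\sqrt{C_\varepsilon}\big)\Big(5\|z^*\|+\tfrac72\sqrt{C_\varepsilon}\Big),$$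 $$\|[f(x^K)]_+\|\le\frac{\varepsilon\sigma}{C_\beta(\sigma-1)}\Big(5\|z^*\|+\tfrac72\sqrt{C_\varepsilon}\Big).$$ (2) *Gradient evaluations.* Let $\mu\le L_0/4$, $x^0\in C$, $H=\sum_iB_i(B_i+L_i)$ and $L_*=L_0+\|(L_1,\dots,L_m)\|\,(2\|z^*\|+\sqrt{C_\varepsilon})$. For every $k$, start an inner first-order method at $x^k$ on the problem $\min_{x\in X}\mathcal L_{\beta_k}(x,z^k)$, whose smooth part $\mathcal L_{\beta_k}(\cdot,z^k)-h$ has a gradient with Lipschitz constant $$\ell_k=L_0+\sum_i\big(\beta_kB_i(B_i+L_i)+L_i|z_i^k|\big),$$ and let $x^{k+1}$ be its first iterate within the tolerance $\varepsilon_k$. Let $T_K$ be the total number of inner iterations, each of which evaluates $\nabla g,\nabla f_1,\dots,\nabla f_m$ once. Then all inner loops stop, and $T_K\le\overline T$ with the number $\overline T$ below, in each of the following two situations. (2a) The smooth part is regular on the closed neighbourhood of $C$ of radius $D$, and the inner method is Nesterov's optimal first-order method: for $\min\phi+\psi$ with $\nabla\phi$ $\ell$-Lipschitz and $q=\mu/\ell$,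 it takes $\hat y^0=y^0$, $\alpha_0=1$ if $\mu=0$ and $\alpha_0=\sqrt q$ if $\mu>0$, and $$y^{j+1}\in\arg\min_y\ \langle\nabla\phi(\hat y^j),y\rangle+\tfrac{\ell}{2}\|y-\hat y^j\|^2+\psi(y),\qquad \alpha_{j+1}=\tfrac12\Big(q-\alpha_j^2+\sqrt{(q-\alpha_j^2)^2+4\alpha_j^2}\Big),$$ $$\hat y^{j+1}=y^{j+1}+\frac{\alpha_j(1-\alpha_j)}{\alpha_j^2+\alpha_{j+1}}(y^{j+1}-y^j).$$ (2b) The smooth part is regular on $C$ only, and the inner method is a certain deterministic first-order method that depends only on $X$, $h$ and $\mu$ (not on $g$, the $f_i$ and their constants), that evaluates gradients at points of $C$ only, and that computes each iterate from the Lipschitz constant, the starting point and the gradients received so far. Here, for $\mu=0$ and constant tolerances, $$\overline T=\left\lceil 2D\sqrt{\tfrac{C_\beta}{C_\varepsilon}}\left(K\sqrt{\tfrac{L_*}{\varepsilon}}+\frac{\sqrt{C_\beta H(\sigma-1)}}{\varepsilon(\sqrt\sigma-1)}\right)+K\right\rceil;$$ for $\mu=0$ and adaptive tolerances, $$\overline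 T=\left\lceil 2D\sqrt{\tfrac{C_\beta}{C_\varepsilon}}\left(\sqrt{\tfrac{L_*}{\varepsilon}}\,\frac{(\sigma-1)^{1/2}}{(\sigma^{1/6}-1)(\sigma^{2/3}-1)^{1/2}}+\frac{\sqrt{HC_\beta}(\sigma-1)}{\varepsilon(\sigma^{2/3}-1)^{3/2}}\right)+K\right\rceil;$$ for $\mu>0$, $$\overline T=\left\lceil 2\max(0,G_\varepsilon)\left(K\sqrt{\tfrac{L_*}{\mu}}+\sqrt{\tfrac H\mu}\,\frac{\sqrt{C_\beta(\sigma-1)}}{\sqrt\varepsilon(\sqrt\sigma-1)}\right)+K\right\rceil,$$ where $$G_\varepsilon=\log\frac{C_\beta D^2}{\varepsilon C_\varepsilon}+\log\Big(L_*+\mu+\frac{H(C_\beta(\sigma-1)+\beta_g\varepsilon)}{\sigma\varepsilon}\Big)$$ for constant tolerances, with the additional summand $\log\dfrac{\sqrt{(\sigma-1)^2+\beta_g\varepsilon(\sigma-1)/C_\beta}}{\sigma-\sqrt\sigma}$ for adaptive tolerances (if $D=0$, the first logarithm is read as $0$). (3) *Order.* As $\varepsilon\to0^+$ with all other quantities ($K,C_\beta,C_\varepsilon,\sigma,\mu,L_*,H,D$)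 fixed, $\overline T=O(\varepsilon^{-1})$ if $\mu=0$, and $\overline T=O(\varepsilon^{-1/2}|\log\varepsilon|)$ if $\mu>0$. -/

import Mathlib

open scoped Asymptotics

noncomputable section

namespace IALM

/-- The Euclidean space of dimension `n`. -/
abbrev E (n : ℕ) := EuclideanSpace ℝ (Fin n)

/-! ### The problem `min f₀ = g + h` over `X` subject to `f i ≤ 0` -/

/-- The simple part of the problem: the set `X` and the extended-valued function equal to `h` on its
effective domain `dom` and to `+∞` off `dom`. -/
structure SimplePart (n : ℕ) where
  X : Set (E n)
  dom : Set (E n)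
  h : E n → ℝ

/-- `dom h ∩ X`. -/
def SimplePart.C {n : ℕ} (S : SimplePart n) : Set (E n) := S.dom ∩ S.X

/-- The diameter of `dom h ∩ X`. -/
def SimplePart.D {n : ℕ} (S : SimplePart n) : ℝ := Metric.diam S.C

/-- The closed neighbourhood of `dom h ∩ X` whose radius is the diameter of `dom h ∩ X`. -/
def SimplePart.nbhd {n : ℕ} (S : SimplePart n) : Set (E n) := Metric.cthickening S.D S.C

/-- `X` is closed convex, `h` is convex, `h` plus the indicator of `X` is a closed function
(it has a closed epigraph), and `dom h ∩ X` is bounded. -/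
structure SimplePart.Admissible {n : ℕ} (S : SimplePart n) : Prop where
  isClosed_X : IsClosed S.X
  convex_X : Convex ℝ S.X
  convex_h : ConvexOn ℝ S.dom S.h
  isClosed_epi : IsClosed {p : E n × ℝ | p.1 ∈ S.C ∧ S.h p.1 ≤ p.2}
  bounded : Bornology.IsBounded S.C

/-- The smooth part of the problem. -/
structure SmoothPart (n m : ℕ) where
  g : E n → ℝ
  f : Fin m → E n → ℝ

/-- Lipschitz constants `L₀` of `∇g` and `L i` of `∇f i`, and bounds `B i` of `|f i|`, `‖∇f i‖`. -/
structure Consts (m : ℕ) where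
  L₀ : ℝ
  L : Fin m → ℝ
  B : Fin m → ℝ

/-- On the set `A`, the functions are differentiable and convex (`g` strongly with modulus `μ ≥ 0`,
which is plain convexity for `μ = 0`), with the constants of `c`. -/
structure SmoothPart.RegularOn {n m : ℕ} (P : SmoothPart n m) (A : Set (E n)) (μ : ℝ)
    (c : Consts m) : Prop where
  convex_g : StrongConvexOn A μ P.g
  convex_f : ∀ i, ConvexOn ℝ A (P.f i)
  diff_g : ∀ x ∈ A, DifferentiableAt ℝ P.g x
  diff_f : ∀ i, ∀ x ∈ A, DifferentiableAt ℝ (P.f i) x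
  L₀_nonneg : 0 ≤ c.L₀
  L_nonneg : ∀ i, 0 ≤ c.L i
  lip_g : ∀ x ∈ A, ∀ y ∈ A, ‖gradient P.g x - gradient P.g y‖ ≤ c.L₀ * ‖x - y‖
  lip_f : ∀ i, ∀ x ∈ A, ∀ y ∈ A,
    ‖gradient (P.f i) x - gradient (P.f i) y‖ ≤ c.L i * ‖x - y‖
  bound_f : ∀ i, ∀ x ∈ A, |P.f i x| ≤ c.B i
  bound_grad : ∀ i, ∀ x ∈ A, ‖gradient (P.f i) x‖ ≤ c.B i

/-- The objective `f₀ = g + h`, meaningful on `dom h`. -/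
def obj {n m : ℕ} (S : SimplePart n) (P : SmoothPart n m) (x : E n) : ℝ := P.g x + S.h x

/-- The vector of positive parts of the constraint functions. -/
def violation {n m : ℕ} (P : SmoothPart n m) (x : E n) : E m :=
  WithLp.toLp 2 fun i => max 0 (P.f i x)

/-- The Karush-Kuhn-Tucker conditions: `0 ∈ ∂f₀(x) + N_X(x) + ∑ i, z i • ∇f i (x)`, feasibility,
sign conditions and complementary slackness. -/
structure IsKKT {n m : ℕ} (S : SimplePart n) (P : SmoothPart n m) (x : E n) (z : E m) : Prop where
  mem : x ∈ S.C
  dual_nonneg : ∀ i, 0 ≤ z i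
  feasible : ∀ i, P.f i x ≤ 0
  slack : ∀ i, z i * P.f i x = 0
  stationary : ∃ s ν : E n,
    (∀ u ∈ S.dom, obj S P x + inner ℝ s (u - x) ≤ obj S P u) ∧
    (∀ u ∈ S.X, inner ℝ ν (u - x) ≤ 0) ∧
    s + ν + ∑ i, z i • gradient (P.f i) x = 0

/-! ### The augmented Lagrangian -/

def psi (β u v : ℝ) : ℝ :=
  if 0 ≤ β * u + v then u * v + β / 2 * u ^ 2 else -(v ^ 2 / (2 * β))

/-- The augmented Lagrangian, meaningful on `dom h`. -/
def augLag {n m : ℕ} (S : SimplePart n) (P : SmoothPart n m) (β : ℝ) (z : E m) (x : E n) : ℝ :=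
  obj S P x + ∑ i, psi β (P.f i x) (z i)

/-- The gradient in `x` of the smooth part `g + ∑ i, psi β (f i) (z i)` of the augmented Lagrangian.
One evaluation uses one gradient of `g` and of each `f i`. -/
def gradF {n m : ℕ} (P : SmoothPart n m) (β : ℝ) (z : E m) (x : E n) : E n :=
  gradient P.g x + ∑ i, max 0 (β * P.f i x + z i) • gradient (P.f i) x

/-- The Lipschitz constant of `gradF P β z`. -/
def lipConst {m : ℕ} (c : Consts m) (β : ℝ) (z : E m) : ℝ :=
  c.L₀ + ∑ i, (β * c.B i * (c.B i + c.L i) + c.L i * |z i|)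

/-- `x ∈ X` minimizes the augmented Lagrangian over `X` up to `ε` (the value at `x` is
finite, so that `x` lies in `dom h`). -/
def IsApproxMin {n m : ℕ} (S : SimplePart n) (P : SmoothPart n m) (β : ℝ) (z : E m) (ε : ℝ)
    (x : E n) : Prop :=
  x ∈ S.C ∧ ∀ u ∈ S.C, augLag S P β z x ≤ augLag S P β z u + ε

/-- `K` steps of the inexact augmented Lagrangian method with dual step sizes equal to the
penalties `β k`, tolerances `ε k`, and zero initial multiplier. -/
structure IsALM {n m : ℕ} (S : SimplePart n) (P : SmoothPart n m) (β ε : ℕ → ℝ) (K : ℕ)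
    (x : ℕ → E n) (z : ℕ → E m) : Prop where
  z_zero : z 0 = 0
  x_step : ∀ k < K, IsApproxMin S P (β k) (z k) (ε k) (x (k + 1))
  z_step : ∀ k < K, ∀ i,
    z (k + 1) i = z k i + β k * max (-(z k i) / β k) (P.f i (x (k + 1)))

/-! ### Solvers for the subproblems -/

/-- Nesterov's optimal first-order method for `min φ + h` over `X`, where `G = ∇φ` is
`ℓ`-Lipschitz and `φ` is `μ`-strongly convex, started at `x₀`; `α 0` is `1` if `μ = 0` and
`√(μ / ℓ)` if `μ > 0`. The iterates are `y`, the points where `G` is evaluated are `w`. -/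
structure IsNesterovRun {n : ℕ} (S : SimplePart n) (μ : ℝ) (G : E n → E n) (ℓ : ℝ) (x₀ : E n)
    (y w : ℕ → E n) (α : ℕ → ℝ) : Prop where
  y_zero : y 0 = x₀
  w_zero : w 0 = x₀
  α_zero : α 0 = if μ = 0 then 1 else √(μ / ℓ)
  y_mem : ∀ j, y (j + 1) ∈ S.C
  y_step : ∀ j, ∀ u ∈ S.C,
    inner ℝ (G (w j)) (y (j + 1)) + ℓ / 2 * ‖y (j + 1) - w j‖ ^ 2 + S.h (y (j + 1)) ≤
      inner ℝ (G (w j)) u + ℓ / 2 * ‖u - w j‖ ^ 2 + S.h u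
  α_step : ∀ j, α (j + 1) =
    (μ / ℓ - α j ^ 2 + √((μ / ℓ - α j ^ 2) ^ 2 + 4 * α j ^ 2)) / 2
  w_step : ∀ j, w (j + 1) =
    y (j + 1) + (α j * (1 - α j) / (α j ^ 2 + α (j + 1))) • (y (j + 1) - y j)

/-- A solver maps a gradient map `G`, its Lipschitz constant and a starting point to the
possible sequences of iterates, where `y j` is obtained with `j` evaluations of `G`. -/
abbrev Solver (n : ℕ) := (E n → E n) → ℝ → E n → (ℕ → E n) → Prop

/-- Nesterov's optimal first-order method as a solver. -/
def nesterov {n : ℕ} (S : SimplePart n) (μ : ℝ) : Solver n :=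
  fun G ℓ x₀ y => ∃ w α, IsNesterovRun S μ G ℓ x₀ y w α

/-- A deterministic first-order method: from the Lipschitz constant, the starting point and the list
of all gradients received so far, it computes the next point where the gradient is
requested, and the current iterate. -/
structure FirstOrderMethod (n : ℕ) where
  query : ℝ → E n → List (E n) → E n
  output : ℝ → E n → List (E n) → E n

/-- The gradients received by the method in its first `j` requests. -/
def FirstOrderMethod.history {n : ℕ} (M : FirstOrderMethod n) (G : E n → E n) (ℓ : ℝ) (x₀ : E n) :
    ℕ → List (E n)
  | 0 => []
  | j + 1 => M.history G ℓ x₀ j ++ [G (M.query ℓ x₀ (M.history G ℓ x₀ j))]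

/-- The iterates of a first-order method. -/
def FirstOrderMethod.solver {n : ℕ} (M : FirstOrderMethod n) : Solver n :=
  fun G ℓ x₀ y => ∀ j, y j = M.output ℓ x₀ (M.history G ℓ x₀ j)

/-- In every outer step `k < K`, the solver is started at `x k` on the subproblem and stopped at its
first iterate within the tolerance, the `t k`-th, which becomes `x (k + 1)`. -/
def SolvedBy {n m : ℕ} (S : SimplePart n) (P : SmoothPart n m) (c : Consts m) (R : Solver n)
    (β ε : ℕ → ℝ) (K : ℕ) (x : ℕ → E n) (z : ℕ → E m) (t : ℕ → ℕ) : Prop :=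
  ∀ k < K, ∃ y : ℕ → E n,
    R (gradF P (β k) (z k)) (lipConst c (β k) (z k)) (x k) y ∧
    IsLeast {j | IsApproxMin S P (β k) (z k) (ε k) (y j)} (t k) ∧ x (k + 1) = y (t k)

/-! ### Parameters and bounds -/

/-- The parameters of the method, apart from the accuracy `ε`. -/
structure Params where
  K : ℕ
  Cβ : ℝ
  Cε : ℝ
  σ : ℝ

structure Params.Valid (p : Params) : Prop where
  K_pos : 0 < p.K
  Cβ_pos : 0 < p.Cβ
  Cε_pos : 0 < p.Cε
  one_lt_σ : 1 < p.σ

def Params.βg (p : Params) (ε : ℝ) : ℝ := p.Cβ / ε * ((p.σ - 1) / (p.σ ^ p.K - 1))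

/-- Geometrically increasing penalties. -/
def Params.β (p : Params) (ε : ℝ) (k : ℕ) : ℝ := p.βg ε * p.σ ^ k

/-- The two ways of choosing the tolerances. -/
inductive Rule
  | constant
  | adaptive

/-- The tolerances: constant, or adaptive with a formula that depends on whether `μ = 0`. -/
def Params.tol (p : Params) (ε μ : ℝ) : Rule → ℕ → ℝ
  | .constant, _ => ε / 2 * (p.Cε / p.Cβ)
  | .adaptive, k =>
    if μ = 0 then
      p.Cε / 2 * (1 / (p.β ε k ^ (1 / 3 : ℝ) * ∑ t ∈ Finset.range p.K, p.β ε t ^ (2 / 3 : ℝ)))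
    else
      p.Cε / 2 * (1 / (√(p.β ε k) * ∑ t ∈ Finset.range p.K, √(p.β ε t)))

/-- The constant `H`. -/
def Consts.H {m : ℕ} (c : Consts m) : ℝ := ∑ i, c.B i * (c.B i + c.L i)

/-- The constant `L_*`, where `z` is the optimal multiplier. -/
def Consts.Lstar {m : ℕ} (c : Consts m) (Cε : ℝ) (z : E m) : ℝ :=
  c.L₀ + ‖(WithLp.toLp 2 c.L : E m)‖ * (2 * ‖z‖ + √Cε)

/-- The logarithmic factor `G_ε` in the strongly convex case. -/
def Params.Gε (p : Params) (ε μ Ls H D : ℝ) : Rule → ℝ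
  | .constant =>
    Real.log (p.Cβ * D ^ 2 / (ε * p.Cε)) +
      Real.log (Ls + μ + H * (p.Cβ * (p.σ - 1) + p.βg ε * ε) / (p.σ * ε))
  | .adaptive =>
    Real.log (p.Cβ * D ^ 2 / (ε * p.Cε)) +
      Real.log (Ls + μ + H * (p.Cβ * (p.σ - 1) + p.βg ε * ε) / (p.σ * ε)) +
      Real.log (√((p.σ - 1) ^ 2 + p.βg ε * ε * (p.σ - 1) / p.Cβ) / (p.σ - √p.σ))

/-- The bound for the number of gradient evaluations in the convex case, before rounding up. -/
def Params.boundConvex (p : Params) (ε Ls H D : ℝ) : Rule → ℝ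
  | .constant =>
    2 * D * √(p.Cβ / p.Cε) *
      (p.K * √(Ls / ε) + √(p.Cβ * H * (p.σ - 1)) / (ε * (√p.σ - 1))) + p.K
  | .adaptive =>
    2 * D * √(p.Cβ / p.Cε) *
      (√(Ls / ε) * ((p.σ - 1) ^ (1 / 2 : ℝ) /
          ((p.σ ^ (1 / 6 : ℝ) - 1) * (p.σ ^ (2 / 3 : ℝ) - 1) ^ (1 / 2 : ℝ))) +
        √(H * p.Cβ) * (p.σ - 1) / (ε * (p.σ ^ (2 / 3 : ℝ) - 1) ^ (3 / 2 : ℝ))) + p.K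

/-- The bound for the number of gradient evaluations in the strongly convex case, before rounding
up. -/
def Params.boundStrong (p : Params) (ε μ Ls H D : ℝ) (r : Rule) : ℝ :=
  2 * max 0 (p.Gε ε μ Ls H D r) *
    (p.K * √(Ls / μ) + √(H / μ) * (√(p.Cβ * (p.σ - 1)) / (√ε * (√p.σ - 1)))) + p.K

/-- The bound for the number of gradient evaluations. -/
def Params.evalBound (p : Params) (ε μ Ls H D : ℝ) (r : Rule) : ℤ :=
  if μ = 0 then ⌈p.boundConvex ε Ls H D r⌉ else ⌈p.boundStrong ε μ Ls H D r⌉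

/-- With the subproblems solved by `R`, from every `x₀ ∈ dom h ∩ X` the inexact augmented
Lagrangian method can be run (all inner loops stop), and every run makes at most
`T` gradient evaluations in total. -/
def RunsWithin {n m : ℕ} (S : SimplePart n) (P : SmoothPart n m) (c : Consts m) (R : Solver n)
    (β ε : ℕ → ℝ) (K : ℕ) (T : ℤ) : Prop :=
  ∀ x₀ ∈ S.C,
    (∃ x z t, x 0 = x₀ ∧ IsALM S P β ε K x z ∧ SolvedBy S P c R β ε K x z t) ∧
    ∀ x z t, x 0 = x₀ → IsALM S P β ε K x z → SolvedBy S P c R β ε K x z t →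
      ((∑ k ∈ Finset.range K, t k : ℕ) : ℤ) ≤ T

end IALM

end

open scoped Asymptotics

noncomputable section

namespace IALM

/-! ### First-order inequalities for smooth convex functions -/

/-! Errors. As a function of `u`, `psi β u v` is the maximum over `w ≥ 0` of `w * u - (w - v) ^ 2 /
(2 * β)`, attained at the updated multiplier, so the outer method is an inexact proximal point
iteration on the dual. Comparing the approximate minimizer with `x*` and using the saddle inequality
`f₀(x*) ≤ f₀(x) + ⟨z*, f(x)⟩` gives `‖z' - z*‖² ≤ ‖z - z*‖² + 2βε` (`norm_dual_step_le`). Every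
tolerance rule is normalized so that `∑ β k * ε k = Cε / 2`; hence all multipliers stay within `‖z*‖
+ √Cε` of `z*`. The violation is at most `‖z' - z‖ / β`, the objective error is controlled by the
tolerance and the same quantities, and the last penalty is of order `1 / ε` (`IsALM.errors`).

Counts. Bounded multipliers give `ℓ k ≤ L_* + β k * H` (`lipConst_le`), so it suffices that an inner
solver stops within `iterBound` iterations (`Solver.Reaches`, `runsWithin_of_reaches`) and that
these numbers sum to the stated bound, which is a matter of geometric sums. Both solvers are
analysed through an energy: the objective gap to an arbitrary `u ∈ C` plus a multiple of the squared
distance from an auxiliary point to `u`. For `μ = 0` this yields a gap of order `ℓ D² / j²`; for `μ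
> 0` the energy contracts by `1 - √(μ/ℓ)` per step. Allowing only one extra iteration per outer step
requires a sharp estimate of the first step. Nesterov's extrapolated points leave `C` by at most
`D`; on that neighbourhood the gradient is cocoercive, which sharpens the first step
(`first_step_le_cocoercive`). The second method queries convex combinations of points of `C`, and
its first step is handled by distinguishing how far it lands from `u` (`safeRun_first_le`). -/

theorem deriv_nonpos_of_nonpos_right {ψ : ℝ → ℝ} {s : ℝ} (hψ : HasDerivAt ψ s 0) (h0 : ψ 0 = 0)
    (h : ∀ t, 0 < t → t ≤ 1 → ψ t ≤ 0) : s ≤ 0 := by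
  have h1 : Filter.Tendsto (slope ψ 0) (nhdsWithin 0 (Set.Ioi 0)) (nhds s) :=
    (hasDerivAt_iff_tendsto_slope.1 hψ).mono_left
      (nhdsWithin_mono _ fun t ht => ne_of_gt ht)
  refine le_of_tendsto h1 ?_
  filter_upwards [Ioc_mem_nhdsGT (zero_lt_one (α := ℝ))] with t ht
  rw [slope_def_field, h0, sub_zero, sub_zero]
  exact div_nonpos_of_nonpos_of_nonneg (h t ht.1 ht.2) ht.1.le

theorem hasDerivAt_along {n : ℕ} {f : E n → ℝ} {x d : E n} {t : ℝ}
    (hf : DifferentiableAt ℝ f (x + t • d)) :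
    HasDerivAt (fun τ : ℝ => f (x + τ • d)) (inner ℝ (gradient f (x + t • d)) d) t := by
  have h1 : HasDerivAt (fun τ : ℝ => x + τ • d) d t := by
    simpa using ((hasDerivAt_id t).smul_const d).const_add x
  exact (hf.hasGradientAt.hasFDerivAt.comp_hasDerivAt t h1).congr_deriv (by simp)

theorem _root_.StrongConvexOn.add_inner_gradient_le {n : ℕ} {f : E n → ℝ} {A : Set (E n)} {μ : ℝ}
    (hf : StrongConvexOn A μ f) {x y : E n} (hx : x ∈ A) (hy : y ∈ A)
    (hd : DifferentiableAt ℝ f x) :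
    f x + inner ℝ (gradient f x) (y - x) + μ / 2 * ‖y - x‖ ^ 2 ≤ f y := by
  have h1 : HasDerivAt (fun τ : ℝ => f (x + τ • (y - x))) (inner ℝ (gradient f x) (y - x)) 0 := by
    have := hasDerivAt_along (f := f) (x := x) (d := y - x) (t := 0) (by simpa using hd)
    simpa using this
  have h2 : HasDerivAt (fun τ : ℝ => (1 - τ) * f x + τ * f y
      - τ * (1 - τ) * (μ / 2 * ‖y - x‖ ^ 2)) (f y - f x - μ / 2 * ‖y - x‖ ^ 2) 0 := by
    have e := hasDerivAt_id (0 : ℝ)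
    exact ((((e.const_sub 1).mul_const (f x)).add (e.mul_const (f y))).sub
      ((e.mul (e.const_sub 1)).mul_const (μ / 2 * ‖y - x‖ ^ 2))).congr_deriv (by simp; ring)
  have h3 := deriv_nonpos_of_nonpos_right (h1.sub h2) (by simp) (fun t ht ht1 => by
    have := hf.2 hx hy (sub_nonneg.2 ht1) ht.le (by ring)
    have e : (1 - t) • x + t • y = x + t • (y - x) := by module
    rw [e, norm_sub_rev] at this
    simp only [smul_eq_mul] at this
    simp only [Pi.sub_apply]
    nlinarith)
  linarith

theorem _root_.ConvexOn.add_inner_gradient_le {n : ℕ} {f : E n → ℝ} {A : Set (E n)}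
    (hf : ConvexOn ℝ A f) {x y : E n} (hx : x ∈ A) (hy : y ∈ A)
    (hd : DifferentiableAt ℝ f x) :
    f x + inner ℝ (gradient f x) (y - x) ≤ f y := by
  simpa using (strongConvexOn_zero.2 hf).add_inner_gradient_le hx hy hd

theorem le_add_inner_gradient_add_sq {n : ℕ} {f : E n → ℝ} {A : Set (E n)} (hA : Convex ℝ A)
    (hd : ∀ x ∈ A, DifferentiableAt ℝ f x) {L : ℝ}
    (hL : ∀ x ∈ A, ∀ y ∈ A, ‖gradient f x - gradient f y‖ ≤ L * ‖x - y‖)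
    {x y : E n} (hx : x ∈ A) (hy : y ∈ A) :
    f y ≤ f x + inner ℝ (gradient f x) (y - x) + L / 2 * ‖y - x‖ ^ 2 := by
  have hm : ∀ t ∈ Set.Icc (0 : ℝ) 1, x + t • (y - x) ∈ A := fun t ht =>
    hA.add_smul_sub_mem hx hy ht
  -- The Lipschitz gradient makes the deviation from the quadratic model along the segment
  -- nonincreasing, so no integral is needed.
  let ψ : ℝ → ℝ := fun t => f (x + t • (y - x)) - t * inner ℝ (gradient f x) (y - x)
    - t ^ 2 * (L / 2 * ‖y - x‖ ^ 2)
  have hψ : ∀ t ∈ Set.Icc (0 : ℝ) 1, HasDerivAt ψ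
      (inner ℝ (gradient f (x + t • (y - x))) (y - x) - inner ℝ (gradient f x) (y - x)
        - 2 * t * (L / 2 * ‖y - x‖ ^ 2)) t := fun t ht => by
    have e := hasDerivAt_id t
    exact (((hasDerivAt_along (hd _ (hm t ht))).sub
      (e.mul_const (inner ℝ (gradient f x) (y - x)))).sub
      ((e.pow 2).mul_const (L / 2 * ‖y - x‖ ^ 2))).congr_deriv (by simp)
  have hanti : AntitoneOn ψ (Set.Icc 0 1) := by
    refine antitoneOn_of_deriv_nonpos (convex_Icc 0 1)
      (fun t ht => (hψ t ht).continuousAt.continuousWithinAt)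
      (fun t ht => (hψ t (interior_subset ht)).differentiableAt.differentiableWithinAt) ?_
    intro t ht
    have ht' := interior_subset ht
    rw [(hψ t ht').deriv, ← inner_sub_left]
    have h1 := real_inner_le_norm (gradient f (x + t • (y - x)) - gradient f x) (y - x)
    have h2 := hL _ (hm t ht') _ hx
    rw [add_sub_cancel_left, norm_smul, Real.norm_of_nonneg ht'.1] at h2
    nlinarith [norm_nonneg (y - x), mul_le_mul_of_nonneg_right h2 (norm_nonneg (y - x))]
  have h := hanti (Set.left_mem_Icc.2 zero_le_one) (Set.right_mem_Icc.2 zero_le_one) zero_le_one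
  simp only [ψ, one_smul, zero_smul, add_zero, add_sub_cancel] at h
  linarith

/-! ### The smooth part of the augmented Lagrangian -/

/-- A map `G` that provides, on `A`, lower and upper quadratic models of `Φ` and is
Lipschitz. -/
structure FirstOrderModel {n : ℕ} (A : Set (E n)) (Φ : E n → ℝ) (G : E n → E n) (μ ℓ : ℝ) :
    Prop where
  lower : ∀ x ∈ A, ∀ y ∈ A, Φ x + inner ℝ (G x) (y - x) + μ / 2 * ‖y - x‖ ^ 2 ≤ Φ y
  upper : ∀ x ∈ A, ∀ y ∈ A, Φ y ≤ Φ x + inner ℝ (G x) (y - x) + ℓ / 2 * ‖y - x‖ ^ 2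
  lipschitz : ∀ x ∈ A, ∀ y ∈ A, ‖G x - G y‖ ≤ ℓ * ‖x - y‖

theorem psi_eq {β : ℝ} (hβ : 0 < β) (u v : ℝ) :
    psi β u v = (max 0 (β * u + v) ^ 2 - v ^ 2) / (2 * β) := by
  unfold psi
  split_ifs with h
  · rw [max_eq_right h]; field_simp; ring
  · rw [max_eq_left (by linarith)]; field_simp; ring

/-- In its first argument `psi` is convex, with derivative `max 0 (β * u + v)`; this derivative is
nonnegative and `β`-Lipschitz. This inequality and `psi_upper` record just that, so `psi` never has
to be differentiated. -/
theorem psi_lower {β : ℝ} (hβ : 0 < β) (u u' v : ℝ) :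
    psi β u v + max 0 (β * u + v) * (u' - u) ≤ psi β u' v := by
  rw [psi_eq hβ, psi_eq hβ, div_add' _ _ _ (by positivity), div_le_div_iff_of_pos_right (by positivity)]
  rcases max_cases 0 (β * u + v) with ⟨h, h'⟩ | ⟨h, h'⟩ <;>
  rcases max_cases 0 (β * u' + v) with ⟨k, k'⟩ | ⟨k, k'⟩ <;> rw [h, k] <;>
  nlinarith [sq_nonneg (β * (u' - u)), sq_nonneg (β * u' + v), sq_nonneg (β * u + v)]

theorem psi_upper {β : ℝ} (hβ : 0 < β) (u u' v : ℝ) :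
    psi β u' v ≤ psi β u v + max 0 (β * u + v) * (u' - u) + β / 2 * (u' - u) ^ 2 := by
  rw [psi_eq hβ, psi_eq hβ, add_assoc, div_add' _ _ _ (by positivity),
    div_le_div_iff_of_pos_right (by positivity)]
  rcases max_cases 0 (β * u + v) with ⟨h, h'⟩ | ⟨h, h'⟩ <;>
  rcases max_cases 0 (β * u' + v) with ⟨k, k'⟩ | ⟨k, k'⟩ <;> rw [h, k] <;>
  nlinarith [sq_nonneg (β * (u' - u)), sq_nonneg (β * u' + v), sq_nonneg (β * u + v)]

/-- The smooth part `g + ∑ i, psi β (f i) (z i)` of the augmented Lagrangian. -/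
def smoothLag {n m : ℕ} (P : SmoothPart n m) (β : ℝ) (z : E m) (x : E n) : ℝ :=
  P.g x + ∑ i, psi β (P.f i x) (z i)

theorem augLag_eq {n m : ℕ} (S : SimplePart n) (P : SmoothPart n m) (β : ℝ) (z : E m) (x : E n) :
    augLag S P β z x = smoothLag P β z x + S.h x := by
  unfold augLag smoothLag obj; ring

namespace SmoothPart.RegularOn

variable {n m : ℕ} {P : SmoothPart n m} {A : Set (E n)} {μ : ℝ} {c : Consts m}

theorem mono {A' : Set (E n)} (hP : P.RegularOn A μ c) (h : A' ⊆ A) (hA' : Convex ℝ A') :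
    P.RegularOn A' μ c where
  convex_g := ⟨hA', fun _ hx _ hy => hP.convex_g.2 (h hx) (h hy)⟩
  convex_f i := (hP.convex_f i).subset h hA'
  diff_g x hx := hP.diff_g x (h hx)
  diff_f i x hx := hP.diff_f i x (h hx)
  L₀_nonneg := hP.L₀_nonneg
  L_nonneg := hP.L_nonneg
  lip_g x hx y hy := hP.lip_g x (h hx) y (h hy)
  lip_f i x hx y hy := hP.lip_f i x (h hx) y (h hy)
  bound_f i x hx := hP.bound_f i x (h hx)
  bound_grad i x hx := hP.bound_grad i x (h hx)

theorem B_nonneg (hP : P.RegularOn A μ c) (hA : A.Nonempty) (i : Fin m) : 0 ≤ c.B i :=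
  let ⟨x, hx⟩ := hA
  (abs_nonneg _).trans (hP.bound_f i x hx)

theorem H_nonneg (hP : P.RegularOn A μ c) (hA : A.Nonempty) : 0 ≤ c.H :=
  Finset.sum_nonneg fun i _ => mul_nonneg (hP.B_nonneg hA i)
    (add_nonneg (hP.B_nonneg hA i) (hP.L_nonneg i))

/-- The gradient inequality at each of the two endpoints bounds the difference from one side. -/
theorem abs_f_sub_le (hP : P.RegularOn A μ c) (i : Fin m) {x y : E n} (hx : x ∈ A) (hy : y ∈ A) :
    |P.f i y - P.f i x| ≤ c.B i * ‖y - x‖ := by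
  have key : ∀ x ∈ A, ∀ y ∈ A, P.f i x - P.f i y ≤ c.B i * ‖y - x‖ := fun x hx y hy => by
    have h1 := (hP.convex_f i).add_inner_gradient_le hx hy (hP.diff_f i x hx)
    have h2 := neg_le_of_abs_le (abs_real_inner_le_norm (gradient (P.f i) x) (y - x))
    have h3 := mul_le_mul_of_nonneg_right (hP.bound_grad i x hx) (norm_nonneg (y - x))
    linarith
  rw [abs_le]
  constructor
  · linarith [key x hx y hy]
  · rw [norm_sub_rev]; exact key y hy x hx

theorem multiplier_le (hP : P.RegularOn A μ c) {β : ℝ} (hβ : 0 < β) (z : E m) (i : Fin m)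
    {x : E n} (hx : x ∈ A) : max 0 (β * P.f i x + z i) ≤ β * c.B i + |z i| := by
  have hB := (abs_nonneg _).trans (hP.bound_f i x hx)
  refine max_le (by positivity) (add_le_add ?_ (le_abs_self _))
  exact mul_le_mul_of_nonneg_left ((le_abs_self _).trans (hP.bound_f i x hx)) hβ.le

/-- Convexity survives the composition because the multiplier `max 0 (β * f i + z i)` is
nonnegative. In the upper model, the curvature of `f i` enters with this multiplier, at most `β * B
i + |z i|`, and the curvature `β` of `psi` enters with the squared Lipschitz constant `B i ^ 2`;
together these form the `i`-th summand of `lipConst`. -/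
theorem firstOrderModel (hP : P.RegularOn A μ c) {β : ℝ} (hβ : 0 < β) (z : E m) :
    FirstOrderModel A (smoothLag P β z) (gradF P β z) μ (lipConst c β z) where
  lower x hx y hy := by
    have h1 := hP.convex_g.add_inner_gradient_le hx hy (hP.diff_g x hx)
    have h2 : ∑ i, (psi β (P.f i x) (z i) +
        max 0 (β * P.f i x + z i) * inner ℝ (gradient (P.f i) x) (y - x)) ≤
        ∑ i, psi β (P.f i y) (z i) := Finset.sum_le_sum fun i _ => by
      have h3 := psi_lower hβ (P.f i x) (P.f i y) (z i)
      have h4 := (hP.convex_f i).add_inner_gradient_le hx hy (hP.diff_f i x hx)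
      have h5 := mul_le_mul_of_nonneg_left (le_sub_iff_add_le'.2 h4)
        (le_max_left 0 (β * P.f i x + z i))
      linarith
    rw [Finset.sum_add_distrib] at h2
    simp only [smoothLag, gradF, inner_add_left, sum_inner, real_inner_smul_left]
    linarith
  upper x hx y hy := by
    have h1 := le_add_inner_gradient_add_sq hP.convex_g.1 hP.diff_g hP.lip_g hx hy
    have h2 : ∑ i, psi β (P.f i y) (z i) ≤ ∑ i, (psi β (P.f i x) (z i) +
        max 0 (β * P.f i x + z i) * inner ℝ (gradient (P.f i) x) (y - x) +
        (β * c.B i * (c.B i + c.L i) + c.L i * |z i|) * (‖y - x‖ ^ 2 / 2)) :=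
      Finset.sum_le_sum fun i _ => by
      have h3 := psi_upper hβ (P.f i x) (P.f i y) (z i)
      have h4 := le_add_inner_gradient_add_sq hP.convex_g.1 (hP.diff_f i) (hP.lip_f i) hx hy
      have h5 := mul_le_mul_of_nonneg_left (sub_le_iff_le_add'.2 (h4.trans_eq (add_assoc _ _ _)))
        (le_max_left 0 (β * P.f i x + z i))
      have h6 := mul_le_mul_of_nonneg_right (hP.multiplier_le hβ z i hx)
        (show 0 ≤ c.L i / 2 * ‖y - x‖ ^ 2 by have := hP.L_nonneg i; positivity)
      have h7 : (P.f i y - P.f i x) ^ 2 ≤ (c.B i * ‖y - x‖) ^ 2 := by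
        rw [← sq_abs]
        exact pow_le_pow_left₀ (abs_nonneg _) (hP.abs_f_sub_le i hx hy) 2
      have h8 := mul_le_mul_of_nonneg_left h7 (half_pos hβ).le
      linarith
    rw [Finset.sum_add_distrib, Finset.sum_add_distrib, ← Finset.sum_mul] at h2
    simp only [smoothLag, gradF, inner_add_left, sum_inner, real_inner_smul_left, lipConst]
    linarith
  lipschitz x hx y hy := by
    have h1 := hP.lip_g x hx y hy
    have e : gradF P β z x - gradF P β z y = (gradient P.g x - gradient P.g y) +
        ∑ i, (max 0 (β * P.f i x + z i) • gradient (P.f i) x -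
          max 0 (β * P.f i y + z i) • gradient (P.f i) y) := by
      simp only [gradF, Finset.sum_sub_distrib]; abel
    have h2 : ∀ i, ‖max 0 (β * P.f i x + z i) • gradient (P.f i) x -
          max 0 (β * P.f i y + z i) • gradient (P.f i) y‖ ≤
        (β * c.B i * (c.B i + c.L i) + c.L i * |z i|) * ‖x - y‖ := fun i => by
      have e : max 0 (β * P.f i x + z i) • gradient (P.f i) x -
          max 0 (β * P.f i y + z i) • gradient (P.f i) y =
          max 0 (β * P.f i x + z i) • (gradient (P.f i) x - gradient (P.f i) y) +
          (max 0 (β * P.f i x + z i) - max 0 (β * P.f i y + z i)) • gradient (P.f i) y := by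
        module
      have hB : 0 ≤ c.B i := (abs_nonneg _).trans (hP.bound_f i x hx)
      have k1 : |max 0 (β * P.f i x + z i) - max 0 (β * P.f i y + z i)| ≤
          β * (c.B i * ‖x - y‖) := by
        rw [max_comm, max_comm 0 (β * P.f i y + z i)]
        refine (abs_max_sub_max_le_abs _ _ _).trans ?_
        rw [add_sub_add_right_eq_sub, ← mul_sub, abs_mul, abs_of_pos hβ]
        exact mul_le_mul_of_nonneg_left (hP.abs_f_sub_le i hy hx) hβ.le
      rw [e]
      refine (norm_add_le _ _).trans ?_
      rw [norm_smul, norm_smul, Real.norm_of_nonneg (le_max_left _ _), Real.norm_eq_abs]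
      have k2 := mul_le_mul (hP.multiplier_le hβ z i hx) (hP.lip_f i x hx y hy) (norm_nonneg _)
        (by positivity)
      have k3 := mul_le_mul k1 (hP.bound_grad i y hy) (norm_nonneg _) (by positivity)
      linarith
    rw [e]
    refine (norm_add_le _ _).trans ?_
    rw [lipConst, add_mul, Finset.sum_mul]
    exact add_le_add h1 ((norm_sum_le _ _).trans (Finset.sum_le_sum fun i _ => h2 i))

/-- Transfers `μ ≤ L₀ / 4` to every subproblem. -/
theorem L₀_le_lipConst (hP : P.RegularOn A μ c) (hA : A.Nonempty) {β : ℝ} (hβ : 0 < β) (z : E m) :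
    c.L₀ ≤ lipConst c β z :=
  le_add_of_nonneg_right <| Finset.sum_nonneg fun i _ => by
    have := hP.B_nonneg hA i
    have := hP.L_nonneg i
    positivity

end SmoothPart.RegularOn

/-! ### The dual iteration -/

/-- The function `w ↦ w * u - (w - v) ^ 2 / (2 * β)` is strongly concave and `psi β u v` is its
maximum over `w ≥ 0`, attained at `max 0 (β * u + v)`. The additional square is the gain from strong
concavity. -/
theorem psi_ge_of_nonneg {β : ℝ} (hβ : 0 < β) (u v : ℝ) {w : ℝ} (hw : 0 ≤ w) :
    w * u + ((w - max 0 (β * u + v)) ^ 2 - (w - v) ^ 2) / (2 * β) ≤ psi β u v := by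
  rw [psi_eq hβ, add_div' _ _ _ (by positivity), div_le_div_iff_of_pos_right (by positivity)]
  nlinarith [mul_le_mul_of_nonneg_left (le_max_right 0 (β * u + v)) hw]

theorem psi_nonpos {β : ℝ} (hβ : 0 < β) {u : ℝ} (hu : u ≤ 0) (v : ℝ) : psi β u v ≤ 0 := by
  rw [psi_eq hβ]
  refine div_nonpos_of_nonpos_of_nonneg ?_ (by positivity)
  rcases max_cases 0 (β * u + v) with ⟨h, h'⟩ | ⟨h, h'⟩ <;> rw [h]
  · nlinarith
  · nlinarith [mul_nonneg hβ.le (neg_nonneg.2 hu)]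

theorem norm_sq_eq_sum {m : ℕ} (z : E m) : ‖z‖ ^ 2 = ∑ i, z i ^ 2 :=
  EuclideanSpace.real_norm_sq_eq z

namespace IsKKT

variable {n m : ℕ} {S : SimplePart n} {P : SmoothPart n m} {xs : E n} {zs : E m} {μ : ℝ}
  {c : Consts m}

/-- The subgradient, normal cone and gradient inequalities add up to this because the three vectors
in the stationarity condition cancel. -/
theorem obj_le_lagrangian (h : IsKKT S P xs zs) (hP : P.RegularOn S.C μ c) {x : E n}
    (hx : x ∈ S.C) : obj S P xs ≤ obj S P x + ∑ i, zs i * P.f i x := by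
  obtain ⟨s, ν, hs, hν, hsum⟩ := h.stationary
  have h1 := hs x hx.1
  have h2 := hν x hx.2
  have h3 : ∑ i, zs i * inner ℝ (gradient (P.f i) xs) (x - xs) ≤ ∑ i, zs i * P.f i x :=
    Finset.sum_le_sum fun i _ => by
      have h4 := (hP.convex_f i).add_inner_gradient_le h.mem hx (hP.diff_f i xs h.mem)
      have h5 := mul_le_mul_of_nonneg_left h4 (h.dual_nonneg i)
      rwa [mul_add, h.slack i, zero_add] at h5
  have h4 : inner ℝ (s + ν + ∑ i, zs i • gradient (P.f i) xs) (x - xs) = (0 : ℝ) := by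
    rw [hsum, inner_zero_left]
  simp only [inner_add_left, sum_inner, real_inner_smul_left] at h4
  linarith

theorem augLag_le (h : IsKKT S P xs zs) {β : ℝ} (hβ : 0 < β) (z : E m) :
    augLag S P β z xs ≤ obj S P xs :=
  add_le_of_nonpos_right (Finset.sum_nonpos fun i _ => psi_nonpos hβ (h.feasible i) (z i))

/-- The augmented Lagrangian at `x` is at most `f₀(x*) + ε`. By `psi_ge_of_nonneg` with `w = z*` it
is at least `f₀(x) + ⟨z*, f(x)⟩` plus the difference of squared distances over `2 * β`, and the
saddle inequality removes `f₀`. -/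
theorem norm_dual_step_le (h : IsKKT S P xs zs) (hP : P.RegularOn S.C μ c) {β ε : ℝ} (hβ : 0 < β)
    {z z' : E m} {x : E n} (hx : IsApproxMin S P β z ε x)
    (hz : ∀ i, z' i = max 0 (β * P.f i x + z i)) :
    ‖z' - zs‖ ^ 2 ≤ ‖z - zs‖ ^ 2 + 2 * (β * ε) := by
  have h1 := hx.2 xs h.mem
  have h2 := h.augLag_le hβ z
  have h3 := h.obj_le_lagrangian hP hx.1
  have h4 : ∑ i, (zs i * P.f i x + ((z' i - zs i) ^ 2 - (z i - zs i) ^ 2) / (2 * β)) ≤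
      ∑ i, psi β (P.f i x) (z i) := Finset.sum_le_sum fun i _ => by
    have := psi_ge_of_nonneg hβ (P.f i x) (z i) (h.dual_nonneg i)
    rwa [← hz i, sub_sq_comm, sub_sq_comm (zs i) (z i)] at this
  have h5 : (‖z' - zs‖ ^ 2 - ‖z - zs‖ ^ 2) / (2 * β) ≤ ε := by
    rw [norm_sq_eq_sum, norm_sq_eq_sum, ← Finset.sum_sub_distrib, Finset.sum_div]
    simp only [PiLp.sub_apply]
    rw [Finset.sum_add_distrib] at h4
    unfold augLag at h1 h2
    linarith
  rw [div_le_iff₀ (by positivity)] at h5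
  linarith

end IsKKT

theorem dual_step_eq {β : ℝ} (hβ : 0 < β) (u v : ℝ) :
    v + β * max (-v / β) u = max 0 (β * u + v) := by
  rw [mul_max_of_nonneg _ _ hβ.le, mul_div_cancel₀ _ hβ.ne', ← max_add_add_left]
  congr 1 <;> ring

theorem psi_eq_of_dual_step {m : ℕ} {β : ℝ} (hβ : 0 < β) {u : Fin m → ℝ} {z z' : E m}
    (hz : ∀ i, z' i = max 0 (β * u i + z i)) :
    ∑ i, psi β (u i) (z i) = (‖z'‖ ^ 2 - ‖z‖ ^ 2) / (2 * β) := by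
  rw [norm_sq_eq_sum, norm_sq_eq_sum, ← Finset.sum_sub_distrib, Finset.sum_div]
  exact Finset.sum_congr rfl fun i _ => by rw [psi_eq hβ, hz i]

theorem norm_le_norm_of_abs_le {m : ℕ} {a b : E m} (h : ∀ i, |a i| ≤ |b i|) : ‖a‖ ≤ ‖b‖ := by
  refine le_of_sq_le_sq ?_ (norm_nonneg b)
  rw [norm_sq_eq_sum, norm_sq_eq_sum]
  exact Finset.sum_le_sum fun i _ => sq_le_sq.2 (h i)

theorem norm_violation_le {n m : ℕ} {P : SmoothPart n m} {β : ℝ} (hβ : 0 < β) {x : E n}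
    {z z' : E m} (hz0 : ∀ i, 0 ≤ z i) (hz : ∀ i, z' i = max 0 (β * P.f i x + z i)) :
    ‖violation P x‖ ≤ ‖z' - z‖ / β := by
  have h : ‖violation P x‖ ≤ ‖β⁻¹ • (z' - z)‖ := norm_le_norm_of_abs_le fun i => by
    simp only [violation, PiLp.smul_apply, PiLp.sub_apply, smul_eq_mul, hz i]
    rw [abs_mul, abs_of_pos (inv_pos.2 hβ), ← div_eq_inv_mul, le_div_iff₀ hβ,
      abs_of_nonneg (le_max_left _ _)]
    rcases le_total (P.f i x) 0 with h | h
    · rw [max_eq_left h, zero_mul]; exact abs_nonneg _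
    · rw [max_eq_right h, max_eq_right (add_nonneg (mul_nonneg hβ.le h) (hz0 i)),
        add_sub_cancel_right, mul_comm]
      exact le_abs_self _
  rwa [norm_smul, Real.norm_of_nonneg (inv_pos.2 hβ).le, ← div_eq_inv_mul] at h

namespace IsALM

variable {n m : ℕ} {S : SimplePart n} {P : SmoothPart n m} {xs : E n} {zs : E m} {μ : ℝ}
  {c : Consts m} {β ε : ℕ → ℝ} {K : ℕ} {x : ℕ → E n} {z : ℕ → E m}

theorem z_succ (h : IsALM S P β ε K x z) (hβ : ∀ k, 0 < β k) {k : ℕ} (hk : k < K) (i : Fin m) :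
    z (k + 1) i = max 0 (β k * P.f i (x (k + 1)) + z k i) := by
  rw [h.z_step k hk i, dual_step_eq (hβ k)]

theorem z_nonneg (h : IsALM S P β ε K x z) (hβ : ∀ k, 0 < β k) {k : ℕ} (hk : k ≤ K) (i : Fin m) :
    0 ≤ z k i := by
  cases k with
  | zero => simp [h.z_zero]
  | succ k => rw [h.z_succ hβ hk]; exact le_max_left _ _

theorem norm_sub_sq_le (h : IsALM S P β ε K x z) (hβ : ∀ k, 0 < β k) (hK : IsKKT S P xs zs)
    (hP : P.RegularOn S.C μ c) {k : ℕ} (hk : k ≤ K) :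
    ‖z k - zs‖ ^ 2 ≤ ‖zs‖ ^ 2 + 2 * ∑ t ∈ Finset.range k, β t * ε t := by
  induction k with
  | zero => simp [h.z_zero]
  | succ k ih =>
    have h1 := ih (by omega)
    have h2 := hK.norm_dual_step_le hP (hβ k) (h.x_step k hk) (h.z_succ hβ hk)
    rw [Finset.sum_range_succ]
    linarith

theorem norm_sub_le (h : IsALM S P β ε K x z) (hβ : ∀ k, 0 < β k) (hε : ∀ k, 0 < ε k)
    (hK : IsKKT S P xs zs) (hP : P.RegularOn S.C μ c) {Cε : ℝ}
    (hsum : ∑ t ∈ Finset.range K, β t * ε t = Cε / 2) {k : ℕ} (hk : k ≤ K) :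
    ‖z k - zs‖ ≤ ‖zs‖ + √Cε := by
  have hC : 0 ≤ Cε := by
    have := Finset.sum_nonneg fun t (_ : t ∈ Finset.range K) => (mul_pos (hβ t) (hε t)).le
    linarith
  have h1 := h.norm_sub_sq_le hβ hK hP hk
  have h2 : ∑ t ∈ Finset.range k, β t * ε t ≤ ∑ t ∈ Finset.range K, β t * ε t :=
    Finset.sum_le_sum_of_subset_of_nonneg (Finset.range_mono hk)
      fun t _ _ => (mul_pos (hβ t) (hε t)).le
  refine le_of_sq_le_sq ?_ (by positivity)
  nlinarith [Real.sq_sqrt hC, Real.sqrt_nonneg Cε, norm_nonneg zs,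
    mul_nonneg (norm_nonneg zs) (Real.sqrt_nonneg Cε)]

theorem norm_z_le (h : IsALM S P β ε K x z) (hβ : ∀ k, 0 < β k) (hε : ∀ k, 0 < ε k)
    (hK : IsKKT S P xs zs) (hP : P.RegularOn S.C μ c) {Cε : ℝ}
    (hsum : ∑ t ∈ Finset.range K, β t * ε t = Cε / 2) {k : ℕ} (hk : k ≤ K) :
    ‖z k‖ ≤ 2 * ‖zs‖ + √Cε := by
  have h1 := h.norm_sub_le hβ hε hK hP hsum hk
  have h2 := norm_le_norm_add_norm_sub zs (z k)
  rw [norm_sub_rev] at h2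
  linarith

/-- Error bounds for the iterate of an outer step. -/
theorem errors (h : IsALM S P β ε K x z) (hβ : ∀ k, 0 < β k) (hε : ∀ k, 0 < ε k)
    (hK : IsKKT S P xs zs) (hP : P.RegularOn S.C μ c) {Cε : ℝ}
    (hsum : ∑ t ∈ Finset.range K, β t * ε t = Cε / 2) {k : ℕ} (hk : k < K) {a b : ℝ}
    (ha : ε k ≤ a) (hb : (β k)⁻¹ ≤ b) :
    |obj S P (x (k + 1)) - obj S P xs| ≤
      a + b * (2 * ‖zs‖ + √Cε) * (5 * ‖zs‖ + 7 / 2 * √Cε) ∧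
    ‖violation P (x (k + 1))‖ ≤ b * (5 * ‖zs‖ + 7 / 2 * √Cε) := by
  have hβk := hβ k
  have hb0 : 0 < b := (inv_pos.2 hβk).trans_le hb
  have n0 := norm_nonneg zs
  have s0 := Real.sqrt_nonneg Cε
  have h1 := h.norm_sub_le hβ hε hK hP hsum hk.le
  have h2 := h.norm_sub_le hβ hε hK hP hsum (Nat.succ_le_of_lt hk)
  have h3 : ‖z (k + 1) - z k‖ ≤ 2 * (‖zs‖ + √Cε) := by
    have := norm_sub_le_norm_sub_add_norm_sub (z (k + 1)) zs (z k)
    rw [norm_sub_rev zs] at this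
    linarith
  have hv : ‖violation P (x (k + 1))‖ ≤ b * (5 * ‖zs‖ + 7 / 2 * √Cε) := by
    refine (norm_violation_le hβk (fun i => h.z_nonneg hβ hk.le i) (h.z_succ hβ hk)).trans ?_
    rw [div_eq_inv_mul]
    exact mul_le_mul hb (by linarith) (norm_nonneg _) hb0.le
  refine ⟨abs_le.2 ⟨?_, ?_⟩, hv⟩
  · have h4 := hK.obj_le_lagrangian hP (h.x_step k hk).1
    have h5 : ∑ i, zs i * P.f i (x (k + 1)) ≤ ‖zs‖ * ‖violation P (x (k + 1))‖ := by
      refine le_trans ?_ (real_inner_le_norm _ _)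
      rw [PiLp.inner_apply]
      refine Finset.sum_le_sum fun i _ => ?_
      simp only [violation, RCLike.inner_apply, conj_trivial]
      rw [mul_comm]
      exact mul_le_mul_of_nonneg_right (le_max_right _ _) (hK.dual_nonneg i)
    have h6 := mul_le_mul_of_nonneg_left hv n0
    have h7 : 0 ≤ b * (‖zs‖ + √Cε) * (5 * ‖zs‖ + 7 / 2 * √Cε) := by positivity
    have := hε k
    linarith
  · have h4 := (h.x_step k hk).2 xs hK.mem
    have h5 := hK.augLag_le hβk (z k)
    have h6 := psi_eq_of_dual_step hβk (h.z_succ hβ hk)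
    have h7 := h.norm_z_le hβ hε hK hP hsum hk.le
    have h8 : (‖z k‖ ^ 2 - ‖z (k + 1)‖ ^ 2) ≤
        2 * ((2 * ‖zs‖ + √Cε) * (5 * ‖zs‖ + 7 / 2 * √Cε)) := by
      have h9 := h.norm_z_le hβ hε hK hP hsum (Nat.succ_le_of_lt hk)
      have h10 := norm_sub_norm_le (z k) (z (k + 1))
      rw [norm_sub_rev] at h10
      have h11 := mul_le_mul (h10.trans h3) (add_le_add h7 h9) (by positivity) (by positivity)
      -- There is slack here: the argument produces `2 * ‖zs‖ + 2 * √Cε` where the claimed bound has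
      -- the coefficients `5` and `7 / 2`.
      have h12 : (2 * (‖zs‖ + √Cε)) * (2 * ‖zs‖ + √Cε) ≤
          (5 * ‖zs‖ + 7 / 2 * √Cε) * (2 * ‖zs‖ + √Cε) :=
        mul_le_mul_of_nonneg_right (by linarith) (by positivity)
      linarith
    have h9 : (‖z k‖ ^ 2 - ‖z (k + 1)‖ ^ 2) / (2 * β k) ≤
        b * ((2 * ‖zs‖ + √Cε) * (5 * ‖zs‖ + 7 / 2 * √Cε)) := by
      rw [div_eq_inv_mul, mul_inv]
      have h10 := mul_le_mul_of_nonneg_left h8 (inv_pos.2 hβk).le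
      have h11 := mul_le_mul_of_nonneg_right hb
        (show 0 ≤ (2 * ‖zs‖ + √Cε) * (5 * ‖zs‖ + 7 / 2 * √Cε) by positivity)
      linarith
    rw [← neg_sub (‖z (k + 1)‖ ^ 2), neg_div] at h9
    unfold augLag at h4 h5
    linarith

end IsALM

/-! ### Penalties and tolerances -/

namespace Params

variable {p : Params} {ε μ : ℝ}

theorem Valid.one_lt_pow (hp : p.Valid) : 1 < p.σ ^ p.K :=
  one_lt_pow₀ hp.one_lt_σ hp.K_pos.ne'

theorem Valid.βg_pos (hp : p.Valid) (hε : 0 < ε) : 0 < p.βg ε :=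
  mul_pos (div_pos hp.Cβ_pos hε)
    (div_pos (sub_pos.2 hp.one_lt_σ) (sub_pos.2 hp.one_lt_pow))

theorem Valid.β_pos (hp : p.Valid) (hε : 0 < ε) (k : ℕ) : 0 < p.β ε k :=
  mul_pos (hp.βg_pos hε) (pow_pos (zero_lt_one.trans hp.one_lt_σ) k)

theorem Valid.βg_mul (hp : p.Valid) : p.βg ε * (p.σ ^ p.K - 1) = p.Cβ / ε * (p.σ - 1) := by
  have := (sub_pos.2 hp.one_lt_pow).ne'
  unfold βg
  field_simp

theorem Valid.sum_β (hp : p.Valid) : ∑ k ∈ Finset.range p.K, p.β ε k = p.Cβ / ε := by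
  have h1 := (sub_pos.2 hp.one_lt_σ).ne'
  simp only [β]
  rw [← Finset.mul_sum, geom_sum_eq hp.one_lt_σ.ne', mul_div_assoc', hp.βg_mul,
    mul_div_cancel_right₀ _ h1]

theorem Valid.β_le_last (hp : p.Valid) (hε : 0 < ε) {k : ℕ} (hk : k < p.K) :
    p.β ε k ≤ p.β ε (p.K - 1) :=
  mul_le_mul_of_nonneg_left (pow_le_pow_right₀ hp.one_lt_σ.le (by omega)) (hp.βg_pos hε).le

theorem Valid.β_last (hp : p.Valid) (hε : 0 < ε) :
    p.β ε (p.K - 1) = (p.Cβ * (p.σ - 1) + p.βg ε * ε) / (p.σ * ε) := by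
  have h0 : 0 < p.σ := zero_lt_one.trans hp.one_lt_σ
  have h1 : p.σ ^ p.K = p.σ ^ (p.K - 1) * p.σ := by
    rw [← pow_succ, Nat.sub_add_cancel hp.K_pos]
  have h2 := hp.βg_mul (ε := ε)
  rw [h1] at h2
  rw [eq_div_iff (by positivity), β]
  field_simp at h2
  linarith

theorem Valid.inv_β_last_le (hp : p.Valid) (hε : 0 < ε) :
    (p.β ε (p.K - 1))⁻¹ ≤ ε * p.σ / (p.Cβ * (p.σ - 1)) := by
  have h0 : 0 < p.σ := zero_lt_one.trans hp.one_lt_σ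
  have h1 := mul_pos hp.Cβ_pos (sub_pos.2 hp.one_lt_σ)
  have h2 := mul_pos (hp.βg_pos hε) hε
  rw [hp.β_last hε, inv_div, mul_comm]
  exact div_le_div_of_nonneg_left (by positivity) h1 (by linarith)

theorem Valid.range_nonempty (hp : p.Valid) : (Finset.range p.K).Nonempty :=
  Finset.nonempty_range_iff.2 hp.K_pos.ne'

theorem Valid.tol_pos (hp : p.Valid) (hε : 0 < ε) (r : Rule) (k : ℕ) : 0 < p.tol ε μ r k := by
  have h1 := hp.Cβ_pos
  have h2 := hp.Cε_pos
  have hβ := hp.β_pos hε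
  cases r with
  | constant => simp only [tol]; positivity
  | adaptive =>
    have h3 : 0 < ∑ t ∈ Finset.range p.K, p.β ε t ^ (2 / 3 : ℝ) :=
      Finset.sum_pos (fun t _ => Real.rpow_pos_of_pos (hβ t) _) hp.range_nonempty
    have h4 : 0 < ∑ t ∈ Finset.range p.K, √(p.β ε t) :=
      Finset.sum_pos (fun t _ => Real.sqrt_pos.2 (hβ t)) hp.range_nonempty
    have h5 := hβ k
    simp only [tol]
    split_ifs <;> positivity

theorem Valid.sum_β_mul_tol (hp : p.Valid) (hε : 0 < ε) (r : Rule) :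
    ∑ k ∈ Finset.range p.K, p.β ε k * p.tol ε μ r k = p.Cε / 2 := by
  have h1 := hp.Cβ_pos
  have hβ := hp.β_pos hε
  cases r with
  | constant =>
    simp only [tol]
    rw [← Finset.sum_mul, hp.sum_β]
    field_simp
  | adaptive =>
    have h3 : 0 < ∑ t ∈ Finset.range p.K, p.β ε t ^ (2 / 3 : ℝ) :=
      Finset.sum_pos (fun t _ => Real.rpow_pos_of_pos (hβ t) _) hp.range_nonempty
    have h4 : 0 < ∑ t ∈ Finset.range p.K, √(p.β ε t) :=
      Finset.sum_pos (fun t _ => Real.sqrt_pos.2 (hβ t)) hp.range_nonempty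
    simp only [tol]
    split_ifs
    · have e : ∀ k, p.β ε k * (p.Cε / 2 * (1 / (p.β ε k ^ (1 / 3 : ℝ) *
          ∑ t ∈ Finset.range p.K, p.β ε t ^ (2 / 3 : ℝ)))) =
          p.β ε k ^ (2 / 3 : ℝ) * (p.Cε / 2 / ∑ t ∈ Finset.range p.K, p.β ε t ^ (2 / 3 : ℝ)) := by
        intro k
        have h5 : p.β ε k ^ (2 / 3 : ℝ) * p.β ε k ^ (1 / 3 : ℝ) = p.β ε k := by
          rw [← Real.rpow_add (hβ k)]; norm_num
        have h6 := Real.rpow_pos_of_pos (hβ k) (1 / 3)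
        nth_rw 1 [← h5]
        field_simp
      rw [Finset.sum_congr rfl fun k _ => e k, ← Finset.sum_mul]
      field_simp
    · have e : ∀ k, p.β ε k * (p.Cε / 2 * (1 / (√(p.β ε k) *
          ∑ t ∈ Finset.range p.K, √(p.β ε t)))) =
          √(p.β ε k) * (p.Cε / 2 / ∑ t ∈ Finset.range p.K, √(p.β ε t)) := by
        intro k
        have h6 := Real.sqrt_pos.2 (hβ k)
        nth_rw 1 [← Real.mul_self_sqrt (hβ k).le]
        field_simp
      rw [Finset.sum_congr rfl fun k _ => e k, ← Finset.sum_mul]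
      field_simp

/-- The last penalty is the largest, so replacing one factor of each `β t` by that of the last
penalty shows that the adaptive denominator is at least `∑ β t = Cβ / ε`, which is the denominator
of the constant rule. -/
theorem Valid.tol_last_le (hp : p.Valid) (hε : 0 < ε) (r : Rule) :
    p.tol ε μ r (p.K - 1) ≤ ε / 2 * (p.Cε / p.Cβ) := by
  have h1 := hp.Cβ_pos
  have h2 := hp.Cε_pos
  have hβ := hp.β_pos hε
  have hs : ε / 2 * (p.Cε / p.Cβ) =
      p.Cε / 2 * (1 / ∑ t ∈ Finset.range p.K, p.β ε t) := by
    rw [hp.sum_β]; field_simp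
  have hs0 : 0 < ∑ t ∈ Finset.range p.K, p.β ε t := by rw [hp.sum_β]; positivity
  rw [hs]
  cases r with
  | constant => simp only [tol]; exact hs.le
  | adaptive =>
    simp only [tol]
    split_ifs
    · refine mul_le_mul_of_nonneg_left (one_div_le_one_div_of_le hs0 ?_) (by positivity)
      rw [Finset.mul_sum]
      refine Finset.sum_le_sum fun t ht => ?_
      have h5 : p.β ε t ^ (1 / 3 : ℝ) * p.β ε t ^ (2 / 3 : ℝ) = p.β ε t := by
        rw [← Real.rpow_add (hβ t)]; norm_num
      conv_lhs => rw [← h5]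
      exact mul_le_mul_of_nonneg_right (Real.rpow_le_rpow (hβ t).le
        (hp.β_le_last hε (Finset.mem_range.1 ht)) (by norm_num)) (Real.rpow_nonneg (hβ t).le _)
    · refine mul_le_mul_of_nonneg_left (one_div_le_one_div_of_le hs0 ?_) (by positivity)
      rw [Finset.mul_sum]
      refine Finset.sum_le_sum fun t ht => ?_
      conv_lhs => rw [← Real.mul_self_sqrt (hβ t).le]
      exact mul_le_mul_of_nonneg_right (Real.sqrt_le_sqrt
        (hp.β_le_last hε (Finset.mem_range.1 ht))) (Real.sqrt_nonneg _)

end Params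

theorem IsALM.errors_last {n m : ℕ} {S : SimplePart n} {P : SmoothPart n m} {c : Consts m} {xs : E n}
    {zs : E m} {p : Params} {ε μ : ℝ} {r : Rule} {x : ℕ → E n} {z : ℕ → E m}
    (h : IsALM S P (p.β ε) (p.tol ε μ r) p.K x z) (hP : P.RegularOn S.C μ c)
    (hK : IsKKT S P xs zs) (hp : p.Valid) (hε : 0 < ε) :
    |obj S P (x p.K) - obj S P xs| ≤
      ε / 2 * (p.Cε / p.Cβ) + ε * p.σ / (p.Cβ * (p.σ - 1)) *
        (2 * ‖zs‖ + √p.Cε) * (5 * ‖zs‖ + 7 / 2 * √p.Cε) ∧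
    ‖violation P (x p.K)‖ ≤
      ε * p.σ / (p.Cβ * (p.σ - 1)) * (5 * ‖zs‖ + 7 / 2 * √p.Cε) := by
  have := h.errors (hp.β_pos hε) (hp.tol_pos hε r) hK hP (hp.sum_β_mul_tol hε r)
    (k := p.K - 1) (Nat.sub_lt hp.K_pos one_pos) (hp.tol_last_le hε r) (hp.inv_β_last_le hε)
  rwa [show p.K - 1 + 1 = p.K from Nat.sub_add_cancel hp.K_pos] at this

/-! ### Proximal points -/

/-- `y` minimizes `⟨g, ·⟩ + κ / 2 * ‖· - c‖ ^ 2 + h` over `dom h ∩ X`. -/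
def SimplePart.IsProx {n : ℕ} (S : SimplePart n) (g c : E n) (κ : ℝ) (y : E n) : Prop :=
  y ∈ S.C ∧ ∀ u ∈ S.C, inner ℝ g y + κ / 2 * ‖y - c‖ ^ 2 + S.h y ≤
    inner ℝ g u + κ / 2 * ‖u - c‖ ^ 2 + S.h u

namespace SimplePart.Admissible

variable {n : ℕ} {S : SimplePart n}

theorem convex_C (hS : S.Admissible) : Convex ℝ S.C := hS.convex_h.1.inter hS.convex_X

theorem convexOn_h (hS : S.Admissible) : ConvexOn ℝ S.C S.h :=
  hS.convex_h.subset Set.inter_subset_left hS.convex_C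

theorem norm_sub_le_D (hS : S.Admissible) {x y : E n} (hx : x ∈ S.C) (hy : y ∈ S.C) :
    ‖x - y‖ ≤ S.D := by
  rw [← dist_eq_norm]
  exact Metric.dist_le_diam_of_mem hS.bounded hx hy

theorem isClosed_sublevel (hS : S.Admissible) (r : ℝ) : IsClosed {x | x ∈ S.C ∧ S.h x ≤ r} :=
  hS.isClosed_epi.preimage (f := fun x : E n => (x, r)) (by fun_prop)

/-- Since `C` itself need not be closed, the minimization runs over the part of `C` where `h` lies
below a level that the minimum cannot exceed. Closedness of the epigraph makes this part compact and
`h` lower semicontinuous on it. No sign of `κ` is required. -/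
theorem exists_isProx (hS : S.Admissible) (hne : S.C.Nonempty) (g c : E n) (κ : ℝ) :
    ∃ y, S.IsProx g c κ y := by
  obtain ⟨x₀, hx₀⟩ := hne
  let φ : E n → ℝ := fun y => inner ℝ g y + κ / 2 * ‖y - c‖ ^ 2
  have hφ : Continuous φ := by fun_prop
  obtain ⟨b, hb⟩ : ∃ b, ∀ x ∈ S.C, b ≤ φ x := by
    obtain ⟨b, hb⟩ := (hS.bounded.isCompact_closure.image hφ).bddBelow
    exact ⟨b, fun x hx => hb ⟨x, subset_closure hx, rfl⟩⟩
  let T : Set (E n) := {x | x ∈ S.C ∧ S.h x ≤ φ x₀ + S.h x₀ - b}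
  have hTc : IsCompact T := Metric.isCompact_of_isClosed_isBounded (hS.isClosed_sublevel _)
    (hS.bounded.subset fun x hx => hx.1)
  have hT₀ : x₀ ∈ T := ⟨hx₀, by linarith [hb x₀ hx₀]⟩
  have hlsc : LowerSemicontinuousOn S.h T := fun x hx r hr => by
    have : {y | y ∈ S.C ∧ S.h y ≤ r}ᶜ ∈ nhds x :=
      (hS.isClosed_sublevel r).isOpen_compl.mem_nhds fun h => (h.2.trans_lt hr).false
    filter_upwards [mem_nhdsWithin_of_mem_nhds this, self_mem_nhdsWithin] with y hy hyT
    exact not_le.1 fun h => hy ⟨hyT.1, h⟩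
  obtain ⟨y, hyT, hy⟩ := (hφ.lowerSemicontinuous.lowerSemicontinuousOn T |>.add hlsc).exists_isMinOn
    ⟨x₀, hT₀⟩ hTc
  refine ⟨y, hyT.1, fun u hu => ?_⟩
  by_cases h : u ∈ T
  · exact hy h
  · have h1 : φ x₀ + S.h x₀ - b < S.h u := not_le.1 fun h' => h ⟨hu, h'⟩
    have h2 : φ y + S.h y ≤ φ x₀ + S.h x₀ := hy hT₀
    have h3 := hb u hu
    change φ y + S.h y ≤ φ u + S.h u
    linarith

end SimplePart.Admissible

theorem nonneg_of_forall_mul_add_sq {a b : ℝ} (h : ∀ t : ℝ, 0 < t → t ≤ 1 → 0 ≤ t * a + t ^ 2 * b) :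
    0 ≤ a := by
  have e := hasDerivAt_id (0 : ℝ)
  have h1 : HasDerivAt (fun t : ℝ => -(t * a + t ^ 2 * b)) (-a) 0 :=
    ((e.mul_const a).add ((e.pow 2).mul_const b)).neg.congr_deriv (by simp)
  have := deriv_nonpos_of_nonpos_right h1 (by simp) fun t h0 h1 => neg_nonpos.2 (h t h0 h1)
  linarith

namespace SimplePart.IsProx

variable {n : ℕ} {S : SimplePart n} {g c y u : E n} {κ : ℝ}

/-- The first-order optimality condition, obtained by comparing `y` with `y + t • (u - y)` and
keeping the terms linear in `t` as `t → 0`. -/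
theorem h_sub_le (hS : S.Admissible) (hy : S.IsProx g c κ y) (hu : u ∈ S.C) :
    S.h y - S.h u ≤ inner ℝ (g + κ • (y - c)) (u - y) := by
  have key : 0 ≤ inner ℝ (g + κ • (y - c)) (u - y) + (S.h u - S.h y) := by
    refine nonneg_of_forall_mul_add_sq (b := κ / 2 * ‖u - y‖ ^ 2) fun t ht ht1 => ?_
    have hm : y + t • (u - y) ∈ S.C := hS.convex_C.add_smul_sub_mem hy.1 hu ⟨ht.le, ht1⟩
    have h1 := hy.2 _ hm
    have h2 := hS.convexOn_h.2 hy.1 hu (sub_nonneg.2 ht1) ht.le (by ring)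
    rw [show (1 - t) • y + t • u = y + t • (u - y) by module] at h2
    rw [show y + t • (u - y) - c = (y - c) + t • (u - y) by abel, norm_add_sq_real,
      inner_add_right, real_inner_smul_right, real_inner_smul_right, norm_smul, mul_pow,
      Real.norm_eq_abs, sq_abs] at h1
    rw [inner_add_left, real_inner_smul_left]
    simp only [smul_eq_mul] at h2
    linarith
  linarith

theorem three_point (hS : S.Admissible) (hy : S.IsProx g c κ y) (hu : u ∈ S.C) :
    inner ℝ g y + κ / 2 * ‖y - c‖ ^ 2 + S.h y + κ / 2 * ‖u - y‖ ^ 2 ≤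
      inner ℝ g u + κ / 2 * ‖u - c‖ ^ 2 + S.h u := by
  have h1 := hy.h_sub_le hS hu
  have h2 : ‖u - c‖ ^ 2 = ‖u - y‖ ^ 2 + 2 * inner ℝ (u - y) (y - c) + ‖y - c‖ ^ 2 := by
    rw [← norm_add_sq_real, sub_add_sub_cancel]
  rw [inner_add_left, real_inner_smul_left, inner_sub_right g, real_inner_comm (u - y)] at h1
  rw [h2]
  linarith

end SimplePart.IsProx

/-! ### Proximal gradient steps -/

section Steps

variable {n : ℕ} {S : SimplePart n} {A : Set (E n)} {Φ : E n → ℝ} {G : E n → E n} {μ ℓ : ℝ}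

theorem prox_step (hS : S.Admissible) (hA : S.C ⊆ A) (hG : FirstOrderModel A Φ G μ ℓ) {w y u : E n}
    (hw : w ∈ A) (hy : S.IsProx (G w) w ℓ y) (hu : u ∈ S.C) :
    Φ y + S.h y + ℓ / 2 * ‖y - u‖ ^ 2 ≤ Φ u + S.h u + (ℓ - μ) / 2 * ‖w - u‖ ^ 2 := by
  have h1 := hy.three_point hS hu
  have h2 := hG.lower w hw u (hA hu)
  have h3 := hG.upper w hw y (hA hy.1)
  rw [inner_sub_right] at h2 h3
  rw [norm_sub_rev y u, norm_sub_rev w u]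
  linarith

theorem objective_convex_comb (hS : S.Admissible) (hA : S.C ⊆ A) (hG : FirstOrderModel A Φ G μ ℓ)
    {y u : E n} {a : ℝ} (h0 : 0 ≤ a) (h1 : a ≤ 1) (hy : y ∈ S.C) (hu : u ∈ S.C) :
    (1 - a) • y + a • u ∈ S.C ∧
    Φ ((1 - a) • y + a • u) + S.h ((1 - a) • y + a • u) + μ / 2 * (a * (1 - a)) * ‖y - u‖ ^ 2 ≤
      (1 - a) * (Φ y + S.h y) + a * (Φ u + S.h u) := by
  have hm := hS.convex_C hy hu (sub_nonneg.2 h1) h0 (by ring)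
  refine ⟨hm, ?_⟩
  have k1 := hG.lower _ (hA hm) y (hA hy)
  have k2 := hG.lower _ (hA hm) u (hA hu)
  have k3 := hS.convexOn_h.2 hy hu (sub_nonneg.2 h1) h0 (by ring)
  rw [show y - ((1 - a) • y + a • u) = a • (y - u) by module, real_inner_smul_right, norm_smul,
    mul_pow, Real.norm_eq_abs, sq_abs] at k1
  rw [show u - ((1 - a) • y + a • u) = (-(1 - a)) • (y - u) by module, real_inner_smul_right,
    norm_smul, mul_pow, Real.norm_eq_abs, sq_abs] at k2
  have k4 := mul_le_mul_of_nonneg_left k1 (sub_nonneg.2 h1)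
  have k5 := mul_le_mul_of_nonneg_left k2 h0
  simp only [smul_eq_mul] at k3
  linarith

/-- One accelerated step in the convex case. -/
theorem accelerated_step_convex (hS : S.Admissible) (hA : S.C ⊆ A)
    (hG : FirstOrderModel A Φ G 0 ℓ) {y y' v v' w u : E n} {a : ℝ} (h0 : 0 ≤ a) (h1 : a ≤ 1)
    (hy : y ∈ S.C) (hu : u ∈ S.C) (hw : w ∈ A) (hy' : S.IsProx (G w) w ℓ y')
    (hwv : w = (1 - a) • y + a • v) (hv' : a • v' = y' - (1 - a) • y) :
    Φ y' + S.h y' + ℓ / 2 * a ^ 2 * ‖v' - u‖ ^ 2 ≤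
      (1 - a) * (Φ y + S.h y) + a * (Φ u + S.h u) + ℓ / 2 * a ^ 2 * ‖v - u‖ ^ 2 := by
  obtain ⟨hm, k1⟩ := objective_convex_comb hS hA hG h0 h1 hy hu
  -- The comparison point is the convex combination of `y` and `u`: its distances to `y'` and `w`
  -- are `a` times those of `v'` and `v` to `u`.
  have k2 := prox_step hS hA hG hw hy' hm
  have e1 : y' - ((1 - a) • y + a • u) = a • (v' - u) := by rw [smul_sub, hv']; module
  have e2 : w - ((1 - a) • y + a • u) = a • (v - u) := by rw [hwv]; module
  rw [e1, e2, norm_smul, norm_smul, mul_pow, mul_pow, Real.norm_eq_abs, sq_abs] at k2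
  linarith

/-- Convexity of the squared norm with weights `a / (1 + a)` and `1 / (1 + a)`; the defect is `a *
‖p - q‖ ^ 2`. -/
theorem norm_smul_add_sq_le (p q : E n) {a : ℝ} (ha : 0 ≤ a) :
    ‖a • p + q‖ ^ 2 ≤ (1 + a) * (a * ‖p‖ ^ 2 + ‖q‖ ^ 2) := by
  have h1 := norm_sub_sq_real p q
  have h2 : ‖a • p + q‖ ^ 2 = a ^ 2 * ‖p‖ ^ 2 + 2 * (a * inner ℝ p q) + ‖q‖ ^ 2 := by
    rw [norm_add_sq_real, norm_smul, mul_pow, real_inner_smul_left, Real.norm_eq_abs, sq_abs]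
  have h3 := mul_nonneg ha (sq_nonneg ‖p - q‖)
  rw [h1] at h3
  rw [h2]
  linarith

/-- One accelerated step in the strongly convex case. -/
theorem accelerated_step_strong (hS : S.Admissible) (hA : S.C ⊆ A)
    (hG : FirstOrderModel A Φ G μ ℓ) {y y' v v' w u : E n} {a : ℝ} (h0 : 0 ≤ a) (h1 : a ≤ 1)
    (hℓ : 0 ≤ ℓ) (haμ : ℓ * a ^ 2 = μ)
    (hy : y ∈ S.C) (hu : u ∈ S.C) (hw : w ∈ A) (hy' : S.IsProx (G w) w ℓ y')
    (hwv : (1 + a) • w = y + a • v) (hv' : a • v' = y' - (1 - a) • y) :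
    Φ y' + S.h y' - (Φ u + S.h u) + μ / 2 * ‖v' - u‖ ^ 2 ≤
      (1 - a) * (Φ y + S.h y - (Φ u + S.h u) + μ / 2 * ‖v - u‖ ^ 2) := by
  obtain ⟨hm, k1⟩ := objective_convex_comb hS hA hG h0 h1 hy hu
  have k2 := prox_step hS hA hG hw hy' hm
  have e1 : y' - ((1 - a) • y + a • u) = a • (v' - u) := by rw [smul_sub, hv']; module
  have e2 : (1 + a) • (w - ((1 - a) • y + a • u)) = a • (a • (y - u) + (v - u)) := by
    rw [smul_sub, hwv]; module
  have k3 : (1 + a) ^ 2 * ‖w - ((1 - a) • y + a • u)‖ ^ 2 ≤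
      (1 + a) ^ 2 * (a ^ 2 / (1 + a) * (a * ‖y - u‖ ^ 2 + ‖v - u‖ ^ 2)) := by
    have e3 := congrArg (fun x => ‖x‖ ^ 2) e2
    simp only [norm_smul, mul_pow, Real.norm_eq_abs, sq_abs] at e3
    rw [e3]
    have := mul_le_mul_of_nonneg_left (norm_smul_add_sq_le (y - u) (v - u) h0) (sq_nonneg a)
    refine this.trans_eq ?_
    field_simp
  have k4 := le_of_mul_le_mul_left k3 (by positivity)
  have k5 : 0 ≤ ℓ - μ := by
    rw [← haμ, ← mul_one_sub]
    exact mul_nonneg hℓ (sub_nonneg.2 (pow_le_one₀ h0 h1))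
  have k6 := mul_le_mul_of_nonneg_left k4 (div_nonneg k5 zero_le_two)
  -- With `μ = ℓ * a ^ 2` the factor becomes exactly `(1 - a) * μ / 2`. The `‖y - u‖` term then
  -- cancels against the strong convexity gain in `k1`.
  have k7 : (ℓ - μ) / 2 * (a ^ 2 / (1 + a) * (a * ‖y - u‖ ^ 2 + ‖v - u‖ ^ 2)) =
      (1 - a) * (μ / 2) * (a * ‖y - u‖ ^ 2 + ‖v - u‖ ^ 2) := by
    rw [← haμ]; field_simp; ring
  rw [e1, norm_smul, mul_pow, Real.norm_eq_abs, sq_abs, ← mul_assoc,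
    show ℓ / 2 * a ^ 2 = μ / 2 by rw [← haμ]; ring] at k2
  linarith

/-- Optimality of the proximal point turns `ℓ • (w - y) - (G w - G y)` into a subgradient of the
objective at `y`. -/
theorem first_step_le_inner (hS : S.Admissible) (hA : S.C ⊆ A) (hμ : 0 ≤ μ)
    (hG : FirstOrderModel A Φ G μ ℓ) {w y u : E n} (hy : S.IsProx (G w) w ℓ y) (hu : u ∈ S.C) :
    Φ y + S.h y - (Φ u + S.h u) ≤ inner ℝ (ℓ • (w - y) - (G w - G y)) (y - u) := by
  have h1 := hy.h_sub_le hS hu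
  have h2 := hG.lower y (hA hy.1) u (hA hu)
  have h3 : 0 ≤ μ / 2 * ‖u - y‖ ^ 2 := by positivity
  have e : inner ℝ (G w + ℓ • (y - w)) (u - y) + inner ℝ (ℓ • (w - y) - (G w - G y)) (u - y) =
      inner ℝ (G y) (u - y) := by rw [← inner_add_left]; congr 1; module
  rw [← neg_sub u y, inner_neg_right]
  linarith

theorem first_step_le_lipschitz (hS : S.Admissible) (hA : S.C ⊆ A) (hμ : 0 ≤ μ) (hℓ : 0 ≤ ℓ)
    (hG : FirstOrderModel A Φ G μ ℓ) {w y u : E n} (hw : w ∈ S.C) (hy : S.IsProx (G w) w ℓ y)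
    (hu : u ∈ S.C) : Φ y + S.h y - (Φ u + S.h u) ≤ 2 * ℓ * S.D * ‖y - u‖ := by
  refine (first_step_le_inner hS hA hμ hG hy hu).trans ((real_inner_le_norm _ _).trans ?_)
  refine mul_le_mul_of_nonneg_right ?_ (norm_nonneg _)
  have h1 := norm_sub_le (ℓ • (w - y)) (G w - G y)
  have h2 := hG.lipschitz w (hA hw) y (hA hy.1)
  have h3 := mul_le_mul_of_nonneg_left (hS.norm_sub_le_D hw hy.1) hℓ
  rw [norm_smul, Real.norm_of_nonneg hℓ] at h1
  linarith

/-- The Baillon–Haddad argument: the lower model at `y` and the upper model at `x` are compared at a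
gradient step from `x`, and the result is added to its mirror image. The step has length at most `‖x
- y‖ ≤ D`, so it may leave `C` but not `nbhd`. -/
theorem cocoercive (hS : S.Admissible) (hμ : 0 ≤ μ) (hℓ : 0 < ℓ)
    (hG : FirstOrderModel S.nbhd Φ G μ ℓ) {x y : E n} (hx : x ∈ S.C) (hy : y ∈ S.C) :
    ‖G x - G y‖ ^ 2 ≤ ℓ * inner ℝ (G x - G y) (x - y) := by
  have hA : S.C ⊆ S.nbhd := Metric.self_subset_cthickening S.C
  have key : ∀ x ∈ S.C, ∀ y ∈ S.C,
      Φ y - Φ x + inner ℝ (G y) (x - y) ≤ -(‖G x - G y‖ ^ 2 / (2 * ℓ)) := fun x hx y hy => by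
    have hm : x - ℓ⁻¹ • (G x - G y) ∈ S.nbhd := by
      refine Metric.mem_cthickening_of_dist_le _ x _ _ hx ?_
      rw [dist_eq_norm, sub_sub_cancel_left, norm_neg, norm_smul,
        Real.norm_of_nonneg (inv_pos.2 hℓ).le, inv_mul_le_iff₀ hℓ]
      exact (hG.lipschitz x (hA hx) y (hA hy)).trans
        (mul_le_mul_of_nonneg_left (hS.norm_sub_le_D hx hy) hℓ.le)
    have h1 := hG.lower y (hA hy) _ hm
    have h2 := hG.upper x (hA hx) _ hm
    have h3 : 0 ≤ μ / 2 * ‖x - y - ℓ⁻¹ • (G x - G y)‖ ^ 2 := by positivity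
    have e : x - ℓ⁻¹ • (G x - G y) - y = (x - y) - ℓ⁻¹ • (G x - G y) := by abel
    have e2 : inner ℝ (G x - G y) (G x - G y) = ‖G x - G y‖ ^ 2 := real_inner_self_eq_norm_sq _
    rw [inner_sub_left] at e2
    rw [sub_sub_cancel_left, norm_neg, norm_smul, mul_pow, Real.norm_eq_abs, sq_abs, inner_neg_right,
      real_inner_smul_right] at h2
    rw [e, inner_sub_right (G y), real_inner_smul_right] at h1
    have e3 : ℓ⁻¹ * inner ℝ (G x) (G x - G y) - ℓ⁻¹ * inner ℝ (G y) (G x - G y) =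
        ℓ⁻¹ * ‖G x - G y‖ ^ 2 := by rw [← e2]; ring
    have e4 : ℓ / 2 * (ℓ⁻¹ ^ 2 * ‖G x - G y‖ ^ 2) = ℓ⁻¹ * ‖G x - G y‖ ^ 2 / 2 := by
      field_simp
    have e5 : ‖G x - G y‖ ^ 2 / (2 * ℓ) = ℓ⁻¹ * ‖G x - G y‖ ^ 2 / 2 := by
      field_simp
    linarith
  have h1 := key x hx y hy
  have h2 := key y hy x hx
  rw [norm_sub_rev (G y)] at h2
  have h3 : inner ℝ (G x - G y) (x - y) = - inner ℝ (G y) (x - y) - inner ℝ (G x) (y - x) := by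
    rw [inner_sub_left, ← neg_sub x y, inner_neg_right]; ring
  have h4 : ‖G x - G y‖ ^ 2 / ℓ ≤ inner ℝ (G x - G y) (x - y) := by
    rw [h3]
    have : ‖G x - G y‖ ^ 2 / ℓ = 2 * (‖G x - G y‖ ^ 2 / (2 * ℓ)) := by field_simp
    linarith
  rwa [div_le_iff₀ hℓ, mul_comm] at h4

/-- Cocoercivity places `G w - G y` in the ball with centre `(ℓ / 2) • (w - y)` and radius `ℓ / 2 *
‖w - y‖`. The gap is then at most `ℓ / 2` times `‖w - y‖ * ‖y - u‖ + ⟨w - y, y - u⟩`, which is at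
most half of `‖w - u‖ ^ 2`. -/
theorem first_step_le_cocoercive (hS : S.Admissible) (hμ : 0 ≤ μ) (hℓ : 0 < ℓ)
    (hG : FirstOrderModel S.nbhd Φ G μ ℓ) {w y u : E n} (hw : w ∈ S.C)
    (hy : S.IsProx (G w) w ℓ y) (hu : u ∈ S.C) :
    Φ y + S.h y - (Φ u + S.h u) ≤ ℓ / 4 * ‖w - u‖ ^ 2 := by
  have h1 := first_step_le_inner hS (Metric.self_subset_cthickening S.C) hμ hG hy hu
  have h2 := cocoercive hS hμ hℓ hG hw hy.1
  have h3 : ‖(ℓ / 2) • (w - y) - (G w - G y)‖ ≤ ℓ / 2 * ‖w - y‖ := by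
    refine le_of_sq_le_sq ?_ (by positivity)
    rw [norm_sub_sq_real, norm_smul, real_inner_smul_left, real_inner_comm,
      Real.norm_of_nonneg (by positivity)]
    linarith
  have h4 : inner ℝ (ℓ • (w - y) - (G w - G y)) (y - u) =
      inner ℝ ((ℓ / 2) • (w - y) - (G w - G y)) (y - u) + ℓ / 2 * inner ℝ (w - y) (y - u) := by
    rw [← real_inner_smul_left, ← inner_add_left]; congr 1; module
  have h5 := real_inner_le_norm ((ℓ / 2) • (w - y) - (G w - G y)) (y - u)
  have h6 := mul_le_mul_of_nonneg_right h3 (norm_nonneg (y - u))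
  have h7 : ‖w - u‖ ^ 2 = ‖w - y‖ ^ 2 + 2 * inner ℝ (w - y) (y - u) + ‖y - u‖ ^ 2 := by
    rw [← norm_add_sq_real, sub_add_sub_cancel]
  have h8 := mul_nonneg hℓ.le (sq_nonneg (‖w - y‖ - ‖y - u‖))
  rw [h7]
  linarith

end Steps

/-! ### Iteration counts -/

/-- The number of iterations that suffice for the tolerance `ε`. -/
def iterBound (μ D ℓ ε : ℝ) : ℝ :=
  if μ = 0 then D * √(2 * ℓ / ε) + 1
  else 2 * √(ℓ / μ) * max 0 (Real.log ((ℓ + μ) * D ^ 2 / (2 * ε))) + 1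

/-- Every run of the solver on a composite problem, whose smooth part has a first-order
model on `A`, reaches the tolerance within `iterBound` iterations, and runs exist. -/
def Solver.Reaches {n : ℕ} (R : Solver n) (S : SimplePart n) (A : Set (E n)) (μ : ℝ) : Prop :=
  ∀ (Φ : E n → ℝ) (G : E n → E n) (ℓ : ℝ) (x₀ : E n), FirstOrderModel A Φ G μ ℓ → 0 ≤ ℓ →
    μ ≤ ℓ / 4 → x₀ ∈ S.C → (∃ y, R G ℓ x₀ y) ∧
    ∀ y, R G ℓ x₀ y → ∀ ε, 0 < ε → ∃ j : ℕ, (j : ℝ) ≤ iterBound μ S.D ℓ ε ∧ y j ∈ S.C ∧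
      ∀ u ∈ S.C, Φ (y j) + S.h (y j) ≤ Φ u + S.h u + ε

theorem exists_count_convex {D ℓ ε : ℝ} (hD : 0 ≤ D) (hℓ : 0 ≤ ℓ) (hε : 0 < ε) :
    ∃ j : ℕ, ((j + 1 : ℕ) : ℝ) ≤ iterBound 0 D ℓ ε ∧ ℓ / 2 * (2 / (j + 2)) ^ 2 * D ^ 2 ≤ ε := by
  have h0 : 0 ≤ D * √(2 * ℓ / ε) := by positivity
  refine ⟨⌊D * √(2 * ℓ / ε)⌋₊, ?_, ?_⟩
  · rw [iterBound, if_pos rfl]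
    push_cast
    linarith [Nat.floor_le h0]
  · have h1 := Nat.lt_floor_add_one (D * √(2 * ℓ / ε))
    set j : ℝ := (⌊D * √(2 * ℓ / ε)⌋₊ : ℝ)
    have hj : 0 ≤ j := Nat.cast_nonneg _
    have h2 : (D * √(2 * ℓ / ε)) ^ 2 ≤ (j + 2) ^ 2 := pow_le_pow_left₀ h0 (by linarith) 2
    rw [mul_pow, Real.sq_sqrt (by positivity), ← mul_div_assoc, div_le_iff₀ hε] at h2
    have e : ℓ / 2 * (2 / (j + 2)) ^ 2 * D ^ 2 = D ^ 2 * (2 * ℓ) / (j + 2) ^ 2 := by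
      field_simp
    rw [e, div_le_iff₀ (by positivity)]
    linarith

theorem one_sub_pow_le_exp {a : ℝ} (h1 : a ≤ 1) (n : ℕ) : (1 - a) ^ n ≤ Real.exp (-(a * n)) := by
  have := pow_le_pow_left₀ (sub_nonneg.2 h1) (Real.one_sub_le_exp_neg a) n
  rwa [← Real.exp_nat_mul, mul_neg, mul_comm] at this

theorem sqrt_div_eq_inv {a ℓ μ : ℝ} (ha : 0 < a) (hℓ : 0 < ℓ) (haμ : ℓ * a ^ 2 = μ) :
    √(ℓ / μ) = a⁻¹ := by
  rw [← haμ, show ℓ / (ℓ * a ^ 2) = a⁻¹ ^ 2 by field_simp, Real.sqrt_sq (by positivity)]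

/-- The factor `2` in `iterBound` yields `Q ^ 2` instead of `Q`. As `ε < ℓ / 4 * D ^ 2` forces `Y >
4`, this square dominates `Y` with enough room for the constant `3 / 4` and for the factor `exp a`
lost by rounding down. -/
theorem exists_count_strong {a D ℓ μ ε : ℝ} (ha : 0 < a) (ha1 : a ≤ 1 / 2) (hℓ : 0 < ℓ)
    (haμ : ℓ * a ^ 2 = μ) (hε : 0 < ε) (hlarge : ε < ℓ / 4 * D ^ 2) :
    ∃ n : ℕ, ((n + 1 : ℕ) : ℝ) ≤ iterBound μ D ℓ ε ∧ (1 - a) ^ n * (3 / 4 * ℓ * D ^ 2) ≤ ε := by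
  have hμ : μ ≠ 0 := by rw [← haμ]; positivity
  set Q := (ℓ + μ) * D ^ 2 / (2 * ε) with hQ
  set Y := ℓ * D ^ 2 / ε with hY
  have hYQ : Q = (1 + a ^ 2) * Y / 2 := by rw [hQ, hY, ← haμ]; field_simp
  have hY4 : 4 < Y := by rw [hY, lt_div_iff₀ hε]; linarith
  have hQ1 : 1 < Q := by rw [hYQ]; nlinarith [sq_nonneg a]
  have hL := Real.log_pos hQ1
  have h0 : 0 ≤ 2 * a⁻¹ * Real.log Q := by positivity
  refine ⟨⌊2 * a⁻¹ * Real.log Q⌋₊, ?_, ?_⟩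
  · rw [iterBound, if_neg hμ, sqrt_div_eq_inv ha hℓ haμ, max_eq_right hL.le]
    push_cast
    linarith [Nat.floor_le h0]
  · have h1 := Nat.lt_floor_add_one (2 * a⁻¹ * Real.log Q)
    set n := ⌊2 * a⁻¹ * Real.log Q⌋₊
    have h2 : 2 * Real.log Q - a ≤ a * n := by
      have := mul_le_mul_of_nonneg_left h1.le ha.le
      have e : a * (2 * a⁻¹ * Real.log Q) = 2 * Real.log Q := by field_simp
      linarith
    have h3 : Real.exp (-(a * n)) ≤ Real.exp a / Q ^ 2 := by
      rw [← Real.exp_log (zero_lt_one.trans hQ1), ← Real.exp_nat_mul, ← Real.exp_sub]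
      refine Real.exp_le_exp.2 ?_
      push_cast
      linarith
    have h4 : Real.exp a ≤ 1 + a + a ^ 2 := by
      have := (abs_le.1 (Real.abs_exp_sub_one_sub_id_le (x := a)
        (abs_le.2 ⟨by linarith, by linarith⟩))).2
      linarith
    have h5 : 3 / 4 * Real.exp a ≤ (1 + a ^ 2) ^ 2 := by
      nlinarith [sq_nonneg (a - 3 / 10), sq_nonneg (a ^ 2)]
    have h6 : 3 / 4 * Y * Real.exp a ≤ Q ^ 2 := by
      have : (1 + a ^ 2) ^ 2 * Y ≤ (1 + a ^ 2) ^ 2 * (Y ^ 2 / 4) :=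
        mul_le_mul_of_nonneg_left (by nlinarith) (by positivity)
      have := mul_le_mul_of_nonneg_right h5 (show 0 ≤ Y by linarith)
      rw [hYQ]
      linarith
    have h7 : (1 - a) ^ n ≤ Real.exp a / Q ^ 2 := (one_sub_pow_le_exp (by linarith) n).trans h3
    have h8 : (1 - a) ^ n * (3 / 4 * Y) ≤ 1 := by
      refine (mul_le_mul_of_nonneg_right h7 (by linarith)).trans ?_
      rw [div_mul_eq_mul_div, div_le_one (by positivity)]
      linarith
    have e : 3 / 4 * ℓ * D ^ 2 = 3 / 4 * Y * ε := by rw [hY]; field_simp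
    rw [e, ← mul_assoc]
    exact mul_le_of_le_one_left hε.le h8

/-- If `n ≥ 1`, then `n + 1 ≤ 2 * n`, and the factor `2` in `iterBound` pays for rounding down. If
`n = 0`, then `Q ≤ exp (a / 2)`, so a bound for a single step, better than the general rate, has to
be supplied separately. -/
theorem exists_count_strong_one {a D ℓ μ ε : ℝ} (ha : 0 < a) (ha1 : a ≤ 1 / 2) (hℓ : 0 < ℓ)
    (haμ : ℓ * a ^ 2 = μ) (hε : 0 < ε) :
    ∃ n : ℕ, ((n + 1 : ℕ) : ℝ) ≤ iterBound μ D ℓ ε ∧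
      (n = 0 ∧ ℓ / 2 * D ^ 2 * ((1 + a ^ 2) * (1 - a / 2)) ≤ ε ∨
        (1 - a) ^ n * (ℓ / 2 * D ^ 2) ≤ ε) := by
  have hμ : μ ≠ 0 := by rw [← haμ]; positivity
  set Q := (ℓ + μ) * D ^ 2 / (2 * ε) with hQ
  have hQe : Q = (1 + a ^ 2) * (ℓ / 2 * D ^ 2) / ε := by rw [hQ, ← haμ]; field_simp
  have hQ0 : 0 ≤ Q := by rw [hQe]; positivity
  set L := max 0 (Real.log Q) with hL
  have hL0 : 0 ≤ L := le_max_left _ _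
  have h0 : 0 ≤ 2 * a⁻¹ * L := by positivity
  refine ⟨⌊2 * a⁻¹ * L⌋₊, ?_, ?_⟩
  · rw [iterBound, if_neg hμ, sqrt_div_eq_inv ha hℓ haμ]
    push_cast
    linarith [Nat.floor_le h0]
  have h1 := Nat.lt_floor_add_one (2 * a⁻¹ * L)
  set n := ⌊2 * a⁻¹ * L⌋₊
  have h2 : 2 * L ≤ a * (n + 1) := by
    have := mul_le_mul_of_nonneg_left h1.le ha.le
    have e : a * (2 * a⁻¹ * L) = 2 * L := by field_simp
    linarith
  rcases hQ0.eq_or_lt with hQz | hQpos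
  · right
    have : (1 + a ^ 2) * (ℓ / 2 * D ^ 2) = 0 := by
      rw [hQe] at hQz
      exact (div_eq_zero_iff.1 hQz.symm).resolve_right hε.ne'
    rw [(mul_eq_zero.1 this).resolve_left (by positivity), mul_zero]
    exact hε.le
  rcases Nat.eq_zero_or_pos n with hn | hn
  · left
    refine ⟨hn, ?_⟩
    rw [hn] at h2
    push_cast at h2
    have h3 : Real.log Q ≤ a / 2 := (le_max_right _ _).trans (show L ≤ a / 2 by linarith)
    have h4 : Q * Real.exp (-(a / 2)) ≤ 1 := by
      rw [← Real.exp_log hQpos, ← Real.exp_add]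
      exact Real.exp_le_one_iff.2 (by linarith)
    have h5 := mul_le_mul_of_nonneg_left (Real.one_sub_le_exp_neg (a / 2)) hQpos.le
    have e : ℓ / 2 * D ^ 2 * ((1 + a ^ 2) * (1 - a / 2)) = Q * (1 - a / 2) * ε := by
      rw [hQe]; field_simp
    rw [e]
    exact mul_le_of_le_one_left hε.le (h5.trans h4)
  · right
    have hn1 : (1 : ℝ) ≤ n := by exact_mod_cast hn
    have h3 : Real.log Q ≤ a * n := (le_max_right _ _).trans
      (show L ≤ a * n by nlinarith)
    have h4 : (1 - a) ^ n ≤ Q⁻¹ := (one_sub_pow_le_exp (by linarith) n).trans (by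
      rw [Real.exp_neg]
      exact inv_anti₀ hQpos ((Real.log_le_iff_le_exp hQpos).1 h3))
    have h5 : ℓ / 2 * D ^ 2 ≤ Q * ε := by
      rw [hQe, div_mul_cancel₀ _ hε.ne']
      nlinarith [mul_nonneg (sq_nonneg a) (mul_nonneg hℓ.le (sq_nonneg D))]
    refine (mul_le_mul h4 h5 (by positivity) (by positivity)).trans_eq ?_
    field_simp

/-! ### Nesterov's method -/

theorem IsNesterovRun.isProx {n : ℕ} {S : SimplePart n} {μ ℓ : ℝ} {G : E n → E n} {x₀ : E n}
    {y w : ℕ → E n} {α : ℕ → ℝ} (h : IsNesterovRun S μ G ℓ x₀ y w α) (j : ℕ) :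
    S.IsProx (G (w j)) (w j) ℓ (y (j + 1)) := ⟨h.y_mem j, h.y_step j⟩

theorem exists_isNesterovRun {n : ℕ} {S : SimplePart n} (hS : S.Admissible) (μ ℓ : ℝ)
    (G : E n → E n) {x₀ : E n} (hx₀ : x₀ ∈ S.C) : ∃ y w α, IsNesterovRun S μ G ℓ x₀ y w α := by
  choose pr hpr using fun g c => hS.exists_isProx ⟨x₀, hx₀⟩ g c ℓ
  let α : ℕ → ℝ := fun j => Nat.rec (if μ = 0 then 1 else √(μ / ℓ))
    (fun _ a => (μ / ℓ - a ^ 2 + √((μ / ℓ - a ^ 2) ^ 2 + 4 * a ^ 2)) / 2) j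
  let s : ℕ → E n × E n := fun j => Nat.rec (x₀, x₀)
    (fun j q => (pr (G q.2) q.2, pr (G q.2) q.2 +
      (α j * (1 - α j) / (α j ^ 2 + α (j + 1))) • (pr (G q.2) q.2 - q.1))) j
  exact ⟨fun j => (s j).1, fun j => (s j).2, α, rfl, rfl, rfl, fun j => (hpr _ _).1,
    fun j => (hpr _ _).2, fun _ => rfl, fun _ => rfl⟩

section Nesterov

variable {n : ℕ} {S : SimplePart n} {Φ : E n → ℝ} {G : E n → E n} {μ ℓ : ℝ} {x₀ : E n}
  {y w : ℕ → E n} {α : ℕ → ℝ}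

/-- The auxiliary sequence in the analysis of Nesterov's method. -/
def auxSeq (x₀ : E n) (y : ℕ → E n) (α : ℕ → ℝ) : ℕ → E n
  | 0 => x₀
  | j + 1 => y j + (α j)⁻¹ • (y (j + 1) - y j)

/-- With this sequence as `v`, the momentum form of the method becomes the form with `y`, `v`, `w`
that the accelerated steps require. The points of `auxSeq` need not lie in `C`. -/
theorem smul_auxSeq (j : ℕ) (hα : α j ≠ 0) :
    α j • auxSeq x₀ y α (j + 1) = y (j + 1) - (1 - α j) • y j := by
  rw [auxSeq, smul_add, smul_inv_smul₀ hα]; module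

theorem IsNesterovRun.iterate_mem (h : IsNesterovRun S μ G ℓ x₀ y w α) (hx₀ : x₀ ∈ S.C) (j : ℕ) :
    y j ∈ S.C := by
  cases j with
  | zero => rwa [h.y_zero]
  | succ j => exact h.y_mem j

/-- A momentum coefficient in `[0, 1]` moves the query point away from an iterate by at most the
distance of two iterates. This fixes the radius of `nbhd`. -/
theorem IsNesterovRun.query_mem (hS : S.Admissible) (h : IsNesterovRun S μ G ℓ x₀ y w α)
    (hx₀ : x₀ ∈ S.C)
    (hα : ∀ j, 0 ≤ α j * (1 - α j) / (α j ^ 2 + α (j + 1)) ∧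
      α j * (1 - α j) / (α j ^ 2 + α (j + 1)) ≤ 1) (j : ℕ) : w j ∈ S.nbhd := by
  cases j with
  | zero => rw [h.w_zero]; exact Metric.self_subset_cthickening _ hx₀
  | succ j =>
    refine Metric.mem_cthickening_of_dist_le _ (y (j + 1)) _ _ (h.y_mem j) ?_
    rw [h.w_step, dist_eq_norm, add_sub_cancel_left, norm_smul, Real.norm_of_nonneg (hα j).1]
    exact (mul_le_of_le_one_left (norm_nonneg _) (hα j).2).trans
      (hS.norm_sub_le_D (h.y_mem j) (h.iterate_mem hx₀ j))

/-- All facts follow from the quadratic equation that `α (j + 1)` solves. The last one makes the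
momentum coefficient at most `1`. -/
theorem nesterov_alpha_convex {α : ℕ → ℝ} (h0 : α 0 = 1)
    (hs : ∀ j, α (j + 1) = (-α j ^ 2 + √((-α j ^ 2) ^ 2 + 4 * α j ^ 2)) / 2) :
    ∀ j, 0 < α j ∧ α j ≤ 2 / (j + 2) ∧ 0 < α (j + 1) ∧
      α (j + 1) ^ 2 = (1 - α (j + 1)) * α j ^ 2 ∧ α j - 2 * α j ^ 2 ≤ α (j + 1) := by
  have key : ∀ a b : ℝ, 0 < a → b = (-a ^ 2 + √((-a ^ 2) ^ 2 + 4 * a ^ 2)) / 2 →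
      0 < b ∧ b ^ 2 = (1 - b) * a ^ 2 ∧ a - 2 * a ^ 2 ≤ b := fun a b ha hb => by
    have hr : 0 ≤ (-a ^ 2) ^ 2 + 4 * a ^ 2 := by positivity
    have h1 := Real.sq_sqrt hr
    have h2 := Real.sqrt_nonneg ((-a ^ 2) ^ 2 + 4 * a ^ 2)
    set r := √((-a ^ 2) ^ 2 + 4 * a ^ 2)
    have h3 : a ^ 2 < r := lt_of_pow_lt_pow_left₀ 2 h2 (by nlinarith [pow_pos ha 2])
    have h4 : 2 * a ≤ r := le_of_sq_le_sq (by nlinarith [sq_nonneg (a ^ 2)]) h2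
    subst hb
    refine ⟨by linarith, by nlinarith, by nlinarith⟩
  have hpos : ∀ j, 0 < α j := fun j => by
    induction j with
    | zero => rw [h0]; exact one_pos
    | succ j ih => exact (key _ _ ih (hs j)).1
  have hle : ∀ j : ℕ, α j ≤ 2 / (j + 2) := fun j => by
    induction j with
    | zero => rw [h0]; norm_num
    | succ j ih =>
      obtain ⟨h1, h2, -⟩ := key _ _ (hpos j) (hs j)
      push_cast
      rw [le_div_iff₀ (by positivity)] at ih ⊢
      -- For `b = α (j + 1)` with `b * (j + 3) > 2`, the recursion and induction give `(b * (j + 2))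
      -- ^ 2 + 4 * b ≤ 4`, while the left side exceeds `(2 - b) ^ 2 + 4 * b ≥ 4`.
      by_contra! h3
      have hj : (0 : ℝ) ≤ j := Nat.cast_nonneg j
      have h4 : α (j + 1) < 1 := by
        by_contra! h5
        nlinarith [pow_pos (hpos j) 2, pow_pos h1 2, mul_nonneg (sub_nonneg.2 h5) (sq_nonneg (α j))]
      have h5 : (α j * (j + 2)) ^ 2 ≤ 2 ^ 2 :=
        pow_le_pow_left₀ (mul_nonneg (hpos j).le (by positivity)) ih 2
      have h6 : (α (j + 1) * (j + 2)) ^ 2 ≤ (1 - α (j + 1)) * 2 ^ 2 := by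
        rw [mul_pow, h2, mul_assoc, ← mul_pow]
        exact mul_le_mul_of_nonneg_left h5 (by linarith)
      nlinarith [mul_pos h1 (sub_pos.2 h3), mul_nonneg hj h1.le]
  exact fun j => ⟨hpos j, hle j, key _ _ (hpos j) (hs j)⟩

theorem IsNesterovRun.le_convex (hS : S.Admissible) (hG : FirstOrderModel S.nbhd Φ G 0 ℓ)
    (h : IsNesterovRun S 0 G ℓ x₀ y w α) (hx₀ : x₀ ∈ S.C) (hℓ : 0 ≤ ℓ)
    {u : E n} (hu : u ∈ S.C) (j : ℕ) :
    Φ (y (j + 1)) + S.h (y (j + 1)) - (Φ u + S.h u) ≤ ℓ / 2 * (2 / (j + 2)) ^ 2 * S.D ^ 2 := by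
  have hA : S.C ⊆ S.nbhd := Metric.self_subset_cthickening S.C
  have hα0 : α 0 = 1 := by simpa using h.α_zero
  have hα := nesterov_alpha_convex hα0 fun j => by simpa using h.α_step j
  have hα1 : ∀ j, α j ≤ 1 := fun j => (hα j).2.1.trans
    ((div_le_one (by positivity)).2 (by linarith [Nat.cast_nonneg (α := ℝ) j]))
  have hw : ∀ j, w j ∈ S.nbhd := h.query_mem hS hx₀ fun j => by
    obtain ⟨k1, -, k3, -, k5⟩ := hα j
    refine ⟨div_nonneg (mul_nonneg k1.le (sub_nonneg.2 (hα1 j))) (by positivity),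
      (div_le_one (by positivity)).2 (by linarith)⟩
  have hwv : ∀ j, w j = (1 - α j) • y j + α j • auxSeq x₀ y α j := fun j => by
    cases j with
    | zero => rw [h.w_zero, hα0, auxSeq]; module
    | succ j =>
      obtain ⟨k1, -, k3, k4, -⟩ := hα j
      have e : α j * (1 - α j) / (α j ^ 2 + α (j + 1)) = α (j + 1) * ((α j)⁻¹ - 1) := by
        have : α j ^ 2 + α (j + 1) ≠ 0 := by positivity
        field_simp
        linear_combination (α j - 1) * k4
      rw [h.w_step, e, auxSeq]
      module
  -- The identity `α (j + 1) ^ 2 = (1 - α (j + 1)) * α j ^ 2` makes the estimate reproduce itself;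
  -- since `α 0 = 1`, the gap at the starting point drops out.
  have key : ∀ j, Φ (y (j + 1)) + S.h (y (j + 1)) - (Φ u + S.h u) +
      ℓ / 2 * α j ^ 2 * ‖auxSeq x₀ y α (j + 1) - u‖ ^ 2 ≤ ℓ / 2 * α j ^ 2 * ‖x₀ - u‖ ^ 2 := by
    intro j
    have step := fun j => accelerated_step_convex hS hA hG (hα j).1.le (hα1 j)
      (h.iterate_mem hx₀ j) hu (hw j) (h.isProx j) (hwv j)
      (smul_auxSeq (x₀ := x₀) j (hα j).1.ne')
    induction j with
    | zero =>
      have := step 0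
      rw [hα0] at this ⊢
      rw [show auxSeq x₀ y α 0 = x₀ from rfl] at this
      linarith
    | succ j ih =>
      have k1 := step (j + 1)
      have k2 := mul_le_mul_of_nonneg_left ih (sub_nonneg.2 (hα1 (j + 1)))
      have k4 := (hα j).2.2.2.1
      have e1 : ℓ / 2 * α (j + 1) ^ 2 * ‖auxSeq x₀ y α (j + 1) - u‖ ^ 2 = (1 - α (j + 1)) *
        (ℓ / 2 * α j ^ 2 * ‖auxSeq x₀ y α (j + 1) - u‖ ^ 2) := by rw [k4]; ring
      have e2 : ℓ / 2 * α (j + 1) ^ 2 * ‖x₀ - u‖ ^ 2 = (1 - α (j + 1)) *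
        (ℓ / 2 * α j ^ 2 * ‖x₀ - u‖ ^ 2) := by rw [k4]; ring
      linarith
  have k1 : 0 ≤ ℓ / 2 * α j ^ 2 * ‖auxSeq x₀ y α (j + 1) - u‖ ^ 2 := by positivity
  have k2 : ℓ / 2 * α j ^ 2 * ‖x₀ - u‖ ^ 2 ≤ ℓ / 2 * (2 / (j + 2)) ^ 2 * S.D ^ 2 := by
    refine mul_le_mul (mul_le_mul_of_nonneg_left ?_ (by positivity)) ?_ (by positivity)
      (by positivity)
    · exact pow_le_pow_left₀ (hα j).1.le (hα j).2.1 2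
    · exact pow_le_pow_left₀ (norm_nonneg _) (hS.norm_sub_le_D hx₀ hu) 2
  linarith [key j]

theorem IsNesterovRun.le_strong (hS : S.Admissible) (hG : FirstOrderModel S.nbhd Φ G μ ℓ)
    (h : IsNesterovRun S μ G ℓ x₀ y w α) (hx₀ : x₀ ∈ S.C) (hμ : 0 < μ) (hℓ : 0 < ℓ) {a : ℝ}
    (ha : a = √(μ / ℓ)) (ha1 : a ≤ 1) {u : E n} (hu : u ∈ S.C) (j : ℕ) :
    Φ (y (j + 1)) + S.h (y (j + 1)) - (Φ u + S.h u) ≤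
      (1 - a) ^ j * (3 / 4 * ℓ * S.D ^ 2) := by
  have hA : S.C ⊆ S.nbhd := Metric.self_subset_cthickening S.C
  have ha0 : 0 < a := ha ▸ Real.sqrt_pos.2 (div_pos hμ hℓ)
  have hq : μ / ℓ = a ^ 2 := by rw [ha, Real.sq_sqrt (div_pos hμ hℓ).le]
  have haμ : ℓ * a ^ 2 = μ := by rw [← hq]; field_simp
  have hα : ∀ j, α j = a := fun j => by
    induction j with
    | zero => rw [h.α_zero, if_neg hμ.ne', ha]
    | succ j ih =>
      rw [h.α_step, ih, hq, sub_self, zero_add, zero_pow two_ne_zero, zero_add,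
        show 4 * a ^ 2 = (2 * a) ^ 2 by ring, Real.sqrt_sq (by positivity)]
      ring
  have hb : ∀ j, α j * (1 - α j) / (α j ^ 2 + α (j + 1)) = (1 - a) / (1 + a) := fun j => by
    rw [hα, hα]; field_simp; ring
  have hw : ∀ j, w j ∈ S.nbhd := h.query_mem hS hx₀ fun j => by
    rw [hb]
    exact ⟨div_nonneg (sub_nonneg.2 ha1) (by positivity),
      (div_le_one (by positivity)).2 (by linarith)⟩
  have hwv : ∀ j, (1 + a) • w j = y j + a • auxSeq x₀ y α j := fun j => by
    cases j with
    | zero => rw [h.w_zero, h.y_zero, auxSeq]; module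
    | succ j =>
      rw [h.w_step, hb, auxSeq, hα, smul_add, smul_add, smul_smul, smul_smul,
        mul_div_cancel₀ _ (by positivity), mul_inv_cancel₀ ha0.ne']
      module
  have haux : ∀ j, a • auxSeq x₀ y α (j + 1) = y (j + 1) - (1 - a) • y j := fun j => by
    have := smul_auxSeq (x₀ := x₀) (y := y) (α := α) j (by rw [hα]; exact ha0.ne')
    rwa [hα] at this
  have step := fun j => accelerated_step_strong hS hA hG ha0.le ha1 hℓ.le haμ
    (h.iterate_mem hx₀ j) hu (hw j) (h.isProx j) (hwv j) (haux j)
  have key : Φ (y (j + 1)) + S.h (y (j + 1)) - (Φ u + S.h u) +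
      μ / 2 * ‖auxSeq x₀ y α (j + 1) - u‖ ^ 2 ≤ (1 - a) ^ j * (3 / 4 * ℓ * S.D ^ 2) := by
    induction j with
    | zero =>
      have k1 := first_step_le_cocoercive hS hμ.le hℓ hG hx₀ (by
        have := h.isProx 0; rwa [h.w_zero] at this) hu
      have k2 : ‖x₀ - u‖ ^ 2 ≤ S.D ^ 2 :=
        pow_le_pow_left₀ (norm_nonneg _) (hS.norm_sub_le_D hx₀ hu) 2
      -- The auxiliary point may lie outside `C`, but `a` times its displacement from `u` is a
      -- difference of two points of `C`. As `μ = ℓ * a ^ 2`, its energy is at most `ℓ / 2 * D ^ 2`;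
      -- the gap contributes `ℓ / 4 * D ^ 2`.
      have e : a • (auxSeq x₀ y α (0 + 1) - u) = y (0 + 1) - ((1 - a) • y 0 + a • u) := by
        rw [smul_sub, haux]; module
      have k3 : ‖a • (auxSeq x₀ y α (0 + 1) - u)‖ ^ 2 ≤ S.D ^ 2 := by
        rw [e]
        exact pow_le_pow_left₀ (norm_nonneg _) (hS.norm_sub_le_D (h.y_mem 0)
          (hS.convex_C (h.iterate_mem hx₀ 0) hu (sub_nonneg.2 ha1) ha0.le (by ring))) 2
      rw [norm_smul, mul_pow, Real.norm_eq_abs, sq_abs] at k3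
      have k4 := mul_le_mul_of_nonneg_left k3 (half_pos hℓ).le
      have k5 := mul_le_mul_of_nonneg_left k2 (show 0 ≤ ℓ / 4 by positivity)
      rw [pow_zero, ← haμ]
      linarith
    | succ j ih =>
      refine (step (j + 1)).trans ?_
      rw [pow_succ' (1 - a), mul_assoc (1 - a)]
      exact mul_le_mul_of_nonneg_left ih (sub_nonneg.2 ha1)
  have : 0 ≤ μ / 2 * ‖auxSeq x₀ y α (j + 1) - u‖ ^ 2 := by positivity
  linarith

theorem sqrt_ratio_le_half (hμℓ : μ ≤ ℓ / 4) (hℓ : 0 < ℓ) : √(μ / ℓ) ≤ 1 / 2 := by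
  rw [Real.sqrt_le_left (by norm_num), div_le_iff₀ hℓ]
  linarith

theorem nesterov_reaches (hS : S.Admissible) (hμ : 0 ≤ μ) :
    (nesterov S μ).Reaches S S.nbhd μ := by
  intro Φ G ℓ x₀ hG hℓ hμℓ hx₀
  refine ⟨exists_isNesterovRun hS μ ℓ G hx₀, ?_⟩
  rintro y ⟨w, α, h⟩ ε hε
  rcases hμ.eq_or_lt with rfl | hμ
  · obtain ⟨j, hj, hjε⟩ := exists_count_convex (D := S.D) Metric.diam_nonneg hℓ hε
    refine ⟨j + 1, hj, h.y_mem j, fun u hu => ?_⟩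
    linarith [h.le_convex hS hG hx₀ hℓ hu j]
  · have hℓ : 0 < ℓ := by linarith
    have haμ : ℓ * √(μ / ℓ) ^ 2 = μ := by
      rw [Real.sq_sqrt (div_pos hμ hℓ).le]; field_simp
    have ha := sqrt_ratio_le_half hμℓ hℓ
    rcases lt_or_ge ε (ℓ / 4 * S.D ^ 2) with hlt | hge
    · obtain ⟨j, hj, hjε⟩ := exists_count_strong (Real.sqrt_pos.2 (div_pos hμ hℓ)) ha hℓ haμ hε hlt
      refine ⟨j + 1, hj, h.y_mem j, fun u hu => ?_⟩
      linarith [h.le_strong hS hG hx₀ hμ hℓ rfl (by linarith) hu j]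
    -- For `ε ≥ ℓ / 4 * D ^ 2` the cocoercive bound already makes the first iterate good enough.
    · refine ⟨1, ?_, h.y_mem 0, fun u hu => ?_⟩
      · rw [iterBound, if_neg hμ.ne']
        push_cast
        have : 0 ≤ 2 * √(ℓ / μ) * max 0 (Real.log ((ℓ + μ) * S.D ^ 2 / (2 * ε))) := by positivity
        linarith
      · have k1 := first_step_le_cocoercive hS hμ.le hℓ hG hx₀ (by
          have := h.isProx 0; rwa [h.w_zero] at this) hu
        have k2 : ‖x₀ - u‖ ^ 2 ≤ S.D ^ 2 :=
          pow_le_pow_left₀ (norm_nonneg _) (hS.norm_sub_le_D hx₀ hu) 2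
        have k5 := mul_le_mul_of_nonneg_left k2 (show 0 ≤ ℓ / 4 by positivity)
        rw [zero_add] at k1
        linarith

end Nesterov

/-! ### An accelerated method with all points in `dom h ∩ X` -/

section SafeSteps

variable {n : ℕ} {S : SimplePart n} {A : Set (E n)} {Φ : E n → ℝ} {G : E n → E n} {μ ℓ : ℝ}

/-- Here the proximal step produces `v'`, and the new iterate is an average of `y` and `v'`; hence
iterates and auxiliary points both stay in `C`, and the models are only needed there. -/
theorem dual_averaging_step (hS : S.Admissible) (hG : FirstOrderModel S.C Φ G μ ℓ)
    {y v' w c u : E n} {a : ℝ} (h0 : 0 ≤ a) (h1 : a ≤ 1) (hy : y ∈ S.C) (hu : u ∈ S.C)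
    (hw : w ∈ S.C) (hμ : 0 ≤ μ) (hwc : w = (1 - a) • y + a • c)
    (hv' : S.IsProx (G w) c (ℓ * a) v') :
    Φ ((1 - a) • y + a • v') + S.h ((1 - a) • y + a • v') + ℓ / 2 * a ^ 2 * ‖v' - u‖ ^ 2 ≤
      (1 - a) * (Φ y + S.h y) + a * (Φ u + S.h u - μ / 2 * ‖w - u‖ ^ 2) +
        ℓ / 2 * a ^ 2 * ‖c - u‖ ^ 2 := by
  have hm := hS.convex_C hy hv'.1 (sub_nonneg.2 h1) h0 (by ring)
  have k1 := hG.upper w hw _ hm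
  have k2 := hS.convexOn_h.2 hy hv'.1 (sub_nonneg.2 h1) h0 (by ring)
  have k3 := mul_le_mul_of_nonneg_left (hG.lower w hw y hy) (sub_nonneg.2 h1)
  have k4 := mul_le_mul_of_nonneg_left (hG.lower w hw u hu) h0
  have k5 := mul_le_mul_of_nonneg_left (hv'.three_point hS hu) h0
  have k6 : 0 ≤ (1 - a) * (μ / 2 * ‖y - w‖ ^ 2) :=
    mul_nonneg (sub_nonneg.2 h1) (by positivity)
  have e : (1 - a) • y + a • v' - w = a • (v' - c) := by rw [hwc]; module
  have e2 : inner ℝ (G w) ((1 - a) • y + a • v' - w) =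
      (1 - a) * inner ℝ (G w) y + a * inner ℝ (G w) v' - inner ℝ (G w) w := by
    rw [inner_sub_right, inner_add_right, real_inner_smul_right, real_inner_smul_right]
  rw [e2, e, norm_smul, mul_pow, Real.norm_eq_abs, sq_abs] at k1
  rw [inner_sub_right] at k3 k4
  simp only [smul_eq_mul] at k2
  rw [norm_sub_rev v' u, norm_sub_rev c u, norm_sub_rev w u]
  linarith

theorem norm_convex_comb_sq_le (p q : E n) {a : ℝ} (h0 : 0 ≤ a) (h1 : a ≤ 1) :
    ‖(1 - a) • p + a • q‖ ^ 2 ≤ (1 - a) * ‖p‖ ^ 2 + a * ‖q‖ ^ 2 := by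
  have h3 := mul_nonneg (mul_nonneg h0 (sub_nonneg.2 h1)) (sq_nonneg ‖p - q‖)
  rw [norm_sub_sq_real] at h3
  rw [norm_add_sq_real, norm_smul, norm_smul, mul_pow, mul_pow, real_inner_smul_left,
    real_inner_smul_right, Real.norm_eq_abs, Real.norm_eq_abs, sq_abs, sq_abs]
  linarith

/-- The proximal centre is chosen so that `w = (1 - a) • y + a • c`. Convexity splits `‖c - u‖ ^ 2`
into a part in `v`, which contracts, and a part in `w`, which the strong convexity term cancels. -/
theorem dual_averaging_step_strong (hS : S.Admissible) (hG : FirstOrderModel S.C Φ G μ ℓ)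
    {y v v' w u : E n} {a : ℝ} (h0 : 0 ≤ a) (h1 : a ≤ 1) (hμ : 0 ≤ μ) (haμ : ℓ * a ^ 2 = μ)
    (hy : y ∈ S.C) (hu : u ∈ S.C) (hw : w ∈ S.C) (hwv : (1 + a) • w = y + a • v)
    (hv' : S.IsProx (G w) ((1 - a) • v + a • w) (ℓ * a) v') :
    Φ ((1 - a) • y + a • v') + S.h ((1 - a) • y + a • v') - (Φ u + S.h u) +
        μ / 2 * ‖v' - u‖ ^ 2 ≤
      (1 - a) * (Φ y + S.h y - (Φ u + S.h u) + μ / 2 * ‖v - u‖ ^ 2) := by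
  have hwc : w = (1 - a) • y + a • ((1 - a) • v + a • w) := by
    have : y = (1 + a) • w - a • v := by rw [hwv]; abel
    rw [this]; module
  have k1 := dual_averaging_step hS hG h0 h1 hy hu hw hμ hwc hv'
  have k2 := norm_convex_comb_sq_le (v - u) (w - u) h0 h1
  rw [show (1 - a) • (v - u) + a • (w - u) = (1 - a) • v + a • w - u by module] at k2
  have k3 := mul_le_mul_of_nonneg_left k2 (show 0 ≤ μ / 2 by positivity)
  have e : ℓ / 2 * a ^ 2 = μ / 2 := by rw [← haμ]; ring
  rw [e] at k1
  linarith

end SafeSteps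

/-- A minimizer of `⟨g, ·⟩ + κ / 2 * ‖· - c‖ ^ 2 + h` over `dom h ∩ X`. -/
def SimplePart.prox {n : ℕ} (S : SimplePart n) (g c : E n) (κ : ℝ) : E n :=
  Classical.epsilon (S.IsProx g c κ)

/-- For `κ ≤ 0` minimizers need not be unique; fixing one for each argument keeps the method
deterministic. -/
theorem SimplePart.Admissible.isProx_prox {n : ℕ} {S : SimplePart n} (hS : S.Admissible)
    (hne : S.C.Nonempty) (g c : E n) (κ : ℝ) : S.IsProx g c κ (S.prox g c κ) :=
  Classical.epsilon_spec (hS.exists_isProx hne g c κ)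

/-- The averaging weights of the method. -/
def safeWeight (μ ℓ : ℝ) : ℕ → ℝ
  | 0 => 1
  | j + 1 => if μ = 0 then 2 / (j + 3) else min 1 √(μ / ℓ)

/-- The state of the method: number of steps, iterate, auxiliary point. -/
structure SafeState (n : ℕ) where
  steps : ℕ
  y : E n
  v : E n

/-- The point where the gradient is evaluated. -/
def SafeState.query {n : ℕ} (μ ℓ : ℝ) (s : SafeState n) : E n :=
  let a := safeWeight μ ℓ s.steps
  if μ = 0 then (1 - a) • s.y + a • s.v else (1 - a / (1 + a)) • s.y + (a / (1 + a)) • s.v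

/-- One step of the method with the gradient `g` received at the query point. -/
def SafeState.next {n : ℕ} (S : SimplePart n) (μ ℓ : ℝ) (s : SafeState n) (g : E n) : SafeState n :=
  let a := safeWeight μ ℓ s.steps
  let c := if μ = 0 then s.v else (1 - a) • s.v + a • s.query μ ℓ
  let v₁ := S.prox g c (ℓ * a)
  ⟨s.steps + 1, (1 - a) • s.y + a • v₁, v₁⟩

/-- The state after receiving a list of gradients. -/
def safeState {n : ℕ} (S : SimplePart n) (μ ℓ : ℝ) (x₀ : E n) (hist : List (E n)) : SafeState n :=
  hist.foldl (SafeState.next S μ ℓ) ⟨0, x₀, x₀⟩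

/-- An accelerated proximal gradient method that evaluates gradients at convex combinations of
points of `dom h ∩ X`. -/
def safeMethod {n : ℕ} (S : SimplePart n) (μ : ℝ) : FirstOrderMethod n where
  query ℓ x₀ hist := (safeState S μ ℓ x₀ hist).query μ ℓ
  output ℓ x₀ hist := (safeState S μ ℓ x₀ hist).y

/-- The cap `min 1` in the weight makes this true for every `ℓ`, so that queries stay in `C` without
any relation between `μ` and `ℓ`. -/
theorem safeWeight_mem (μ ℓ : ℝ) (j : ℕ) : 0 ≤ safeWeight μ ℓ j ∧ safeWeight μ ℓ j ≤ 1 := by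
  cases j with
  | zero => exact ⟨zero_le_one, le_rfl⟩
  | succ j =>
    rw [safeWeight]
    split_ifs
    · exact ⟨by positivity, (div_le_one (by positivity)).2
        (by linarith [Nat.cast_nonneg (α := ℝ) j])⟩
    · exact ⟨le_min zero_le_one (Real.sqrt_nonneg _), min_le_left _ _⟩

section SafeMethod

variable {n : ℕ} {S : SimplePart n} {Φ : E n → ℝ} {G : E n → E n} {μ ℓ : ℝ} {x₀ : E n}

theorem SafeState.query_mem (hS : S.Admissible) {s : SafeState n} (hy : s.y ∈ S.C) (hv : s.v ∈ S.C) :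
    s.query μ ℓ ∈ S.C := by
  obtain ⟨h0, h1⟩ := safeWeight_mem μ ℓ s.steps
  rw [SafeState.query]
  split_ifs
  · exact hS.convex_C hy hv (sub_nonneg.2 h1) h0 (by ring)
  · exact hS.convex_C hy hv (sub_nonneg.2 ((div_le_one (by positivity)).2 (by linarith)))
      (by positivity) (by ring)

theorem safeState_mem (hS : S.Admissible) (hx₀ : x₀ ∈ S.C) (hist : List (E n)) :
    (safeState S μ ℓ x₀ hist).y ∈ S.C ∧ (safeState S μ ℓ x₀ hist).v ∈ S.C := by
  induction hist using List.reverseRecOn with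
  | nil => exact ⟨hx₀, hx₀⟩
  | append_singleton l g ih =>
    obtain ⟨h0, h1⟩ := safeWeight_mem μ ℓ (safeState S μ ℓ x₀ l).steps
    rw [safeState, List.foldl_append]
    have hv := fun c κ => (hS.isProx_prox ⟨x₀, hx₀⟩ g c κ).1
    exact ⟨hS.convex_C ih.1 (hv _ _) (sub_nonneg.2 h1) h0 (by ring), hv _ _⟩

theorem safeMethod_query_mem (hS : S.Admissible) (hx₀ : x₀ ∈ S.C) (hist : List (E n)) :
    (safeMethod S μ).query ℓ x₀ hist ∈ S.C :=
  SafeState.query_mem hS (safeState_mem hS hx₀ hist).1 (safeState_mem hS hx₀ hist).2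

/-- The states of the method on a given gradient map. -/
def safeRun (S : SimplePart n) (μ ℓ : ℝ) (G : E n → E n) (x₀ : E n) (j : ℕ) : SafeState n :=
  safeState S μ ℓ x₀ ((safeMethod S μ).history G ℓ x₀ j)

theorem safeRun_succ (j : ℕ) : safeRun S μ ℓ G x₀ (j + 1) =
    (safeRun S μ ℓ G x₀ j).next S μ ℓ (G ((safeRun S μ ℓ G x₀ j).query μ ℓ)) := by
  rw [safeRun, FirstOrderMethod.history, safeState, List.foldl_append]
  rfl

theorem safeRun_steps (j : ℕ) : (safeRun S μ ℓ G x₀ j).steps = j := by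
  induction j with
  | zero => rfl
  | succ j ih => rw [safeRun_succ, SafeState.next, ih]

theorem safeRun_le_convex (hS : S.Admissible) (hG : FirstOrderModel S.C Φ G 0 ℓ) (hx₀ : x₀ ∈ S.C)
    (hℓ : 0 ≤ ℓ) {u : E n} (hu : u ∈ S.C) (j : ℕ) :
    Φ (safeRun S 0 ℓ G x₀ (j + 1)).y + S.h (safeRun S 0 ℓ G x₀ (j + 1)).y - (Φ u + S.h u) ≤
      ℓ / 2 * (2 / (j + 2)) ^ 2 * S.D ^ 2 := by
  have ha : ∀ j : ℕ, safeWeight 0 ℓ j = 2 / (j + 2) := fun j => by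
    cases j with
    | zero => simp [safeWeight]
    | succ j => rw [safeWeight, if_pos rfl]; push_cast; congr 1; ring
  have hm : ∀ j, (safeRun S 0 ℓ G x₀ j).y ∈ S.C ∧ (safeRun S 0 ℓ G x₀ j).v ∈ S.C :=
    fun j => safeState_mem hS hx₀ _
  have step : ∀ j : ℕ, _ := fun j => by
    have h := safeWeight_mem 0 ℓ j
    rw [ha] at h
    have hq : (safeRun S 0 ℓ G x₀ j).query 0 ℓ = (1 - 2 / (j + 2 : ℝ)) • (safeRun S 0 ℓ G x₀ j).y +
        (2 / (j + 2 : ℝ)) • (safeRun S 0 ℓ G x₀ j).v := by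
      rw [SafeState.query, if_pos rfl, safeRun_steps, ha]
    exact dual_averaging_step hS hG h.1 h.2 (hm j).1 hu
      (SafeState.query_mem (μ := 0) (ℓ := ℓ) hS (hm j).1 (hm j).2) le_rfl hq
      (hS.isProx_prox ⟨x₀, hx₀⟩ _ _ _)
  have hsucc : ∀ j, (safeRun S 0 ℓ G x₀ (j + 1)).y = (1 - 2 / (j + 2 : ℝ)) •
      (safeRun S 0 ℓ G x₀ j).y + (2 / (j + 2 : ℝ)) • (safeRun S 0 ℓ G x₀ (j + 1)).v ∧
      (safeRun S 0 ℓ G x₀ (j + 1)).v = S.prox (G ((safeRun S 0 ℓ G x₀ j).query 0 ℓ))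
        (safeRun S 0 ℓ G x₀ j).v (ℓ * (2 / (j + 2 : ℝ))) := fun j => by
    rw [safeRun_succ, SafeState.next, safeRun_steps, ha]
    simp
  have hD : ∀ j, ‖(safeRun S 0 ℓ G x₀ j).v - u‖ ^ 2 ≤ S.D ^ 2 := fun j =>
    pow_le_pow_left₀ (norm_nonneg _) (hS.norm_sub_le_D (hm j).2 hu) 2
  have key : ∀ j : ℕ, Φ (safeRun S 0 ℓ G x₀ (j + 1)).y + S.h (safeRun S 0 ℓ G x₀ (j + 1)).y -
      (Φ u + S.h u) + ℓ / 2 * (2 / (j + 2 : ℝ)) ^ 2 * ‖(safeRun S 0 ℓ G x₀ (j + 1)).v - u‖ ^ 2 ≤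
      ℓ / 2 * (2 / (j + 2 : ℝ)) ^ 2 * S.D ^ 2 := fun j => by
    have k1 := step j
    rw [← (hsucc j).2, ← (hsucc j).1] at k1
    induction j with
    | zero =>
      have k2 := mul_le_mul_of_nonneg_left (hD 0) (half_pos (zero_lt_one (α := ℝ))).le
      have k3 := mul_le_mul_of_nonneg_left (hD 0) (div_nonneg hℓ zero_le_two)
      norm_num at k1 ⊢
      linarith
    | succ j ih =>
      have k2 := step j
      rw [← (hsucc j).2, ← (hsucc j).1] at k2
      have k3 := ih k2
      have hj : (0 : ℝ) ≤ j := Nat.cast_nonneg j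
      have e1 : (0 : ℝ) ≤ 1 - 2 / (((j + 1 : ℕ) : ℝ) + 2) := by
        push_cast
        rw [sub_nonneg, div_le_one (by positivity)]
        linarith
      have k4 := mul_le_mul_of_nonneg_left k3 e1
      -- The weights `2 / (j + 2)` satisfy the recursion of Nesterov's `α` only as an inequality;
      -- the excess is absorbed by `‖v - u‖ ≤ D`, valid because `v` lies in `C`.
      have e2 : 0 ≤ (2 / (((j + 1 : ℕ) : ℝ) + 2)) ^ 2 -
          (1 - 2 / (((j + 1 : ℕ) : ℝ) + 2)) * (2 / ((j : ℝ) + 2)) ^ 2 := by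
        push_cast
        have : (2 / ((j : ℝ) + 1 + 2)) ^ 2 - (1 - 2 / ((j : ℝ) + 1 + 2)) * (2 / ((j : ℝ) + 2)) ^ 2 =
            4 / (((j : ℝ) + 1 + 2) ^ 2 * ((j : ℝ) + 2) ^ 2) := by
          field_simp; ring
        rw [this]; positivity
      have k5 := mul_le_mul_of_nonneg_left (hD (j + 1)) (mul_nonneg (div_nonneg hℓ zero_le_two) e2)
      linarith
  have : 0 ≤ ℓ / 2 * (2 / (j + 2 : ℝ)) ^ 2 * ‖(safeRun S 0 ℓ G x₀ (j + 1)).v - u‖ ^ 2 := by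
    positivity
  linarith [key j]

/-- The weight `1` makes the first step a plain proximal gradient step with `y = v`, which starts
the energy at no more than `ℓ / 2 * D ^ 2`. -/
theorem safeRun_first (hμ : μ ≠ 0) : (safeRun S μ ℓ G x₀ 1).y = S.prox (G x₀) x₀ ℓ ∧
    (safeRun S μ ℓ G x₀ 1).v = S.prox (G x₀) x₀ ℓ := by
  have hq : (safeRun S μ ℓ G x₀ 0).query μ ℓ = x₀ := by
    rw [SafeState.query, if_neg hμ, show (safeRun S μ ℓ G x₀ 0).y = x₀ from rfl,
      show (safeRun S μ ℓ G x₀ 0).v = x₀ from rfl]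
    module
  rw [safeRun_succ, SafeState.next, hq, if_neg hμ, safeRun_steps, safeWeight]
  simp

theorem safeRun_le_strong (hS : S.Admissible) (hG : FirstOrderModel S.C Φ G μ ℓ) (hx₀ : x₀ ∈ S.C)
    (hμ : 0 < μ) (hℓ : 0 < ℓ) {a : ℝ} (ha : a = √(μ / ℓ)) (ha1 : a ≤ 1) {u : E n} (hu : u ∈ S.C)
    (j : ℕ) :
    Φ (safeRun S μ ℓ G x₀ (j + 1)).y + S.h (safeRun S μ ℓ G x₀ (j + 1)).y - (Φ u + S.h u) ≤
      (1 - a) ^ j * (ℓ / 2 * S.D ^ 2) := by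
  have ha0 : 0 < a := ha ▸ Real.sqrt_pos.2 (div_pos hμ hℓ)
  have haμ : ℓ * a ^ 2 = μ := by rw [ha, Real.sq_sqrt (div_pos hμ hℓ).le]; field_simp
  have haw : ∀ j, safeWeight μ ℓ (j + 1) = a := fun j => by
    rw [safeWeight, if_neg hμ.ne', ← ha, min_eq_right ha1]
  have hm : ∀ j, (safeRun S μ ℓ G x₀ j).y ∈ S.C ∧ (safeRun S μ ℓ G x₀ j).v ∈ S.C :=
    fun j => safeState_mem hS hx₀ _
  have key : Φ (safeRun S μ ℓ G x₀ (j + 1)).y + S.h (safeRun S μ ℓ G x₀ (j + 1)).y - (Φ u + S.h u) +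
      μ / 2 * ‖(safeRun S μ ℓ G x₀ (j + 1)).v - u‖ ^ 2 ≤ (1 - a) ^ j * (ℓ / 2 * S.D ^ 2) := by
    induction j with
    | zero =>
      obtain ⟨e1, e2⟩ := safeRun_first (S := S) (ℓ := ℓ) (G := G) (x₀ := x₀) hμ.ne'
      have k1 := prox_step hS subset_rfl hG hx₀ (hS.isProx_prox ⟨x₀, hx₀⟩ (G x₀) x₀ ℓ) hu
      have k2 : ‖x₀ - u‖ ^ 2 ≤ S.D ^ 2 :=
        pow_le_pow_left₀ (norm_nonneg _) (hS.norm_sub_le_D hx₀ hu) 2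
      have hμℓ : 0 ≤ ℓ - μ := by
        rw [← haμ, ← mul_one_sub]
        exact mul_nonneg hℓ.le (sub_nonneg.2 (pow_le_one₀ ha0.le ha1))
      have k3 := mul_le_mul_of_nonneg_left k2 (div_nonneg hμℓ zero_le_two)
      have k4 := mul_nonneg (div_nonneg hμℓ zero_le_two)
        (sq_nonneg ‖S.prox (G x₀) x₀ ℓ - u‖)
      have k5 := mul_nonneg hμ.le (sq_nonneg S.D)
      rw [zero_add, e1, e2, pow_zero]
      linarith
    | succ j ih =>
      set s := safeRun S μ ℓ G x₀ (j + 1) with hs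
      have hw : (1 + a) • s.query μ ℓ = s.y + a • s.v := by
        rw [SafeState.query, if_neg hμ.ne', hs, safeRun_steps, haw, smul_add, smul_smul, smul_smul,
          mul_div_cancel₀ _ (by positivity), mul_sub, mul_div_cancel₀ _ (by positivity)]
        module
      have k1 := dual_averaging_step_strong hS hG ha0.le ha1 hμ.le haμ (hm (j + 1)).1 hu
        (SafeState.query_mem hS (hm (j + 1)).1 (hm (j + 1)).2) hw
        (hS.isProx_prox ⟨x₀, hx₀⟩ _ _ _)
      have k2 : (safeRun S μ ℓ G x₀ (j + 1 + 1)).v = S.prox (G (s.query μ ℓ))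
          ((1 - a) • s.v + a • s.query μ ℓ) (ℓ * a) ∧ (safeRun S μ ℓ G x₀ (j + 1 + 1)).y =
          (1 - a) • s.y + a • S.prox (G (s.query μ ℓ))
            ((1 - a) • s.v + a • s.query μ ℓ) (ℓ * a) := by
        rw [safeRun_succ, ← hs, SafeState.next, hs, safeRun_steps, haw, if_neg hμ.ne']
        exact ⟨rfl, rfl⟩
      rw [k2.1, k2.2]
      refine k1.trans ?_
      rw [pow_succ' (1 - a), mul_assoc (1 - a)]
      exact mul_le_mul_of_nonneg_left ih (sub_nonneg.2 ha1)
  have : 0 ≤ μ / 2 * ‖(safeRun S μ ℓ G x₀ (j + 1)).v - u‖ ^ 2 := by positivity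
  linarith

/-- Cocoercivity is not available on `C` alone. If `y` is at least `0.23 * D` from `u`, the term `ℓ
/ 2 * ‖y - u‖ ^ 2` in `prox_step` saves the fraction `0.23² = 0.0529`; otherwise the Lipschitz bound
gives the fraction `4 * 0.23 = 0.92`. Both are below `(1 + a ^ 2) * (1 - a / 2)` on `[0, 1 / 2]`,
whose minimum is about `0.926`. -/
theorem safeRun_first_le (hS : S.Admissible) (hG : FirstOrderModel S.C Φ G μ ℓ) (hx₀ : x₀ ∈ S.C)
    (hμ : 0 < μ) (hℓ : 0 < ℓ) {a : ℝ} (ha0 : 0 ≤ a) (ha1 : a ≤ 1 / 2) (haμ : ℓ * a ^ 2 = μ)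
    {u : E n} (hu : u ∈ S.C) :
    Φ (safeRun S μ ℓ G x₀ 1).y + S.h (safeRun S μ ℓ G x₀ 1).y - (Φ u + S.h u) ≤
      ℓ / 2 * S.D ^ 2 * ((1 + a ^ 2) * (1 - a / 2)) := by
  have hy := hS.isProx_prox ⟨x₀, hx₀⟩ (G x₀) x₀ ℓ
  rw [(safeRun_first hμ.ne').1]
  set y := S.prox (G x₀) x₀ ℓ
  have hD0 : 0 ≤ S.D := Metric.diam_nonneg
  have hD : 0 ≤ ℓ / 2 * S.D ^ 2 := by positivity
  rcases le_total (23 / 100 * S.D) ‖y - u‖ with h | h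
  · have k1 := prox_step hS subset_rfl hG hx₀ hy hu
    have k2 : ‖x₀ - u‖ ^ 2 ≤ S.D ^ 2 :=
      pow_le_pow_left₀ (norm_nonneg _) (hS.norm_sub_le_D hx₀ hu) 2
    have hμℓ : 0 ≤ ℓ - μ := by
      rw [← haμ, ← mul_one_sub]
      exact mul_nonneg hℓ.le (sub_nonneg.2 (pow_le_one₀ ha0 (by linarith)))
    have k3 := mul_le_mul_of_nonneg_left k2 (div_nonneg hμℓ zero_le_two)
    have k4 := mul_le_mul_of_nonneg_left (pow_le_pow_left₀ (by positivity) h 2) (half_pos hℓ).le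
    have k5 : 1 - a ^ 2 - 529 / 10000 ≤ (1 + a ^ 2) * (1 - a / 2) := by
      nlinarith [sq_nonneg (a - 1 / 7), mul_nonneg (sq_nonneg a) (sub_nonneg.2 ha1)]
    have k6 := mul_le_mul_of_nonneg_left k5 hD
    rw [← haμ] at k1 k3
    linarith
  · have k1 := first_step_le_lipschitz hS subset_rfl hμ.le hℓ.le hG hx₀ hy hu
    have k2 := mul_le_mul_of_nonneg_left h (show 0 ≤ 2 * ℓ * S.D by positivity)
    have k5 : 92 / 100 ≤ (1 + a ^ 2) * (1 - a / 2) := by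
      nlinarith [sq_nonneg (a - 1 / 3), mul_nonneg (sq_nonneg (a - 1 / 3)) (sub_nonneg.2 ha1)]
    have k6 := mul_le_mul_of_nonneg_left k5 hD
    linarith

theorem safeMethod_reaches (hS : S.Admissible) (hμ : 0 ≤ μ) :
    (safeMethod S μ).solver.Reaches S S.C μ := by
  intro Φ G ℓ x₀ hG hℓ hμℓ hx₀
  refine ⟨⟨_, fun j => rfl⟩, ?_⟩
  intro y h ε hε
  have hy : ∀ j, y j = (safeRun S μ ℓ G x₀ j).y := h
  have hm : ∀ j, y j ∈ S.C := fun j => by rw [hy]; exact (safeState_mem hS hx₀ _).1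
  rcases hμ.eq_or_lt with rfl | hμ
  · obtain ⟨j, hj, hjε⟩ := exists_count_convex (D := S.D) Metric.diam_nonneg hℓ hε
    refine ⟨j + 1, hj, hm _, fun u hu => ?_⟩
    rw [hy]
    linarith [safeRun_le_convex hS hG hx₀ hℓ hu j]
  · have hℓ : 0 < ℓ := by linarith
    have haμ : ℓ * √(μ / ℓ) ^ 2 = μ := by
      rw [Real.sq_sqrt (div_pos hμ hℓ).le]; field_simp
    have ha := sqrt_ratio_le_half hμℓ hℓ
    obtain ⟨j, hj, hjε⟩ := exists_count_strong_one (D := S.D)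
      (Real.sqrt_pos.2 (div_pos hμ hℓ)) ha hℓ haμ hε
    refine ⟨j + 1, hj, hm _, fun u hu => ?_⟩
    rw [hy]
    rcases hjε with ⟨rfl, hjε⟩ | hjε
    · have := safeRun_first_le hS hG hx₀ hμ hℓ (Real.sqrt_nonneg _) ha haμ hu
      rw [zero_add]
      linarith
    · linarith [safeRun_le_strong hS hG hx₀ hμ hℓ rfl (by linarith) hu j]

end SafeMethod

/-! ### Summation of the iteration counts -/

namespace Params

variable {p : Params} {ε μ Ls H D : ℝ} {ℓ : ℕ → ℝ}

theorem Valid.one_lt_sqrt (hp : p.Valid) : 1 < √p.σ :=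
  Real.lt_sqrt zero_le_one |>.2 (by rw [one_pow]; exact hp.one_lt_σ)

theorem Valid.sum_sqrt_β_le (hp : p.Valid) (hε : 0 < ε) :
    ∑ k ∈ Finset.range p.K, √(p.β ε k) ≤ √(p.Cβ * (p.σ - 1) / ε) / (√p.σ - 1) := by
  have h1 := hp.one_lt_sqrt
  have hg := hp.βg_pos hε
  have hσ : 0 ≤ p.σ := zero_le_one.trans hp.one_lt_σ.le
  have e : ∀ k, √(p.β ε k) = √(p.βg ε) * √p.σ ^ k := fun k => by
    rw [β, Real.sqrt_mul hg.le, ← Real.sqrt_sq (show 0 ≤ √p.σ ^ k by positivity), ← pow_mul,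
      mul_comm k, pow_mul, Real.sq_sqrt hσ]
  rw [Finset.sum_congr rfl fun k _ => e k, ← Finset.mul_sum, geom_sum_eq h1.ne', ← mul_div_assoc]
  refine div_le_div_of_nonneg_right ?_ (sub_pos.2 h1).le
  refine Real.le_sqrt_of_sq_le ?_
  have h2 : (√p.σ ^ p.K) ^ 2 = p.σ ^ p.K := by rw [← pow_mul, mul_comm, pow_mul, Real.sq_sqrt hσ]
  -- This makes the square of the geometric sum comparable with `βg * (σ ^ K - 1)`, which the choice
  -- of `βg` evaluates.
  have h3 : (√p.σ ^ p.K - 1) ^ 2 ≤ p.σ ^ p.K - 1 := by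
    have := one_le_pow₀ h1.le (n := p.K)
    nlinarith
  rw [mul_pow, Real.sq_sqrt hg.le]
  refine (mul_le_mul_of_nonneg_left h3 hg.le).trans_eq ?_
  rw [hp.βg_mul]
  ring

theorem sqrt_le_of_le_add_mul {l b : ℝ} (hLs : 0 ≤ Ls) (hH : 0 ≤ H) (hb : 0 ≤ b)
    (h : l ≤ Ls + b * H) : √l ≤ √Ls + √H * √b := by
  rw [← Real.sqrt_mul hH, mul_comm H]
  refine (Real.sqrt_le_sqrt h).trans ?_
  have h1 := Real.sq_sqrt hLs
  have h2 := Real.sq_sqrt (mul_nonneg hb hH)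
  have h3 := mul_nonneg (Real.sqrt_nonneg Ls) (Real.sqrt_nonneg (b * H))
  exact Real.sqrt_le_iff.2 ⟨by positivity, by linarith⟩

theorem Valid.sum_iterBound_convex_constant (hp : p.Valid) (hε : 0 < ε) (hLs : 0 ≤ Ls) (hH : 0 ≤ H)
    (hD : 0 ≤ D) (hℓ : ∀ k < p.K, ℓ k ≤ Ls + p.β ε k * H) :
    ∑ k ∈ Finset.range p.K, iterBound 0 D (ℓ k) (p.tol ε 0 .constant k) ≤
      p.boundConvex ε Ls H D .constant := by
  have h1 := hp.Cβ_pos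
  have h2 := hp.Cε_pos
  have hs1 := sub_pos.2 hp.one_lt_sqrt
  have hσ1 := sub_pos.2 hp.one_lt_σ
  have key : ∀ k ∈ Finset.range p.K, iterBound 0 D (ℓ k) (p.tol ε 0 .constant k) ≤
      2 * D * √(p.Cβ / p.Cε) * (√(Ls / ε) + √(H / ε) * √(p.β ε k)) + 1 := fun k hk => by
    rw [iterBound, if_pos rfl, tol]
    have e : 2 * ℓ k / (ε / 2 * (p.Cε / p.Cβ)) = 2 ^ 2 * ((p.Cβ / p.Cε) * (ℓ k / ε)) := by
      field_simp
    have k1 : √(ℓ k / ε) ≤ √(Ls / ε) + √(H / ε) * √(p.β ε k) :=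
      sqrt_le_of_le_add_mul (by positivity) (by positivity) (hp.β_pos hε k).le (by
        rw [mul_div_assoc', ← add_div]
        exact div_le_div_of_nonneg_right (hℓ k (Finset.mem_range.1 hk)) hε.le)
    rw [e, Real.sqrt_mul (by norm_num), Real.sqrt_sq (by norm_num), Real.sqrt_mul (by positivity)]
    have k2 := mul_le_mul_of_nonneg_left k1 (show 0 ≤ 2 * D * √(p.Cβ / p.Cε) by positivity)
    linarith
  refine (Finset.sum_le_sum key).trans ?_
  rw [Finset.sum_add_distrib, ← Finset.mul_sum, Finset.sum_add_distrib, ← Finset.mul_sum]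
  simp only [Finset.sum_const, Finset.card_range, nsmul_eq_mul, mul_one, boundConvex]
  have k3 : √(H / ε) * ∑ k ∈ Finset.range p.K, √(p.β ε k) ≤
      √(p.Cβ * H * (p.σ - 1)) / (ε * (√p.σ - 1)) := by
    refine (mul_le_mul_of_nonneg_left (hp.sum_sqrt_β_le hε) (Real.sqrt_nonneg _)).trans_eq ?_
    rw [← mul_div_assoc, ← Real.sqrt_mul (by positivity),
      show H / ε * (p.Cβ * (p.σ - 1) / ε) = p.Cβ * H * (p.σ - 1) / ε ^ 2 by field_simp,
      Real.sqrt_div' _ (by positivity), Real.sqrt_sq hε.le, div_div]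
  have k4 := mul_le_mul_of_nonneg_left k3 (show 0 ≤ 2 * D * √(p.Cβ / p.Cε) by positivity)
  linarith

theorem Valid.sum_rpow_β (hp : p.Valid) (hε : 0 < ε) {s : ℝ} (hs : 0 < s) :
    ∑ k ∈ Finset.range p.K, p.β ε k ^ s =
      p.βg ε ^ s * (((p.σ ^ s) ^ p.K - 1) / (p.σ ^ s - 1)) := by
  have hσ : 0 ≤ p.σ := zero_le_one.trans hp.one_lt_σ.le
  have e : ∀ k, p.β ε k ^ s = p.βg ε ^ s * (p.σ ^ s) ^ k := fun k => by
    rw [β, Real.mul_rpow (hp.βg_pos hε).le (by positivity), ← Real.rpow_natCast_mul hσ,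
      mul_comm (k : ℝ), Real.rpow_mul_natCast hσ]
  rw [Finset.sum_congr rfl fun k _ => e k, ← Finset.mul_sum,
    geom_sum_eq (Real.one_lt_rpow hp.one_lt_σ hs).ne']

/-- With sixth roots `τ`, `b` of `σ`, `βg` and `X = τ ^ K`, all sums are rational in `τ`, `b`, `X`.
After squaring, the claims reduce to `(X⁴ - 1)(X - 1)² ≤ X⁶ - 1` and `(X⁴ - 1)³ ≤ (X⁶ - 1)²`, while
`b⁶ (X⁶ - 1)` is known. -/
theorem Valid.adaptive_sums (hp : p.Valid) (hε : 0 < ε) :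
    √(∑ t ∈ Finset.range p.K, p.β ε t ^ (2 / 3 : ℝ)) * ∑ t ∈ Finset.range p.K, p.β ε t ^ (1 / 6 : ℝ)
      ≤ √(p.Cβ / ε) * ((p.σ - 1) ^ (1 / 2 : ℝ) /
          ((p.σ ^ (1 / 6 : ℝ) - 1) * (p.σ ^ (2 / 3 : ℝ) - 1) ^ (1 / 2 : ℝ))) ∧
    √(∑ t ∈ Finset.range p.K, p.β ε t ^ (2 / 3 : ℝ)) * ∑ t ∈ Finset.range p.K, p.β ε t ^ (2 / 3 : ℝ)
      ≤ p.Cβ / ε * ((p.σ - 1) / (p.σ ^ (2 / 3 : ℝ) - 1) ^ (3 / 2 : ℝ)) := by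
  have hC := hp.Cβ_pos
  have hσ : 0 < p.σ := zero_lt_one.trans hp.one_lt_σ
  have hg := hp.βg_pos hε
  have hτ : 1 < p.σ ^ (1 / 6 : ℝ) := Real.one_lt_rpow hp.one_lt_σ (by norm_num)
  have e4 : ∀ x : ℝ, 0 < x → x ^ (2 / 3 : ℝ) = (x ^ (1 / 6 : ℝ)) ^ 4 := fun x hx => by
    rw [← Real.rpow_mul_natCast hx.le]; norm_num
  have e6 : ∀ x : ℝ, 0 < x → (x ^ (1 / 6 : ℝ)) ^ 6 = x := fun x hx => by
    rw [← Real.rpow_mul_natCast hx.le]; norm_num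
  have eh : ∀ x : ℝ, 0 ≤ x → (x ^ (1 / 2 : ℝ)) ^ 2 = x := fun x hx => by
    rw [← Real.rpow_mul_natCast hx]; norm_num
  have e3 : ∀ x : ℝ, 0 ≤ x → (x ^ (3 / 2 : ℝ)) ^ 2 = x ^ 3 := fun x hx => by
    rw [← Real.rpow_mul_natCast hx, ← Real.rpow_natCast]; norm_num
  have hmul := hp.βg_mul (ε := ε)
  rw [hp.sum_rpow_β hε (by norm_num), hp.sum_rpow_β hε (by norm_num), e4 _ hg, e4 _ hσ]
  rw [← e6 _ hg] at hmul
  have hσ6 := e6 _ hσ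
  set τ := p.σ ^ (1 / 6 : ℝ)
  set b := p.βg ε ^ (1 / 6 : ℝ)
  have hb : 0 < b := Real.rpow_pos_of_pos hg _
  have hX6 : p.σ ^ p.K = (τ ^ p.K) ^ 6 := by rw [← hσ6, ← pow_mul, ← pow_mul, mul_comm]
  have hX4 : (τ ^ 4) ^ p.K = (τ ^ p.K) ^ 4 := by rw [← pow_mul, ← pow_mul, mul_comm]
  rw [hX6] at hmul
  rw [hX4]
  have hX : 1 ≤ τ ^ p.K := one_le_pow₀ hτ.le
  set X := τ ^ p.K
  have hτ4 : 0 < τ ^ 4 - 1 := sub_pos.2 (one_lt_pow₀ hτ (by norm_num))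
  have hX4 : 0 ≤ X ^ 4 - 1 := sub_nonneg.2 (one_le_pow₀ hX)
  have hτ1 : 0 < τ - 1 := sub_pos.2 hτ
  have hX1 : 0 ≤ X - 1 := sub_nonneg.2 hX
  have hσ1 : 0 < p.σ - 1 := sub_pos.2 hp.one_lt_σ
  have hS0 : 0 ≤ b ^ 4 * ((X ^ 4 - 1) / (τ ^ 4 - 1)) := by positivity
  constructor
  · refine le_of_sq_le_sq ?_ (by positivity)
    rw [mul_pow (√_), mul_pow (√_), Real.sq_sqrt hS0, Real.sq_sqrt (by positivity), div_pow,
      mul_pow (τ - 1),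
      eh _ hσ1.le, eh _ hτ4.le]
    have k1 : (X ^ 4 - 1) * (X - 1) ^ 2 ≤ X ^ 6 - 1 := by
      nlinarith [mul_nonneg hX1 (pow_nonneg (zero_le_one.trans hX) 4), mul_nonneg hX1 (zero_le_one.trans hX)]
    have l1 : b ^ 4 * ((X ^ 4 - 1) / (τ ^ 4 - 1)) * (b * ((X - 1) / (τ - 1))) ^ 2 =
        b ^ 6 * ((X ^ 4 - 1) * (X - 1) ^ 2) / ((τ - 1) ^ 2 * (τ ^ 4 - 1)) := by
      field_simp
    rw [l1, ← mul_div_assoc]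
    refine div_le_div_of_nonneg_right ?_ (by positivity)
    exact (mul_le_mul_of_nonneg_left k1 (by positivity)).trans_eq hmul
  · refine le_of_sq_le_sq ?_ (by positivity)
    rw [mul_pow (√_), Real.sq_sqrt hS0, mul_pow (p.Cβ / ε), div_pow (p.σ - 1), e3 _ hτ4.le]
    have k1 : (X ^ 4 - 1) ^ 3 ≤ (X ^ 6 - 1) ^ 2 := by
      have : (X ^ 6 - 1) ^ 2 - (X ^ 4 - 1) ^ 3 =
        (X ^ 2 - 1) ^ 2 * (3 * (X ^ 2) ^ 2 + 4 * X ^ 2 + 2) := by ring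
      have h2 : 0 ≤ (X ^ 2 - 1) ^ 2 * (3 * (X ^ 2) ^ 2 + 4 * X ^ 2 + 2) := by positivity
      linarith
    have l1 : b ^ 4 * ((X ^ 4 - 1) / (τ ^ 4 - 1)) * (b ^ 4 * ((X ^ 4 - 1) / (τ ^ 4 - 1))) ^ 2 =
        (b ^ 6) ^ 2 * (X ^ 4 - 1) ^ 3 / (τ ^ 4 - 1) ^ 3 := by
      field_simp
    rw [l1, ← mul_div_assoc, ← mul_pow, ← hmul, mul_pow]
    refine div_le_div_of_nonneg_right ?_ (by positivity)
    exact mul_le_mul_of_nonneg_left k1 (by positivity)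

theorem Valid.sum_iterBound_convex_adaptive (hp : p.Valid) (hε : 0 < ε) (hLs : 0 ≤ Ls) (hH : 0 ≤ H)
    (hD : 0 ≤ D) (hℓ : ∀ k < p.K, ℓ k ≤ Ls + p.β ε k * H) :
    ∑ k ∈ Finset.range p.K, iterBound 0 D (ℓ k) (p.tol ε 0 .adaptive k) ≤
      p.boundConvex ε Ls H D .adaptive := by
  have h1 := hp.Cβ_pos
  have h2 := hp.Cε_pos
  have hβ := hp.β_pos hε
  obtain ⟨hA, hB⟩ := hp.adaptive_sums hε
  have hS0 : 0 < ∑ t ∈ Finset.range p.K, p.β ε t ^ (2 / 3 : ℝ) :=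
    Finset.sum_pos (fun t _ => Real.rpow_pos_of_pos (hβ t) _) hp.range_nonempty
  have key : ∀ k ∈ Finset.range p.K, iterBound 0 D (ℓ k) (p.tol ε 0 .adaptive k) ≤
      2 * D / √p.Cε * √(∑ t ∈ Finset.range p.K, p.β ε t ^ (2 / 3 : ℝ)) *
        (√Ls * p.β ε k ^ (1 / 6 : ℝ) + √H * p.β ε k ^ (2 / 3 : ℝ)) + 1 := fun k hk => by
    rw [iterBound, if_pos rfl, tol, if_pos rfl]
    set s := ∑ t ∈ Finset.range p.K, p.β ε t ^ (2 / 3 : ℝ)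
    have b3 : p.β ε k ^ (1 / 3 : ℝ) = (p.β ε k ^ (1 / 6 : ℝ)) ^ 2 := by
      rw [← Real.rpow_mul_natCast (hβ k).le]; norm_num
    have b2 : p.β ε k ^ (2 / 3 : ℝ) = p.β ε k ^ (1 / 6 : ℝ) * √(p.β ε k) := by
      rw [Real.sqrt_eq_rpow, ← Real.rpow_add (hβ k)]; norm_num
    have hb6 := Real.rpow_pos_of_pos (hβ k) (1 / 6)
    -- The root of `β ^ (1 / 3)` contributes `β ^ (1 / 6)`; the part `√(β * H)` of `√ℓ` raises the
    -- exponent to `2 / 3`. Hence the two sums in `adaptive_sums`.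
    have e : 2 * ℓ k / (p.Cε / 2 * (1 / (p.β ε k ^ (1 / 3 : ℝ) * s))) =
        (2 * p.β ε k ^ (1 / 6 : ℝ)) ^ 2 * (s * ℓ k) / p.Cε := by
      rw [b3]; field_simp
    have k1 := sqrt_le_of_le_add_mul hLs hH (hβ k).le (hℓ k (Finset.mem_range.1 hk))
    have k2 := mul_le_mul_of_nonneg_left k1
      (show 0 ≤ 2 * D / √p.Cε * √s * p.β ε k ^ (1 / 6 : ℝ) by positivity)
    rw [e, Real.sqrt_div' _ h2.le, Real.sqrt_mul (by positivity), Real.sqrt_sq (by positivity),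
      Real.sqrt_mul hS0.le, b2]
    refine add_le_add_left ((le_of_eq ?_).trans (k2.trans_eq ?_)) 1 <;> ring
  refine (Finset.sum_le_sum key).trans ?_
  rw [Finset.sum_add_distrib, ← Finset.mul_sum, Finset.sum_add_distrib, ← Finset.mul_sum,
    ← Finset.mul_sum]
  simp only [Finset.sum_const, Finset.card_range, nsmul_eq_mul, mul_one, boundConvex]
  generalize (p.σ - 1) ^ (1 / 2 : ℝ) /
    ((p.σ ^ (1 / 6 : ℝ) - 1) * (p.σ ^ (2 / 3 : ℝ) - 1) ^ (1 / 2 : ℝ)) = q₁ at hA ⊢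
  generalize (p.σ ^ (2 / 3 : ℝ) - 1) ^ (3 / 2 : ℝ) = q₂ at hB ⊢
  have k1 := mul_le_mul_of_nonneg_left hA (show 0 ≤ 2 * D / √p.Cε * √Ls by positivity)
  have k2 := mul_le_mul_of_nonneg_left hB (show 0 ≤ 2 * D / √p.Cε * √H by positivity)
  refine add_le_add_left ?_ _
  have e1 : √(p.Cβ / p.Cε) * √(Ls / ε) = 1 / √p.Cε * √Ls * √(p.Cβ / ε) := by
    rw [Real.sqrt_div' _ h2.le, Real.sqrt_div' _ hε.le, Real.sqrt_div' _ hε.le]; ring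
  have e2 : √(p.Cβ / p.Cε) * √(H * p.Cβ) = 1 / √p.Cε * √H * p.Cβ := by
    rw [Real.sqrt_div' _ h2.le, Real.sqrt_mul hH]
    nth_rw 3 [← Real.mul_self_sqrt h1.le]
    ring
  have e3 : ∀ a b : ℝ, 2 * D * √(p.Cβ / p.Cε) * (√(Ls / ε) * a +
      √(H * p.Cβ) * (p.σ - 1) / (ε * b)) =
      2 * D * (√(p.Cβ / p.Cε) * √(Ls / ε)) * a +
      2 * D * (√(p.Cβ / p.Cε) * √(H * p.Cβ)) * ((p.σ - 1) / (ε * b)) := fun a b => by ring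
  rw [e3, e1, e2]
  have e4 : ∀ b : ℝ, 2 * D / √p.Cε * √H * (p.Cβ / ε * ((p.σ - 1) / b)) =
      2 * D * (1 / √p.Cε * √H * p.Cβ) * ((p.σ - 1) / (ε * b)) := fun b => by
    rw [div_mul_div_comm, ← mul_div_assoc, ← mul_div_assoc]; ring
  rw [e4] at k2
  refine (le_of_eq ?_).trans ((add_le_add k1 k2).trans_eq ?_) <;> ring

theorem Valid.log_le_Gε (hp : p.Valid) (hε : 0 < ε) (hμ : 0 < μ) (hH : 0 ≤ H)
    (hD : 0 < D) (r : Rule) {l : ℝ} {k : ℕ} (hk : k < p.K) (hl0 : 0 < l)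
    (hl : l ≤ Ls + p.β ε k * H) :
    Real.log ((l + μ) * D ^ 2 / (2 * p.tol ε μ r k)) ≤ p.Gε ε μ Ls H D r := by
  have h1 := hp.Cβ_pos
  have h2 := hp.Cε_pos
  have hβ := hp.β_pos hε
  have hσ : 0 < p.σ := zero_lt_one.trans hp.one_lt_σ
  have hσ1 := sub_pos.2 hp.one_lt_σ
  have hs1 := hp.one_lt_sqrt
  have hg := hp.βg_pos hε
  have hlast : l + μ ≤ Ls + μ + H * (p.Cβ * (p.σ - 1) + p.βg ε * ε) / (p.σ * ε) := by
    rw [mul_div_assoc, ← hp.β_last hε]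
    have := mul_le_mul_of_nonneg_right (hp.β_le_last hε hk) hH
    linarith
  have hpos : 0 < l + μ := by positivity
  have hpos2 := hpos.trans_le hlast
  have hA : 0 < p.Cβ * D ^ 2 / (ε * p.Cε) := by positivity
  cases r with
  | constant =>
    rw [Gε, ← Real.log_mul hA.ne' hpos2.ne', tol]
    refine Real.log_le_log (by positivity) ?_
    have e : (l + μ) * D ^ 2 / (2 * (ε / 2 * (p.Cε / p.Cβ))) =
      p.Cβ * D ^ 2 / (ε * p.Cε) * (l + μ) := by field_simp
    rw [e]
    exact mul_le_mul_of_nonneg_left hlast hA.le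
  | adaptive =>
    have hss : 0 < p.σ - √p.σ := by
      nlinarith [Real.mul_self_sqrt hσ.le]
    have hW : 0 < p.Cβ * (p.σ - 1) + p.βg ε * ε := by positivity
    have hR : 0 < √((p.σ - 1) ^ 2 + p.βg ε * ε * (p.σ - 1) / p.Cβ) / (p.σ - √p.σ) := by
      positivity
    have hS0 : 0 < ∑ t ∈ Finset.range p.K, √(p.β ε t) :=
      Finset.sum_pos (fun t _ => Real.sqrt_pos.2 (hβ t)) hp.range_nonempty
    have hbk := Real.sqrt_pos.2 (hβ k)
    rw [Gε, ← Real.log_mul hA.ne' hpos2.ne', ← Real.log_mul (mul_pos hA hpos2).ne' hR.ne', tol,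
      if_neg hμ.ne']
    refine Real.log_le_log (by positivity) ?_
    -- Relative to the constant rule, the adaptive tolerance is smaller by at most the factor whose
    -- logarithm is the additional summand of `Gε`.
    have key : √(p.β ε k) * ∑ t ∈ Finset.range p.K, √(p.β ε t) ≤
        p.Cβ / ε * (√((p.σ - 1) ^ 2 + p.βg ε * ε * (p.σ - 1) / p.Cβ) / (p.σ - √p.σ)) := by
      refine (mul_le_mul (Real.sqrt_le_sqrt (hp.β_le_last hε hk)) (hp.sum_sqrt_β_le hε) hS0.le
        (Real.sqrt_nonneg _)).trans_eq ?_
      rw [hp.β_last hε, ← mul_div_assoc, ← Real.sqrt_mul (by positivity)]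
      have e1 : (p.Cβ * (p.σ - 1) + p.βg ε * ε) / (p.σ * ε) * (p.Cβ * (p.σ - 1) / ε) =
          (p.Cβ / ε) ^ 2 * ((p.σ - 1) ^ 2 + p.βg ε * ε * (p.σ - 1) / p.Cβ) / p.σ := by
        field_simp
      have e2 : p.σ - √p.σ = √p.σ * (√p.σ - 1) := by
        rw [mul_sub, Real.mul_self_sqrt hσ.le, mul_one]
      rw [e1, Real.sqrt_div' _ hσ.le, Real.sqrt_mul (by positivity), Real.sqrt_sq (by positivity),
        e2, div_div, mul_div_assoc]
    have e : (l + μ) * D ^ 2 / (2 * (p.Cε / 2 * (1 / (√(p.β ε k) *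
        ∑ t ∈ Finset.range p.K, √(p.β ε t))))) =
        (l + μ) * (D ^ 2 / p.Cε * (√(p.β ε k) * ∑ t ∈ Finset.range p.K, √(p.β ε t))) := by
      field_simp
    rw [e]
    have e3 : p.Cβ * D ^ 2 / (ε * p.Cε) = D ^ 2 / p.Cε * (p.Cβ / ε) := by field_simp
    rw [e3, mul_comm (D ^ 2 / p.Cε * (p.Cβ / ε)), mul_assoc, mul_assoc (D ^ 2 / p.Cε)]
    exact mul_le_mul hlast (mul_le_mul_of_nonneg_left key (by positivity)) (by positivity)
      hpos2.le

theorem Valid.sum_iterBound_strong (hp : p.Valid) (hε : 0 < ε) (hμ : 0 < μ) (hLs : 0 ≤ Ls)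
    (hH : 0 ≤ H) (hD : 0 ≤ D) (r : Rule) (hℓ0 : ∀ k < p.K, 0 < ℓ k)
    (hℓ : ∀ k < p.K, ℓ k ≤ Ls + p.β ε k * H) :
    ∑ k ∈ Finset.range p.K, iterBound μ D (ℓ k) (p.tol ε μ r k) ≤ p.boundStrong ε μ Ls H D r := by
  have h1 := hp.Cβ_pos
  have hσ1 := sub_pos.2 hp.one_lt_σ
  set g := max 0 (p.Gε ε μ Ls H D r) with hg
  have hg0 : 0 ≤ g := le_max_left _ _
  have key : ∀ k ∈ Finset.range p.K, iterBound μ D (ℓ k) (p.tol ε μ r k) ≤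
      2 * g * (√(Ls / μ) + √(H / μ) * √(p.β ε k)) + 1 := fun k hk => by
    have hk := Finset.mem_range.1 hk
    rw [iterBound, if_neg hμ.ne']
    have k1 : √(ℓ k / μ) ≤ √(Ls / μ) + √(H / μ) * √(p.β ε k) :=
      sqrt_le_of_le_add_mul (by positivity) (by positivity) (hp.β_pos hε k).le (by
        rw [mul_div_assoc', ← add_div]
        exact div_le_div_of_nonneg_right (hℓ k hk) hμ.le)
    have k2 : max 0 (Real.log ((ℓ k + μ) * D ^ 2 / (2 * p.tol ε μ r k))) ≤ g := by
      -- For `D = 0` the logarithm in `iterBound` is `log 0 = 0`, so the count needs no estimate of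
      -- `Gε`.
      rcases hD.eq_or_lt with rfl | hD
      · simpa using hg0
      · exact max_le_max le_rfl (hp.log_le_Gε hε hμ hH hD r hk (hℓ0 k hk) (hℓ k hk))
    have k3 := mul_le_mul k1 k2 (le_max_left _ _) (by positivity)
    linarith
  refine (Finset.sum_le_sum key).trans ?_
  rw [Finset.sum_add_distrib, ← Finset.mul_sum, Finset.sum_add_distrib, ← Finset.mul_sum]
  simp only [Finset.sum_const, Finset.card_range, nsmul_eq_mul, mul_one, boundStrong, ← hg]
  have k3 : ∑ k ∈ Finset.range p.K, √(p.β ε k) ≤ √(p.Cβ * (p.σ - 1)) / (√ε * (√p.σ - 1)) := by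
    refine (hp.sum_sqrt_β_le hε).trans_eq ?_
    rw [Real.sqrt_div' _ hε.le, div_div]
  have k4 := mul_le_mul_of_nonneg_left (mul_le_mul_of_nonneg_left k3 (Real.sqrt_nonneg (H / μ)))
    (show 0 ≤ 2 * g by positivity)
  linarith

theorem Valid.sum_le_evalBound (hp : p.Valid) (hε : 0 < ε) (hμ : 0 ≤ μ) (hLs : 0 ≤ Ls)
    (hH : 0 ≤ H) (hD : 0 ≤ D) (r : Rule) (hℓ0 : ∀ k < p.K, μ ≤ ℓ k / 4)
    (hℓ : ∀ k < p.K, ℓ k ≤ Ls + p.β ε k * H) {t : ℕ → ℕ}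
    (ht : ∀ k < p.K, (t k : ℝ) ≤ iterBound μ D (ℓ k) (p.tol ε μ r k)) :
    ((∑ k ∈ Finset.range p.K, t k : ℕ) : ℤ) ≤ p.evalBound ε μ Ls H D r := by
  have h1 : ((∑ k ∈ Finset.range p.K, t k : ℕ) : ℝ) ≤
      ∑ k ∈ Finset.range p.K, iterBound μ D (ℓ k) (p.tol ε μ r k) := by
    push_cast
    exact Finset.sum_le_sum fun k hk => ht k (Finset.mem_range.1 hk)
  rw [evalBound]
  rcases hμ.eq_or_lt with rfl | hμ
  · rw [if_pos rfl, Int.le_ceil_iff]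
    push_cast at h1 ⊢
    cases r with
    | constant => linarith [hp.sum_iterBound_convex_constant hε hLs hH hD hℓ]
    | adaptive => linarith [hp.sum_iterBound_convex_adaptive hε hLs hH hD hℓ]
  · rw [if_neg hμ.ne', Int.le_ceil_iff]
    push_cast at h1 ⊢
    linarith [hp.sum_iterBound_strong hε hμ hLs hH hD r
      (fun k hk => by linarith [hℓ0 k hk]) hℓ]

end Params

/-! ### The outer loop -/

theorem lipConst_le {m : ℕ} (c : Consts m) {β M : ℝ} {z : E m} (hz : ‖z‖ ≤ M) :
    lipConst c β z ≤ c.L₀ + ‖(WithLp.toLp 2 c.L : E m)‖ * M + β * c.H := by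
  have h1 : ∑ i, c.L i * |z i| ≤ ‖(WithLp.toLp 2 c.L : E m)‖ * M := by
    let z' : E m := WithLp.toLp 2 fun i => |z i|
    have h2 : ‖z'‖ ≤ ‖z‖ := norm_le_norm_of_abs_le fun i => (abs_abs (z i)).le
    have h3 := real_inner_le_norm z' (WithLp.toLp 2 c.L : E m)
    have h4 : inner ℝ z' (WithLp.toLp 2 c.L : E m) = ∑ i, c.L i * |z i| := by
      rw [PiLp.inner_apply]
      simp [z']
    rw [h4, mul_comm] at h3
    exact h3.trans (mul_le_mul_of_nonneg_left (h2.trans hz) (norm_nonneg _))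
  rw [lipConst, Finset.sum_add_distrib, Consts.H, Finset.mul_sum]
  simp only [mul_assoc] at h1 ⊢
  linarith

/-- The outer argument uses the solver only through `Reaches`. Stopping at the first acceptable
iterate makes `t k` at most the index that `Reaches` provides. -/
theorem runsWithin_of_reaches {n m : ℕ} {S : SimplePart n} (hS : S.Admissible) {μ : ℝ} (hμ : 0 ≤ μ)
    {A : Set (E n)} (hA : S.C ⊆ A) {R : Solver n} (hR : R.Reaches S A μ) {P : SmoothPart n m}
    {c : Consts m} {xs : E n} {zs : E m} {p : Params} {ε : ℝ} (r : Rule) (hP : P.RegularOn A μ c)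
    (hμL : μ ≤ c.L₀ / 4) (hK : IsKKT S P xs zs) (hp : p.Valid) (hε : 0 < ε) :
    RunsWithin S P c R (p.β ε) (p.tol ε μ r) p.K
      (p.evalBound ε μ (c.Lstar p.Cε zs) c.H S.D r) := by
  have hβ := hp.β_pos hε
  have hne : A.Nonempty := ⟨xs, hA hK.mem⟩
  have hL : ∀ k z, c.L₀ ≤ lipConst c (p.β ε k) z := fun k z => hP.L₀_le_lipConst hne (hβ k) z
  have inner : ∀ k (x : E n) (z : E m), x ∈ S.C →
      (∃ y, R (gradF P (p.β ε k) z) (lipConst c (p.β ε k) z) x y) ∧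
      ∀ y, R (gradF P (p.β ε k) z) (lipConst c (p.β ε k) z) x y →
        ∃ j : ℕ, (j : ℝ) ≤ iterBound μ S.D (lipConst c (p.β ε k) z) (p.tol ε μ r k) ∧
          IsApproxMin S P (p.β ε k) z (p.tol ε μ r k) (y j) := fun k x z hx => by
    obtain ⟨h1, h2⟩ := hR _ _ _ x (hP.firstOrderModel (hβ k) z)
      (hP.L₀_nonneg.trans (hL k z)) (by linarith [hL k z]) hx
    refine ⟨h1, fun y hy => ?_⟩
    obtain ⟨j, hj, hm, hle⟩ := h2 y hy _ (hp.tol_pos hε r k)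
    exact ⟨j, hj, hm, fun u hu => by simpa only [augLag_eq] using hle u hu⟩
  intro x₀ hx₀
  constructor
  -- The outer iterate is carried as an element of `S.C`, since each inner run must start there.
  · have step : ∀ k (x : S.C) (z : E m), ∃ (t : ℕ) (x' : S.C) (y : ℕ → E n),
        R (gradF P (p.β ε k) z) (lipConst c (p.β ε k) z) x y ∧
        IsLeast {j | IsApproxMin S P (p.β ε k) z (p.tol ε μ r k) (y j)} t ∧ (x' : E n) = y t :=
      fun k x z => by
      classical
      obtain ⟨⟨y, hy⟩, h2⟩ := inner k x z x.2
      have hex : ∃ j, IsApproxMin S P (p.β ε k) z (p.tol ε μ r k) (y j) :=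
        let ⟨j, _, hj⟩ := h2 y hy; ⟨j, hj⟩
      exact ⟨Nat.find hex, ⟨y (Nat.find hex), (Nat.find_spec hex).1⟩, y, hy,
        ⟨Nat.find_spec hex, fun j hj => Nat.find_min' hex hj⟩, rfl⟩
    choose t x' y hy using step
    let s : ℕ → S.C × E m := fun k => Nat.rec (⟨x₀, hx₀⟩, 0) (fun k q => (x' k q.1 q.2,
      WithLp.toLp 2 fun i => q.2 i + p.β ε k *
        max (-(q.2 i) / p.β ε k) (P.f i (x' k q.1 q.2)))) k
    refine ⟨fun k => (s k).1, fun k => (s k).2, fun k => t k (s k).1 (s k).2, rfl,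
      ⟨rfl, fun k _ => ?_, fun k _ i => rfl⟩, fun k _ => ⟨_, hy k (s k).1 (s k).2⟩⟩
    obtain ⟨-, h2, h3⟩ := hy k (s k).1 (s k).2
    change IsApproxMin S P _ _ _ ((x' k (s k).1 (s k).2 : S.C) : E n)
    rw [h3]
    exact h2.1
  · intro x z t hx0 halm hsol
    have hP' := hP.mono hA hS.convex_C
    have hx : ∀ k ≤ p.K, x k ∈ S.C := fun k hk => by
      cases k with
      | zero => rwa [hx0]
      | succ k => exact (halm.x_step k hk).1
    refine hp.sum_le_evalBound (ℓ := fun k => lipConst c (p.β ε k) (z k)) hε hμ ?_ (hP.H_nonneg hne)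
      Metric.diam_nonneg r (fun k _ => by linarith [hL k (z k)]) (fun k hk => ?_) fun k hk => ?_
    · have := hP.L₀_nonneg
      unfold Consts.Lstar
      positivity
    · exact lipConst_le c
        (halm.norm_z_le hβ (hp.tol_pos hε r) hK hP' (hp.sum_β_mul_tol hε r) hk.le)
    · obtain ⟨y, hRy, hleast, -⟩ := hsol k hk
      obtain ⟨j, hj, hmin⟩ := (inner k (x k) (z k) (hx k hk.le)).2 y hRy
      exact (Nat.cast_le.2 (hleast.2 hmin)).trans hj

/-! ### Order of the bounds as the accuracy tends to zero -/

namespace Params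

variable {p : Params} {ε μ Ls H D : ℝ}

theorem abs_ceil_le {b : ℝ} (hb : 0 ≤ b) : ‖((⌈b⌉ : ℤ) : ℝ)‖ ≤ b + 1 := by
  rw [Real.norm_of_nonneg (by exact_mod_cast Int.ceil_nonneg hb)]
  exact (Int.ceil_lt_add_one b).le

theorem sqrt_div_le_mul_inv (a : ℝ) (hε : 0 < ε) (hε1 : ε ≤ 1) :
    √(a / ε) ≤ √a * ε⁻¹ := by
  rw [Real.sqrt_div' _ hε.le, div_eq_mul_inv]
  refine mul_le_mul_of_nonneg_left (inv_anti₀ hε ?_) (Real.sqrt_nonneg a)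
  exact Real.le_sqrt_of_sq_le (by nlinarith)

theorem Valid.boundConvex_le (hp : p.Valid) (Ls : ℝ) (hD : 0 ≤ D) (r : Rule) :
    ∃ M, ∀ ε, 0 < ε → ε ≤ 1 →
      0 ≤ p.boundConvex ε Ls H D r ∧ p.boundConvex ε Ls H D r ≤ M * ε⁻¹ := by
  have hs1 := sub_pos.2 hp.one_lt_sqrt
  have hσ1 := sub_pos.2 hp.one_lt_σ
  have hσ : 0 < p.σ := zero_lt_one.trans hp.one_lt_σ
  have h6 := sub_pos.2 (Real.one_lt_rpow hp.one_lt_σ (z := 1 / 6) (by norm_num))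
  have h23 := sub_pos.2 (Real.one_lt_rpow hp.one_lt_σ (z := 2 / 3) (by norm_num))
  have key : ∀ q a b K : ℝ, 0 ≤ q → 0 ≤ a → 0 ≤ b → 0 ≤ K → ∃ M, ∀ ε : ℝ, 0 < ε → ε ≤ 1 →
      0 ≤ q * (√(Ls / ε) * a + b * ε⁻¹) + K ∧
      q * (√(Ls / ε) * a + b * ε⁻¹) + K ≤ M * ε⁻¹ := fun q a b K hq ha hb hK => by
    refine ⟨q * (√Ls * a + b) + K, fun ε hε hε1 => ⟨by positivity, ?_⟩⟩
    have k1 := mul_le_mul_of_nonneg_left (mul_le_mul_of_nonneg_right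
      (sqrt_div_le_mul_inv Ls hε hε1) ha) hq
    have k2 := mul_le_mul_of_nonneg_left ((one_le_inv₀ hε).2 hε1) hK
    linarith
  have hq : 0 ≤ 2 * D * √(p.Cβ / p.Cε) := by positivity
  cases r with
  | constant =>
    obtain ⟨M, hM⟩ := key _ p.K (√(p.Cβ * H * (p.σ - 1)) / (√p.σ - 1)) p.K hq (by positivity)
      (by positivity) (by positivity)
    refine ⟨M, fun ε hε hε1 => ?_⟩
    have e : p.boundConvex ε Ls H D .constant = 2 * D * √(p.Cβ / p.Cε) * (√(Ls / ε) * p.K +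
        √(p.Cβ * H * (p.σ - 1)) / (√p.σ - 1) * ε⁻¹) + p.K := by
      rw [boundConvex, mul_comm (p.K : ℝ), div_mul_eq_div_div_swap, ← div_eq_mul_inv _ ε]
    rw [e]
    exact hM ε hε hε1
  | adaptive =>
    obtain ⟨M, hM⟩ := key _ ((p.σ - 1) ^ (1 / 2 : ℝ) /
      ((p.σ ^ (1 / 6 : ℝ) - 1) * (p.σ ^ (2 / 3 : ℝ) - 1) ^ (1 / 2 : ℝ)))
      (√(H * p.Cβ) * (p.σ - 1) / (p.σ ^ (2 / 3 : ℝ) - 1) ^ (3 / 2 : ℝ)) p.K hq (by positivity)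
      (by positivity) (by positivity)
    refine ⟨M, fun ε hε hε1 => ?_⟩
    have e := hM ε hε hε1
    rw [← div_eq_mul_inv _ ε, ← div_mul_eq_div_div_swap] at e
    exact e

theorem log_div_le (c : ℝ) (hε : ε ≠ 0) : Real.log (c / ε) ≤ |Real.log c| + |Real.log ε| := by
  rcases eq_or_ne c 0 with rfl | hc
  · simp
  · rw [Real.log_div hc hε]
    linarith [le_abs_self (Real.log c), neg_abs_le (Real.log ε)]

/-- The product does not depend on `ε`, so in `Gε` the accuracy appears only through the visible
powers of `ε`. -/
theorem Valid.βg_mul_self (hp : p.Valid) (hε : 0 < ε) :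
    p.βg ε * ε = p.Cβ * ((p.σ - 1) / (p.σ ^ p.K - 1)) := by
  have := (sub_pos.2 hp.one_lt_pow).ne'
  unfold βg
  field_simp

theorem Valid.Gε_le (hp : p.Valid) (hμ : 0 < μ) (hLs : 0 ≤ Ls) (hH : 0 ≤ H) (r : Rule) :
    ∃ M, 0 ≤ M ∧ ∀ ε, 0 < ε → ε ≤ 1 → 1 ≤ |Real.log ε| →
      max 0 (p.Gε ε μ Ls H D r) ≤ M * |Real.log ε| := by
  have h1 := hp.Cβ_pos
  have hσ : 0 < p.σ := zero_lt_one.trans hp.one_lt_σ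
  have hσ1 := sub_pos.2 hp.one_lt_σ
  set w := p.Cβ * ((p.σ - 1) / (p.σ ^ p.K - 1)) with hw
  have hw0 : 0 ≤ w := by have := sub_pos.2 hp.one_lt_pow; positivity
  set c₀ := |Real.log (p.Cβ * D ^ 2 / p.Cε)|
  set c₁ := |Real.log (Ls + μ + H * (p.Cβ * (p.σ - 1) + w) / p.σ)|
  set c₂ := |Real.log (√((p.σ - 1) ^ 2 + w * (p.σ - 1) / p.Cβ) / (p.σ - √p.σ))|
  refine ⟨c₀ + c₁ + c₂ + 2, by positivity, fun ε hε hε1 hlog => max_le (by positivity) ?_⟩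
  have k1 : Real.log (p.Cβ * D ^ 2 / (ε * p.Cε)) ≤ c₀ + |Real.log ε| := by
    rw [div_mul_eq_div_div_swap]
    exact log_div_le _ hε.ne'
  have k2 : Real.log (Ls + μ + H * (p.Cβ * (p.σ - 1) + p.βg ε * ε) / (p.σ * ε)) ≤
      c₁ + |Real.log ε| := by
    refine le_trans (Real.log_le_log ?_ ?_) (log_div_le _ hε.ne')
    · rw [hp.βg_mul_self hε]; positivity
    · rw [hp.βg_mul_self hε, ← hw, add_div, div_mul_eq_div_div]
      exact add_le_add_left (le_div_self (by positivity) hε hε1) _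
  have k3 : c₀ + c₁ + c₂ + 2 * |Real.log ε| ≤ (c₀ + c₁ + c₂ + 2) * |Real.log ε| := by
    have := mul_le_mul_of_nonneg_left hlog (show 0 ≤ c₀ + c₁ + c₂ by positivity)
    linarith
  have hc₂ : 0 ≤ c₂ := abs_nonneg _
  cases r with
  | constant => rw [Gε]; linarith
  | adaptive =>
    have k4 := le_abs_self (Real.log (√((p.σ - 1) ^ 2 + w * (p.σ - 1) / p.Cβ) / (p.σ - √p.σ)))
    rw [Gε]
    rw [hp.βg_mul_self hε, ← hw] at k2 ⊢
    linarith

theorem Valid.boundStrong_le (hp : p.Valid) (hμ : 0 < μ) (hLs : 0 ≤ Ls) (hH : 0 ≤ H) (r : Rule) :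
    ∃ M, ∀ ε, 0 < ε → ε ≤ 1 → 1 ≤ |Real.log ε| →
      0 ≤ p.boundStrong ε μ Ls H D r ∧
      p.boundStrong ε μ Ls H D r + 1 ≤ M * (ε ^ (-(1 / 2) : ℝ) * |Real.log ε|) := by
  obtain ⟨M, hM0, hM⟩ := hp.Gε_le (D := D) hμ hLs hH r
  have hs1 := sub_pos.2 hp.one_lt_sqrt
  set a := p.K * √(Ls / μ)
  set b := √(H / μ) * (√(p.Cβ * (p.σ - 1)) / (√p.σ - 1))
  have ha : 0 ≤ a := by positivity
  have hb : 0 ≤ b := by positivity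
  refine ⟨2 * M * (a + b) + p.K + 1, fun ε hε hε1 hlog => ?_⟩
  have e : p.boundStrong ε μ Ls H D r =
      2 * max 0 (p.Gε ε μ Ls H D r) * (a + b * (√ε)⁻¹) + p.K := by
    rw [boundStrong, div_mul_eq_div_div_swap, div_eq_mul_inv _ √ε]
    simp only [a, b]
    ring
  have hr : ε ^ (-(1 / 2) : ℝ) = (√ε)⁻¹ := by rw [Real.rpow_neg hε.le, Real.sqrt_eq_rpow]
  have hg : 0 ≤ max 0 (p.Gε ε μ Ls H D r) := le_max_left _ _
  have hi : 1 ≤ (√ε)⁻¹ := (one_le_inv₀ (Real.sqrt_pos.2 hε)).2 (Real.sqrt_le_one.2 hε1)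
  rw [e, hr]
  refine ⟨by positivity, ?_⟩
  have k1 : a + b * (√ε)⁻¹ ≤ (a + b) * (√ε)⁻¹ := by
    linarith [mul_le_mul_of_nonneg_left hi ha]
  have k2 := mul_le_mul (hM ε hε hε1 hlog) k1 (by positivity) (by positivity)
  have k3 : 1 ≤ (√ε)⁻¹ * |Real.log ε| := one_le_mul_of_one_le_of_one_le hi hlog
  have k4 := mul_le_mul_of_nonneg_left k3 (show (0 : ℝ) ≤ p.K + 1 by positivity)
  linarith

theorem Valid.evalBound_isBigO_convex (hp : p.Valid) (Ls H : ℝ) (hD : 0 ≤ D) (r : Rule) :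
    (fun ε : ℝ => (p.evalBound ε 0 Ls H D r : ℝ)) =O[nhdsWithin 0 (Set.Ioi 0)]
      fun ε : ℝ => ε⁻¹ := by
  obtain ⟨M, hM⟩ := hp.boundConvex_le (H := H) Ls hD r
  refine Asymptotics.IsBigO.of_bound (M + 1) ?_
  filter_upwards [Ioc_mem_nhdsGT (zero_lt_one (α := ℝ))] with ε hε
  obtain ⟨h0, h1⟩ := hM ε hε.1 hε.2
  have h2 := (one_le_inv₀ hε.1).2 hε.2
  rw [evalBound, if_pos rfl, Real.norm_of_nonneg (inv_pos.2 hε.1).le]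
  linarith [abs_ceil_le h0]

theorem Valid.evalBound_isBigO_strong (hp : p.Valid) (hμ : 0 < μ) (hLs : 0 ≤ Ls) (hH : 0 ≤ H)
    (D : ℝ) (r : Rule) :
    (fun ε : ℝ => (p.evalBound ε μ Ls H D r : ℝ)) =O[nhdsWithin 0 (Set.Ioi 0)]
      fun ε : ℝ => ε ^ (-(1 / 2) : ℝ) * |Real.log ε| := by
  obtain ⟨M, hM⟩ := hp.boundStrong_le (D := D) hμ hLs hH r
  refine Asymptotics.IsBigO.of_bound M ?_
  -- Below `exp (-1)` one has `|log ε| ≥ 1`, which absorbs the constants, among them the `1` from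
  -- rounding up.
  filter_upwards [Ioc_mem_nhdsGT (Real.exp_pos (-1))] with ε hε
  have h1 : ε ≤ 1 := hε.2.trans (Real.exp_le_one_iff.2 (by norm_num))
  have hlog : Real.log ε ≤ -1 := (Real.log_le_iff_le_exp hε.1).2 hε.2
  obtain ⟨h0, h2⟩ := hM ε hε.1 h1 ((by linarith : 1 ≤ -Real.log ε).trans (neg_le_abs _))
  have := Real.rpow_nonneg hε.1.le (-(1 / 2))
  rw [evalBound, if_neg hμ.ne',
    Real.norm_of_nonneg (show 0 ≤ ε ^ (-(1 / 2) : ℝ) * |Real.log ε| by positivity)]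
  exact (abs_ceil_le h0).trans h2

end Params

end IALM

end

theorem mainTheorem7 {n m : ℕ} (S : IALM.SimplePart n) (hS : S.Admissible) (μ : ℝ) (hμ : 0 ≤ μ) :
    -- error bounds for the last iterate of every run
    (∀ (P : IALM.SmoothPart n m) (c : IALM.Consts m) (xs : IALM.E n) (zs : IALM.E m)
      (p : IALM.Params) (ε : ℝ) (r : IALM.Rule) (x : ℕ → IALM.E n) (z : ℕ → IALM.E m),
      P.RegularOn S.C μ c → IALM.IsKKT S P xs zs → p.Valid → 0 < ε →
      IALM.IsALM S P (p.β ε) (p.tol ε μ r) p.K x z →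
        |IALM.obj S P (x p.K) - IALM.obj S P xs| ≤
          ε / 2 * (p.Cε / p.Cβ) + ε * p.σ / (p.Cβ * (p.σ - 1)) *
            (2 * ‖zs‖ + √p.Cε) * (5 * ‖zs‖ + 7 / 2 * √p.Cε) ∧
        ‖IALM.violation P (x p.K)‖ ≤
          ε * p.σ / (p.Cβ * (p.σ - 1)) * (5 * ‖zs‖ + 7 / 2 * √p.Cε)) ∧
    -- gradient evaluations with Nesterov's method, whose points of evaluation may leave
    -- `dom h ∩ X` by at most its diameter
    (∀ (P : IALM.SmoothPart n m) (c : IALM.Consts m) (xs : IALM.E n) (zs : IALM.E m)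
      (p : IALM.Params) (ε : ℝ) (r : IALM.Rule),
      P.RegularOn S.nbhd μ c → μ ≤ c.L₀ / 4 → IALM.IsKKT S P xs zs → p.Valid → 0 < ε →
        IALM.RunsWithin S P c (IALM.nesterov S μ) (p.β ε) (p.tol ε μ r) p.K
          (p.evalBound ε μ (c.Lstar p.Cε zs) c.H S.D r)) ∧
    -- the same number of evaluations for a first-order method that evaluates gradients in
    -- `dom h ∩ X` only, with regularity on that set only
    (∃ M : IALM.FirstOrderMethod n,
      (∀ ℓ, ∀ x₀ ∈ S.C, ∀ hist, M.query ℓ x₀ hist ∈ S.C) ∧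
      ∀ (P : IALM.SmoothPart n m) (c : IALM.Consts m) (xs : IALM.E n) (zs : IALM.E m)
        (p : IALM.Params) (ε : ℝ) (r : IALM.Rule),
        P.RegularOn S.C μ c → μ ≤ c.L₀ / 4 → IALM.IsKKT S P xs zs → p.Valid → 0 < ε →
          IALM.RunsWithin S P c M.solver (p.β ε) (p.tol ε μ r) p.K
            (p.evalBound ε μ (c.Lstar p.Cε zs) c.H S.D r)) ∧
    -- the order of the bound as `ε → 0`, all other quantities being fixed
    (∀ (p : IALM.Params) (Ls H D : ℝ) (r : IALM.Rule),
      p.Valid → 0 ≤ Ls → 0 ≤ H → 0 ≤ D →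
        (μ = 0 → (fun ε : ℝ => (p.evalBound ε μ Ls H D r : ℝ)) =O[nhdsWithin 0 (Set.Ioi 0)]
          fun ε : ℝ => ε⁻¹) ∧
        (0 < μ → (fun ε : ℝ => (p.evalBound ε μ Ls H D r : ℝ)) =O[nhdsWithin 0 (Set.Ioi 0)]
          fun ε : ℝ => ε ^ (-(1 / 2) : ℝ) * |Real.log ε|)) := by
  refine ⟨fun P c xs zs p ε r x z hP hK hp hε h => h.errors_last hP hK hp hε,
    fun P c xs zs p ε r hP hμL hK hp hε =>
      IALM.runsWithin_of_reaches hS hμ (Metric.self_subset_cthickening _)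
        (IALM.nesterov_reaches hS hμ) r hP hμL hK hp hε,
    ⟨IALM.safeMethod S μ, fun ℓ x₀ hx₀ hist => IALM.safeMethod_query_mem hS hx₀ hist,
      fun P c xs zs p ε r hP hμL hK hp hε =>
        IALM.runsWithin_of_reaches hS hμ subset_rfl
          (IALM.safeMethod_reaches hS hμ) r hP hμL hK hp hε⟩,
    fun p Ls H D r hp hLs hH hD => ⟨?_, fun hμ => hp.evalBound_isBigO_strong hμ hLs hH D r⟩⟩
  rintro rfl
  exact hp.evalBound_isBigO_convex Ls H hD r
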